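/- Let $\mathbb F$ be a field of characteristic $p>2$, let $k,l\ge 1$ and $\underline m=(m_1,\dots,m_k)$ with all $m_i\ge 1$. Let $\mathcal O=\mathcal O(k,l,\underline m)$ be the tensor product of the truncated divided power algebra with basis $x^{(\alpha)}$, $0\le\alpha_i\le p^{m_i}-1$, and the exterior superalgebra in $\xi_1,\dots,\xi_l$. It has the basis $x^{(\alpha)}\xi^u$, $u\subseteq\{1,\dots,l\}$, the $\mathbb Z$-degree $|\alpha|+|u|$ and the $\mathbb Z_2$-degree $|u|$ mod $2$. Write $d(\cdot)$ for $\mathbb Z_2$-degrees of homogeneous elements. Let $\partial_1,\dots,\partial_{k+l}$ be the derivations $D_1,\dots,D_k,d_1,\dots,d_l$ with $D_i(x^{(\alpha)}\xi^u)=x^{(\alpha-\varepsilon_i)}\xi^u$ and $d_j(x^{(\alpha)}\xi^u)=(-1)^{u(j)}x^{(\alpha)}\xi^{u\setminus\{j\}}$, where $u(j)=\#\{r\in u: r<j\}$ (the value is $0$ if $j\notin u$), let $x_1,\dots,x_{k+l}$ be the corresponding variables, and $|s|\in\mathbb Z_2$ the degree of $x_s$. Let $L$ be one of the following $\mathbb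 Z$-graded Lie superalgebras of Cartan type, with the super bracket of $\mathrm{End}_{\mathbb F}(\mathcal O)$: * $W(k,l,\underline m)=\{\sum_s f_s\partial_s: f_s\in\mathcal O\}$; * $S(k,l,\underline m)$, the span of all $D_{sr}(f)=(-1)^{|s||r|}\partial_s(f)\partial_r-(-1)^{(|s|+|r|)d(f)}\partial_r(f)\partial_s$ with $f\in\mathcal O$ homogeneous; * for even $k$, $H(k,l,\underline m)$, the span of the $D_H(f)=\sum_s\tau(s)(-1)^{|s|d(f)}\partial_s(f)\partial_{s'}$, where $f$ runs over the basis elements $x^{(\alpha)}\xi^u$ other than the one of top degree; here $s'=s+k/2$, $\tau(s)=1$ for $s\le k/2$, $s'=s-k/2$, $\tau(s)=-1$ for $k/2<s\le k$, and $s'=s$, $\tau(s)=1$ for odd variables. Put $K=L_0\oplus\bigoplus_{i>0}L_i$, let $z_i=D_i^{p^{m_i}}\in U(L)$, and let $\theta(L,K)$ be the subalgebra of the universal enveloping algebra $U(L)$ generated by $K$ and $z_1,\dots,z_k$. Let $\sigma(x)$ be the supertrace of the natural action of $x\in K$ on $L/K$. Let $V$ be a finite-dimensional ($\mathbb Z_2$-graded)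 $L_0$-module, regarded as a $K$-module on which $L_i$, $i>0$, acts trivially. Let $V_\sigma$ be the space $V$ with the twisted $K$-action $x\circ v=x\cdot v+\sigma(x)v$, made into a $\theta(L,K)$-module by letting each $z_i$ act by $0$ (this is well defined). Let $\mathrm{Ind}_K(V_\sigma)=U(L)\otimes_{\theta(L,K)}V_\sigma$ be the generalized reduced Verma module. Let the mixed product be the space $\mathcal O\otimes V$ on which $D=\sum_s f_s\partial_s\in L$ acts by $$D(b\otimes v)=D(b)\otimes v+\sum_{s,r}(-1)^{|r|\,d(\partial_r(f_s))+(|r|+|s|)d(b)}\;\partial_r(f_s)\,b\otimes (x_r\partial_s)\cdot v ;$$ this makes sense for an $L_0$-module $V$, because $\sum_{s,r}(-1)^{|r|d(\partial_r(f_s))}\partial_r(f_s)\otimes x_r\partial_s$ lies in $\mathcal O\otimes L_0$ for $D\in L$. Then $\mathrm{Ind}_K(V_\sigma)$ is isomorphic to the mixed product $\mathcal O\otimes V$ as an $L$-module: there is a bijective linear map $T:\mathrm{Ind}_K(V_\sigma)\to\mathcal O\otimes V$, homogeneous for the $\mathbb Z_2$-gradings, such that $x\cdot T(w)=(-1)^{d(x)d(T)}\,T(x\cdot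 w)$ for all homogeneous $x\in L$ and all $w$. -/

import Mathlib

open scoped TensorProduct

namespace CartanSuper

noncomputable section

/-! ## Signs and super brackets -/

/-- The sign `(-1)^a` in `F`, for `a` in the integers mod `2`. -/
def sgn (F : Type*) [Field F] (a : ZMod 2) : F := if a = 0 then 1 else -1

/-- The super bracket `x y - (-1)^(a b) y x` of two elements of `Z_2`-degrees `a` and `b`
of an associative superalgebra. -/
def sbr (F : Type*) [Field F] {A : Type*} [Ring A] [Algebra F A] (a b : ZMod 2) (x y : A) : A :=
  x * y - sgn F (a * b) • (y * x)

/-! ## The divided power superalgebra `O(k, l, m)` -/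

/-- Indices `(α, u)` of the basis elements `x^(α) ξ^u`, with `0 ≤ α_i ≤ p^(m_i) - 1` and `u` a
subset of the `l` odd indices. -/
abbrev Idx (p : ℕ) {k : ℕ} (m : Fin k → ℕ) (l : ℕ) : Type :=
  ((i : Fin k) → Fin (p ^ m i)) × Finset (Fin l)

/-- `O(k, l, m)`: the vector space with basis `x^(α) ξ^u`. -/
def O (F : Type*) [Field F] (p : ℕ) {k : ℕ} (m : Fin k → ℕ) (l : ℕ) : Type _ :=
  Idx p m l → F

instance (F : Type*) [Field F] (p : ℕ) {k : ℕ} (m : Fin k → ℕ) (l : ℕ) :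
    AddCommGroup (O F p m l) := inferInstanceAs (AddCommGroup (Idx p m l → F))

instance (F : Type*) [Field F] (p : ℕ) {k : ℕ} (m : Fin k → ℕ) (l : ℕ) :
    Module F (O F p m l) := inferInstanceAs (Module F (Idx p m l → F))

instance (F : Type*) [Field F] (p : ℕ) {k : ℕ} (m : Fin k → ℕ) (l : ℕ) :
    FiniteDimensional F (O F p m l) := inferInstanceAs (FiniteDimensional F (Idx p m l → F))

/-- The standard basis: `bas F p m l (α, u)` is the element `x^(α) ξ^u`. -/
def bas (F : Type*) [Field F] (p : ℕ) {k : ℕ} (m : Fin k → ℕ) (l : ℕ) :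
    Module.Basis (Idx p m l) F (O F p m l) := Pi.basisFun F (Idx p m l)

/-- The linear map with prescribed values on the basis elements `x^(α) ξ^u`. -/
def lin {F : Type*} [Field F] {p : ℕ} {k : ℕ} {m : Fin k → ℕ} {l : ℕ}
    {M : Type*} [AddCommGroup M] [Module F M] (g : Idx p m l → M) : O F p m l →ₗ[F] M :=
  (bas F p m l).constr F g

/-- Indices of the variables: `k` even ones and `l` odd ones. -/
abbrev Var (k l : ℕ) : Type := Fin k ⊕ Fin l

/-- The `Z_2`-degree of a variable. -/
def vpar {k l : ℕ} : Var k l → ZMod 2 := Sum.elim (fun _ => 0) (fun _ => 1)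

section Algebra

variable {F : Type*} [Field F] {p : ℕ} {k : ℕ} {m : Fin k → ℕ} {l : ℕ}

variable (F p m) in
/-- `x^(α) ξ^u` for an arbitrary exponent `α`; it is zero if some `α_i` exceeds `p^(m_i) - 1`. -/
def mono (α : Fin k → ℕ) (u : Finset (Fin l)) : O F p m l :=
  if h : ∀ i, α i < p ^ m i then bas F p m l (fun i => ⟨α i, h i⟩, u) else 0

/-- The sign `c` in `ξ^u ξ^t = c ξ^(u ∪ t)` for disjoint `u`, `t`: the parity of the number of
pairs in the wrong order. -/
def wedgeSign (F : Type*) [Field F] {l : ℕ} (u t : Finset (Fin l)) : F :=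
  (-1) ^ ((u ×ˢ t).filter (fun q => q.2 < q.1)).card

/-- The structure constant of the product `x^(α) ξ^u * x^(β) ξ^t`. -/
def mulCoeff (F : Type*) [Field F] {p : ℕ} {k : ℕ} {m : Fin k → ℕ} {l : ℕ} (a b : Idx p m l) : F :=
  if Disjoint a.2 b.2 then
    (∏ i, (((a.1 i : ℕ) + (b.1 i : ℕ)).choose (a.1 i : ℕ) : F)) * wedgeSign F a.2 b.2
  else 0

/-- The product of `O(k, l, m)`, as a bilinear map. -/
def mulO : O F p m l →ₗ[F] O F p m l →ₗ[F] O F p m l :=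
  lin fun a => lin fun b =>
    mulCoeff F a b • mono F p m (fun i => (a.1 i : ℕ) + (b.1 i : ℕ)) (a.2 ∪ b.2)

/-- The even derivation `D_i`: `x^(α) ξ^u ↦ x^(α - ε_i) ξ^u`. -/
def Deven (i : Fin k) : Module.End F (O F p m l) :=
  lin fun a =>
    if 0 < (a.1 i : ℕ) then
      mono F p m (fun r => (a.1 r : ℕ) - (if r = i then 1 else 0)) a.2
    else 0

/-- The odd derivation `d_j`: `x^(α) ξ^u ↦ (-1)^(u(j)) x^(α) ξ^(u - ⟨j⟩)`, where `u(j)` is the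
number of elements of `u` smaller than `j`; the value is zero if `j` is not in `u`. -/
def dodd (j : Fin l) : Module.End F (O F p m l) :=
  lin fun a =>
    if j ∈ a.2 then
      (-1 : F) ^ (a.2.filter (fun r => r < j)).card • bas F p m l (a.1, a.2.erase j)
    else 0

/-- All the derivations `D_1, …, D_k, d_1, …, d_l`. -/
def der (s : Var k l) : Module.End F (O F p m l) := Sum.elim Deven dodd s

variable (F p m) in
/-- The variables `x_i` and `ξ_j` as elements of `O(k, l, m)`. -/
def gen (s : Var k l) : O F p m l :=
  Sum.elim (fun i => mono F p m (fun r => if r = i then 1 else 0) ∅)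
    (fun j => mono F p m (fun _ => 0) {j}) s

/-- The parity automorphism `f ↦ (-1)^(d(f)) f` of `O(k, l, m)`. -/
def parAut : Module.End F (O F p m l) :=
  lin fun a => sgn F (a.2.card : ZMod 2) • bas F p m l a

/-- The `c`-th power of the parity automorphism: `f ↦ (-1)^(c d(f)) f`. -/
def parTwist (c : ZMod 2) : Module.End F (O F p m l) := if c = 0 then 1 else parAut

variable (F p m l) in
/-- The part of `O(k, l, m)` of `Z_2`-degree `c`. -/
def Opar (c : ZMod 2) : Submodule F (O F p m l) :=
  Submodule.span F {f | ∃ a : Idx p m l, (a.2.card : ZMod 2) = c ∧ f = bas F p m l a}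

variable (F p m l) in
/-- The part of `O(k, l, m)` of `Z`-degree `n`, where `zd(x^(α) ξ^u) = |α| + |u|`. -/
def Odeg (n : ℤ) : Submodule F (O F p m l) :=
  Submodule.span F {f | ∃ a : Idx p m l,
    ((∑ i, (a.1 i : ℕ) : ℕ) : ℤ) + (a.2.card : ℤ) = n ∧ f = bas F p m l a}

variable (F p m l) in
/-- Endomorphisms of `O(k, l, m)` of `Z_2`-degree `c`. -/
def Epar (c : ZMod 2) : Submodule F (Module.End F (O F p m l)) :=
  ⨅ b : ZMod 2, Submodule.compatibleMaps (Opar F p m l b) (Opar F p m l (b + c))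

variable (F p m l) in
/-- Endomorphisms of `O(k, l, m)` of `Z`-degree `n`. -/
def Edeg (n : ℤ) : Submodule F (Module.End F (O F p m l)) :=
  ⨅ b : ℤ, Submodule.compatibleMaps (Odeg F p m l b) (Odeg F p m l (b + n))

/-! ## The Lie superalgebras `W`, `S`, `H` of Cartan type

They are subspaces of `End (O(k, l, m))`, closed under the super bracket `sbr`. -/

/-- The derivation `f ∂_s`. -/
def fder (f : O F p m l) (s : Var k l) : Module.End F (O F p m l) := mulO f * der s

variable (F p m l) in
/-- `W(k, l, m)`: all the derivations `∑ f_s ∂_s`. -/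
def W : Submodule F (Module.End F (O F p m l)) :=
  Submodule.span F {D | ∃ (f : O F p m l) (s : Var k l), D = fder f s}

/-- For `f` of `Z_2`-degree `c`, the derivation
`D_{sr}(f) = (-1)^(|s||r|) ∂_s(f) ∂_r - (-1)^((|s|+|r|) d(f)) ∂_r(f) ∂_s`. -/
def Dsr (s r : Var k l) (c : ZMod 2) (f : O F p m l) : Module.End F (O F p m l) :=
  sgn F (vpar s * vpar r) • fder (der s f) r -
    sgn F ((vpar s + vpar r) * c) • fder (der r f) s

variable (F p m l) in
/-- `S(k, l, m)`: the span of all `D_{sr}(f)`. -/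
def S : Submodule F (Module.End F (O F p m l)) :=
  Submodule.span F {D | ∃ (s r : Var k l) (c : ZMod 2) (f : O F p m l),
    f ∈ Opar F p m l c ∧ D = Dsr s r c f}

/-- The pairing `s ↦ s'` of the variables: it exchanges `i` and `i + k/2` for even variables
(`k` even) and fixes the odd ones. -/
def conj : Var k l → Var k l :=
  Sum.map
    (fun i => if h : (i : ℕ) < k / 2 then ⟨i + k / 2, by omega⟩ else ⟨i - k / 2, by omega⟩) id

variable (F) in
/-- The sign attached to a variable: `1` for the first half of the even variables, `-1` for
the second half, `1` for odd variables. -/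
def hsign : Var k l → F := Sum.elim (fun i => if (i : ℕ) < k / 2 then 1 else -1) (fun _ => 1)

/-- For `f` of `Z_2`-degree `c`, the Hamiltonian derivation
`D_H(f) = ∑_s hsign(s) (-1)^(|s| d(f)) ∂_s(f) ∂_{s'}`. -/
def DH (c : ZMod 2) (f : O F p m l) : Module.End F (O F p m l) :=
  ∑ s : Var k l, (hsign F s * sgn F (vpar s * c)) • fder (der s f) (conj s)

variable (F p m l) in
/-- `H(k, l, m)` (used for even `k`): the span of the `D_H(x^(α) ξ^u)` where `(α, u)` is not
the index `(π, E)` of the basis element of top degree. -/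
def H : Submodule F (Module.End F (O F p m l)) :=
  Submodule.span F {D | ∃ a : Idx p m l,
    ¬ ((∀ i, (a.1 i : ℕ) = p ^ m i - 1) ∧ a.2 = Finset.univ) ∧
    D = DH (a.2.card : ZMod 2) (bas F p m l a)}

/-! ## The `Z`-gradation, the subalgebra `K`, and the character `σ` -/

/-- The component `L_n`. -/
def Lz (L : Submodule F (Module.End F (O F p m l))) (n : ℤ) :
    Submodule F (Module.End F (O F p m l)) := L ⊓ Edeg F p m l n

/-- `K = L_0 ⊕ L_1 ⊕ L_2 ⊕ ⋯`. -/
def K (L : Submodule F (Module.End F (O F p m l))) : Submodule F (Module.End F (O F p m l)) :=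
  ⨆ n : ℕ, Lz L (n : ℤ)

/-- The quotient space `L / K`. -/
abbrev LmodK (L : Submodule F (Module.End F (O F p m l))) : Type _ :=
  L ⧸ (K L).submoduleOf L

/-- The class in `L / K` of an element of `L`. -/
def cls (L : Submodule F (Module.End F (O F p m l))) (y : L) : LmodK L :=
  Submodule.Quotient.mk y

/-- `R` is the natural action on `L / K` of an element `x` of `K` of `Z_2`-degree `a`:
`R (y + K) = [x, y] + K`. -/
def IsNatRep (L : Submodule F (Module.End F (O F p m l))) (a : ZMod 2) (x : K L)
    (R : Module.End F (LmodK L)) : Prop :=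
  ∀ (b : ZMod 2) (y z : L), (y : Module.End F (O F p m l)) ∈ Epar F p m l b →
    (z : Module.End F (O F p m l)) = sbr F a b (x : Module.End F (O F p m l)) y →
    R (cls L y) = cls L z

/-- `g` is the parity involution of `L / K`. The supertrace of an endomorphism `R` of `L / K`
is the trace of `R ∘ g`. -/
def IsParInv (L : Submodule F (Module.End F (O F p m l)))
    (g : Module.End F (LmodK L)) : Prop :=
  ∀ (b : ZMod 2) (y : L), (y : Module.End F (O F p m l)) ∈ Epar F p m l b →
    g (cls L y) = sgn F b • cls L y

/-- `σ(x)` is the supertrace of the natural action of `x` on `L / K`, for every `x` in `K`.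
There is exactly one linear form `σ` of this kind. -/
def IsSigma (L : Submodule F (Module.End F (O F p m l))) (σ : K L →ₗ[F] F) : Prop :=
  ∀ (a : ZMod 2) (x : K L), (x : Module.End F (O F p m l)) ∈ Epar F p m l a →
    ∃ R g : Module.End F (LmodK L), IsNatRep L a x R ∧ IsParInv L g ∧
      σ x = LinearMap.trace F (LmodK L) (R * g)

/-! ## Modules over `L_0` -/

/-- A (`Z_2`-graded) module `V` over the Lie superalgebra `M`, for a space `M` of endomorphisms
of `O(k, l, m)` closed under the super bracket. -/
structure SuperRep (M : Submodule F (Module.End F (O F p m l)))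
    (V : Type*) [AddCommGroup V] [Module F V] where
  /-- the homogeneous parts of `V` -/
  grade : ZMod 2 → Submodule F V
  isInternal : DirectSum.IsInternal grade
  /-- the action -/
  act : M →ₗ[F] Module.End F V
  act_mem : ∀ (a b : ZMod 2) (x : M) (v : V), (x : Module.End F (O F p m l)) ∈ Epar F p m l a →
    v ∈ grade b → act x v ∈ grade (a + b)
  act_bracket : ∀ (a b : ZMod 2) (x y z : M), (x : Module.End F (O F p m l)) ∈ Epar F p m l a →
    (y : Module.End F (O F p m l)) ∈ Epar F p m l b →
    (z : Module.End F (O F p m l)) = sbr F a b (x : Module.End F (O F p m l)) y →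
    act z = sbr F a b (act x) (act y)

/-! ## The universal enveloping algebra and the subalgebra `θ(L, K)` -/

/-- The defining relations `x y - (-1)^(d(x) d(y)) y x = [x, y]` of `U(L)`. -/
inductive URel (L : Submodule F (Module.End F (O F p m l))) :
    TensorAlgebra F L → TensorAlgebra F L → Prop
  | bracket (a b : ZMod 2) (x y z : L) (hx : (x : Module.End F (O F p m l)) ∈ Epar F p m l a)
      (hy : (y : Module.End F (O F p m l)) ∈ Epar F p m l b)
      (hz : (z : Module.End F (O F p m l)) = sbr F a b (x : Module.End F (O F p m l)) y) :
      URel L (sbr F a b (TensorAlgebra.ι F x) (TensorAlgebra.ι F y)) (TensorAlgebra.ι F z)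

/-- The universal enveloping algebra `U(L)`. -/
def U (L : Submodule F (Module.End F (O F p m l))) : Type _ := RingQuot (URel L)

instance (L : Submodule F (Module.End F (O F p m l))) : Ring (U L) :=
  inferInstanceAs (Ring (RingQuot (URel L)))

instance (L : Submodule F (Module.End F (O F p m l))) : Algebra F (U L) :=
  inferInstanceAs (Algebra F (RingQuot (URel L)))

/-- The canonical map `L → U(L)`. -/
def ι (L : Submodule F (Module.End F (O F p m l))) : L →ₗ[F] U L :=
  (RingQuot.mkAlgHom F (URel L)).toLinearMap ∘ₗ TensorAlgebra.ι F

/-- Products of homogeneous elements of `L`, with the `Z_2`-degree of the product. -/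
inductive IsProd (L : Submodule F (Module.End F (O F p m l))) : ZMod 2 → U L → Prop
  | one : IsProd L 0 1
  | mul (a b : ZMod 2) (x : L) (y : U L) (hx : (x : Module.End F (O F p m l)) ∈ Epar F p m l a)
      (hy : IsProd L b y) : IsProd L (a + b) (ι L x * y)

/-- The part of `U(L)` of `Z_2`-degree `a`. -/
def Upar (L : Submodule F (Module.End F (O F p m l))) (a : ZMod 2) : Submodule F (U L) :=
  Submodule.span F {y | IsProd L a y}

/-- The central elements `z_i = D_i^(p^(m_i))` of `U(L)`. -/
def zset (L : Submodule F (Module.End F (O F p m l))) : Set (U L) :=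
  {z | ∃ (i : Fin k) (e : L), (e : Module.End F (O F p m l)) = Deven i ∧
    z = ι L e ^ p ^ m i}

/-- `θ(L, K)`: the subalgebra of `U(L)` generated by `K` and the `z_i`. -/
def theta (L : Submodule F (Module.End F (O F p m l))) : Subalgebra F (U L) :=
  Algebra.adjoin F ({y | ∃ x : L, (x : Module.End F (O F p m l)) ∈ K L ∧ y = ι L x} ∪ zset L)

section Modules

variable {V : Type*} [AddCommGroup V] [Module F V]
variable {L : Submodule F (Module.End F (O F p m l))}

/-- `A` is the `θ(L, K)`-module structure of `V_σ`, for an `L_0`-module `V`: an element `x` of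
`L_0` acts by `v ↦ x · v + σ(x) v`, an element `x` of `L_n`, `n > 0`, by
`v ↦ 0 + σ(x) v` (it acts trivially on `V`), and the `z_i` act by zero. As `θ(L, K)` is
generated by these elements, there is at most one such `A`. -/
structure IsTwistedAction (ρ : SuperRep (Lz L 0) V) (σ : K L →ₗ[F] F)
    (A : theta L →ₐ[F] Module.End F V) : Prop where
  zero : ∀ (t : theta L) (x : L) (h0 : (x : Module.End F (O F p m l)) ∈ Lz L 0)
    (hK : (x : Module.End F (O F p m l)) ∈ K L), (t : U L) = ι L x →
    A t = ρ.act ⟨x, h0⟩ + σ ⟨x, hK⟩ • 1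
  pos : ∀ (t : theta L) (n : ℤ), 0 < n → ∀ (x : L)
    (_ : (x : Module.End F (O F p m l)) ∈ Lz L n)
    (hK : (x : Module.End F (O F p m l)) ∈ K L), (t : U L) = ι L x →
    A t = σ ⟨x, hK⟩ • 1
  central : ∀ t : theta L, (t : U L) ∈ zset L → A t = 0

/-! ## The generalized reduced Verma module -/

/-- The relations `y t ⊗ v = y ⊗ t v`, for `t` in `θ(L, K)`. -/
def balanced (A : theta L →ₐ[F] Module.End F V) : Submodule F (U L ⊗[F] V) :=
  Submodule.span F {w | ∃ (y : U L) (t : theta L) (v : V),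
    w = (y * (t : U L)) ⊗ₜ[F] v - y ⊗ₜ[F] (A t v)}

/-- The induced module `U(L) ⊗_{θ(L, K)} V`, where `θ(L, K)` acts on `V` through `A`. -/
abbrev Ind (A : theta L →ₐ[F] Module.End F V) : Type _ := (U L ⊗[F] V) ⧸ balanced A

/-- The element `y ⊗ v` of the induced module. -/
def Ind.tmul (A : theta L →ₐ[F] Module.End F V) (y : U L) (v : V) : Ind A :=
  Submodule.Quotient.mk (y ⊗ₜ[F] v)

/-- The action of `U(L)` on the induced module: `y · (y' ⊗ v) = y y' ⊗ v`. -/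
def Ind.act (A : theta L →ₐ[F] Module.End F V) (y : U L) : Module.End F (Ind A) :=
  Submodule.mapQ (balanced A) (balanced A) ((LinearMap.mulLeft F y).rTensor V) (by
    refine Submodule.span_le.2 ?_
    rintro w ⟨y', t, v, rfl⟩
    refine Submodule.subset_span ⟨y * y', t, v, ?_⟩
    simp [mul_assoc])

/-- The part of the induced module of `Z_2`-degree `c`, with `d(y ⊗ v) = d(y) + d(v)`. -/
def Ind.par (ρ : SuperRep (Lz L 0) V) (A : theta L →ₐ[F] Module.End F V) (c : ZMod 2) :
    Submodule F (Ind A) :=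
  Submodule.span F {w | ∃ (a b : ZMod 2) (y : U L) (v : V),
    y ∈ Upar L a ∧ v ∈ ρ.grade b ∧ a + b = c ∧ w = Ind.tmul A y v}

/-! ## The mixed product -/

/-- An extension of the action of `L_0` on `V` to a linear map on all endomorphisms of
`O(k, l, m)`. In the mixed product only its values on `L_0` matter. -/
def extAct (ρ : SuperRep (Lz L 0) V) : Module.End F (O F p m l) →ₗ[F] Module.End F V :=
  Classical.choose (LinearMap.exists_extend (p := Lz L 0) ρ.act)

theorem extAct_eq (ρ : SuperRep (Lz L 0) V) (x : Lz L 0) :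
    extAct ρ (x : Module.End F (O F p m l)) = ρ.act x :=
  LinearMap.congr_fun (Classical.choose_spec (LinearMap.exists_extend (p := Lz L 0) ρ.act)) x

/-- The action of `D = ∑ f_s ∂_s`, where `f_s = D(x_s)`, on the mixed product `O(k, l, m) ⊗ V`:

`D (b ⊗ v) = D(b) ⊗ v + ∑_{s,r} ± ∂_r(f_s) b ⊗ (x_r ∂_s) v`

with the sign `(-1)^(|r| d(∂_r(f_s)) + (|r| + |s|) d(b))`. In other words `D` acts as
`D ⊗ 1` plus the element `∑_{s,r} (-1)^(|r| d(∂_r(f_s))) ∂_r(f_s) ⊗ x_r ∂_s`, which for `D` in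
`L` lies in `O(k, l, m) ⊗ L_0`, where `(a ⊗ g)(b ⊗ v) = (-1)^(d(g) d(b)) a b ⊗ g v`. -/
def mixed (ρ : SuperRep (Lz L 0) V) (D : L) : Module.End F (O F p m l ⊗[F] V) :=
  TensorProduct.map (D : Module.End F (O F p m l)) LinearMap.id +
    ∑ s : Var k l, ∑ r : Var k l,
      TensorProduct.map
        (mulO (parTwist (vpar r) (der r ((D : Module.End F (O F p m l)) (gen F p m s)))) *
          parTwist (vpar r + vpar s))
        (extAct ρ (fder (gen F p m r) s))

/-- The part of `O(k, l, m) ⊗ V` of `Z_2`-degree `c`. -/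
def mixedPar (ρ : SuperRep (Lz L 0) V) (c : ZMod 2) : Submodule F (O F p m l ⊗[F] V) :=
  Submodule.span F {w | ∃ (a b : ZMod 2) (f : O F p m l) (v : V),
    f ∈ Opar F p m l a ∧ v ∈ ρ.grade b ∧ a + b = c ∧ w = f ⊗ₜ[F] v}

/-- `T` is an isomorphism of `L`-modules, homogeneous of `Z_2`-degree `c`, from the induced module
to the mixed product: `x · T(w) = (-1)^(d(x) d(T)) T(x · w)`. -/
structure IsModuleIso (ρ : SuperRep (Lz L 0) V) (A : theta L →ₐ[F] Module.End F V)
    (c : ZMod 2) (T : Ind A ≃ₗ[F] (O F p m l ⊗[F] V)) : Prop where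
  homogeneous : ∀ (b : ZMod 2) (w : Ind A), w ∈ Ind.par ρ A b → T w ∈ mixedPar ρ (b + c)
  intertwines : ∀ (a : ZMod 2) (x : L), (x : Module.End F (O F p m l)) ∈ Epar F p m l a →
    ∀ w : Ind A, mixed ρ x (T w) = sgn F (a * c) • T (Ind.act A (ι L x) w)

end Modules

end Algebra

end

end CartanSuper

/-! The isomorphism comes from the universal property of the induced module and a dimension count.
Let `top` be the basis element of highest degree of O(k,l,m). In the mixed product, `L_n` with `n >
0` kills top ⊗ V for degree reasons, each `z_i` acts by zero because `D_i^(p^(m_i)) = 0` on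
O(k,l,m), and `x` in `L_0` sends top ⊗ v, up to the sign `(-1)^(l d(x))`, to top ⊗ xv plus the
contribution of `x(top)`. Applying `∂_q` to `x_r · top = 0` shows that `x(top)` is a multiple of top
(`fder_gen_top`, `apply_top`), and `IsGood.isSigma` identifies the factor with the supertrace on
L/K. So top ⊗ V is a copy of `V_σ`; the sign is absorbed by `shiftedAct` and makes the isomorphism
homogeneous of degree `l`. Restricting the action to top ⊗ V also yields the θ(L,K)-module structure
of `V_σ` (`IsGood.thetaAct`), so its existence needs no separate argument.

Hence y ⊗ v ↦ y · (top ⊗ v) is a well defined map `IsGood.indMap`. It is onto, because the `∂_s`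
lead from top to every basis element (`tensor_eq_top`). Its source is spanned by ordered monomials
in the `∂_s` applied to 1 ⊗ V, one for each basis index of O(k,l,m)
(`IsGood.monomialMap_surjective`), so its dimension is at most that of the target. A
Poincaré-Birkhoff-Witt theorem is not needed.

The main work is to show that the mixed product is an L-module at all (`IsGood.mixedLin_sbr`). For S
and H the single elements `x_r ∂_s` need not lie in `L_0`, so the formula cannot be checked term by
term. Instead, an element of O ⊗ V is zero as soon as its constant term and its images under all
`∂_s ⊗ 1` vanish (`tensor_eq_zero`). The elements `∂_s` act on the first factor only, and brackets
with them are respected whatever happens on V (`map_der_mul_mixedLin`). For elements of degree at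
least zero the constant term sees only the linear part (`eps_comp_mixedLin`), where the claim is the
representation property of V. The super Jacobi identity then gives an induction on the total degree.
The only facts about L that enter are those collected in `IsGood`; they are verified for W, S and H
in turn. -/

namespace CartanSuper

noncomputable section

set_option linter.unusedSectionVars false

/-! ### Signs, and reordering of odd variables -/

section Signs

variable {F : Type*} [Field F]

theorem sgn_zero : sgn F 0 = 1 := by simp [sgn]

theorem sgn_one : sgn F 1 = -1 := by simp [sgn]

theorem zmod_two_cases (a : ZMod 2) : a = 0 ∨ a = 1 := by revert a; decide

theorem sgn_add (a b : ZMod 2) : sgn F (a + b) = sgn F a * sgn F b := by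
  rcases zmod_two_cases a with rfl | rfl <;> rcases zmod_two_cases b with rfl | rfl <;>
    simp [sgn, show (1 : ZMod 2) + 1 = 0 by decide]

theorem sgn_mul_self (a : ZMod 2) : sgn F a * sgn F a = 1 := by
  rcases zmod_two_cases a with rfl | rfl <;> simp [sgn]

theorem sgn_ne_zero (a : ZMod 2) : sgn F a ≠ 0 := by
  rcases zmod_two_cases a with rfl | rfl <;> simp [sgn]

theorem sgn_natCast (n : ℕ) : sgn F (n : ZMod 2) = (-1) ^ n := by
  induction n with
  | zero => simp [sgn]
  | succ n ih => rw [Nat.cast_succ, sgn_add, ih, sgn_one, pow_succ]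

theorem sgn_eq_one_or (a : ZMod 2) : sgn F a = 1 ∨ sgn F a = -1 := by
  rcases zmod_two_cases a with rfl | rfl <;> simp [sgn]

theorem wedgeSign_insert_left {l : ℕ} {j : Fin l} {u : Finset (Fin l)} (hj : j ∉ u)
    (t : Finset (Fin l)) :
    wedgeSign F (insert j u) t = (-1) ^ (t.filter (fun r => r < j)).card * wedgeSign F u t := by
  simp only [wedgeSign, Finset.card_filter, Finset.sum_product, Finset.sum_insert hj, pow_add]

theorem wedgeSign_insert_right {l : ℕ} {j : Fin l} {t : Finset (Fin l)} (hj : j ∉ t)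
    (u : Finset (Fin l)) :
    wedgeSign F u (insert j t) = (-1) ^ (u.filter (fun r => j < r)).card * wedgeSign F u t := by
  simp only [wedgeSign, Finset.card_filter, Finset.sum_product_right, Finset.sum_insert hj, pow_add]

theorem card_filter_lt_add_gt {l : ℕ} {j : Fin l} {u : Finset (Fin l)} (hj : j ∉ u) :
    (u.filter (fun r => r < j)).card + (u.filter (fun r => j < r)).card = u.card := by
  rw [← Finset.card_union_of_disjoint]
  · congr 1
    ext x
    simp only [Finset.mem_union, Finset.mem_filter]
    constructor
    · tauto
    · intro h
      rcases lt_trichotomy x j with h' | rfl | h'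
      · exact Or.inl ⟨h, h'⟩
      · exact absurd h hj
      · exact Or.inr ⟨h, h'⟩
  · rw [Finset.disjoint_filter]
    intro x _ h h'
    exact absurd h (not_lt.2 h'.le)

end Signs

section Algebra

variable {F : Type*} [Field F] {p : ℕ} {k : ℕ} {m : Fin k → ℕ} {l : ℕ}

/-! ## Values on the basis -/

theorem lin_bas {M : Type*} [AddCommGroup M] [Module F M] (g : Idx p m l → M) (a : Idx p m l) :
    lin g (bas F p m l a) = g a := by
  simp [lin]

theorem mono_of_lt {α : Fin k → ℕ} (h : ∀ i, α i < p ^ m i) (u : Finset (Fin l)) :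
    mono F p m α u = bas F p m l (fun i => ⟨α i, h i⟩, u) := by
  simp [mono, h]

theorem mono_of_le {α : Fin k → ℕ} {i : Fin k} (h : p ^ m i ≤ α i) (u : Finset (Fin l)) :
    mono F p m α u = 0 := by
  rw [mono, dif_neg]
  intro h'
  exact absurd (h' i) (not_lt.2 h)

theorem bas_eq_mono (a : Idx p m l) : bas F p m l a = mono F p m (fun i => (a.1 i : ℕ)) a.2 := by
  rw [mono_of_lt (fun i => (a.1 i).2)]

theorem hom_ext {M : Type*} [AddCommGroup M] [Module F M] {f g : O F p m l →ₗ[F] M}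
    (h : ∀ α u, (∀ i, α i < p ^ m i) → f (mono F p m α u) = g (mono F p m α u)) : f = g := by
  refine (bas F p m l).ext fun a => ?_
  rw [bas_eq_mono]
  exact h _ _ fun i => (a.1 i).2

theorem Deven_mono (i : Fin k) {α : Fin k → ℕ} (h : ∀ i, α i < p ^ m i) (u : Finset (Fin l)) :
    Deven i (mono F p m α u) =
      if 0 < α i then mono F p m (fun r => α r - (if r = i then 1 else 0)) u else 0 := by
  rw [mono_of_lt h, Deven, lin_bas]

theorem dodd_mono (j : Fin l) (α : Fin k → ℕ) (u : Finset (Fin l)) :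
    dodd j (mono F p m α u) =
      if j ∈ u then (-1 : F) ^ (u.filter (fun r => r < j)).card • mono F p m α (u.erase j)
      else 0 := by
  by_cases h : ∀ i, α i < p ^ m i
  · rw [mono_of_lt h, mono_of_lt h, dodd, lin_bas]
  · push Not at h
    obtain ⟨i, hi⟩ := h
    simp [mono_of_le hi]

theorem parAut_mono (α : Fin k → ℕ) (u : Finset (Fin l)) :
    parAut (mono F p m α u) = sgn F (u.card : ZMod 2) • mono F p m α u := by
  by_cases h : ∀ i, α i < p ^ m i
  · rw [mono_of_lt h, parAut, lin_bas]
  · push Not at h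
    obtain ⟨i, hi⟩ := h
    simp [mono_of_le hi]

/-- The structure constant of the product of two monomials. -/
def monoCoeff (F : Type*) [Field F] {k l : ℕ} (α β : Fin k → ℕ) (u t : Finset (Fin l)) : F :=
  if Disjoint u t then (∏ i, ((α i + β i).choose (α i) : F)) * wedgeSign F u t else 0

/-- No bound on the exponents is required: if a factor is truncated to zero, the exponent of the
product is out of range as well, and both sides vanish. -/
theorem mulO_mono (α β : Fin k → ℕ) (u t : Finset (Fin l)) :
    mulO (mono F p m α u) (mono F p m β t) =
      monoCoeff F α β u t • mono F p m (fun i => α i + β i) (u ∪ t) := by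
  by_cases h : ∀ i, α i < p ^ m i
  · by_cases h' : ∀ i, β i < p ^ m i
    · rw [mono_of_lt h, mono_of_lt h', mulO, lin_bas, lin_bas]
      rfl
    · push Not at h'
      obtain ⟨i, hi⟩ := h'
      rw [mono_of_le hi, mono_of_le (α := fun i => α i + β i) (i := i) (le_add_left hi)]
      simp
  · push Not at h
    obtain ⟨i, hi⟩ := h
    rw [mono_of_le hi, mono_of_le (α := fun i => α i + β i) (i := i) (le_add_right hi)]
    simp

/-! ## The derivations -/

theorem dodd_comp_dodd (i j : Fin l) :
    (dodd i * dodd j : Module.End F (O F p m l)) = -(dodd j * dodd i) := by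
  refine hom_ext fun α u _ => ?_
  simp only [Module.End.mul_apply, LinearMap.neg_apply, dodd_mono]
  -- Removing the larger index does not affect the count below the smaller one, while removing the
  -- smaller index lowers the count below the larger one by one. This single step is the sign of the
  -- anticommutation.
  have key : ∀ i j : Fin l, i < j → i ∈ u → j ∈ u →
      ((u.erase j).filter (fun r => r < i)).card = (u.filter (fun r => r < i)).card ∧
      ((u.erase i).filter (fun r => r < j)).card + 1 = (u.filter (fun r => r < j)).card := by
    intro i j hij hi hj
    constructor
    · congr 1
      ext x
      simp only [Finset.mem_filter, Finset.mem_erase]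
      constructor
      · tauto
      · rintro ⟨h1, h2⟩
        exact ⟨⟨(h2.trans hij).ne, h1⟩, h2⟩
    · rw [Finset.filter_erase, Finset.card_erase_add_one]
      simp [hi, hij]
  by_cases hi : i ∈ u <;> by_cases hj : j ∈ u
  · rcases lt_trichotomy i j with h | rfl | h
    · obtain ⟨h1, h2⟩ := key i j h hi hj
      simp only [hi, hj, if_true, map_smul, dodd_mono, Finset.mem_erase, ne_eq, h.ne, h.ne',
        not_false_eq_true, and_self, smul_smul, Finset.erase_right_comm (a := i), h1, ← h2,
        pow_succ, ← neg_smul]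
      congr 1
      ring
    · simp [hi, dodd_mono]
    · obtain ⟨h1, h2⟩ := key j i h hj hi
      simp only [hi, hj, if_true, map_smul, dodd_mono, Finset.mem_erase, ne_eq, h.ne, h.ne',
        not_false_eq_true, and_self, smul_smul, Finset.erase_right_comm (a := i), h1, ← h2,
        pow_succ, ← neg_smul]
      congr 1
      ring
  all_goals simp [hi, hj, dodd_mono]

theorem Deven_comp_dodd (i : Fin k) (j : Fin l) :
    (Deven i * dodd j : Module.End F (O F p m l)) = dodd j * Deven i := by
  refine hom_ext fun α u h => ?_
  simp only [Module.End.mul_apply, dodd_mono, Deven_mono i h]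
  by_cases hj : j ∈ u <;> by_cases hi : 0 < α i <;> simp [hi, hj, dodd_mono, Deven_mono i h]

theorem Deven_comp_Deven (i j : Fin k) :
    (Deven i * Deven j : Module.End F (O F p m l)) = Deven j * Deven i := by
  refine hom_ext fun α u h => ?_
  have h' : ∀ j r, α r - (if r = j then 1 else 0) < p ^ m r :=
    fun j r => lt_of_le_of_lt (Nat.sub_le _ _) (h r)
  rcases eq_or_ne i j with rfl | hij
  · rfl
  simp only [Module.End.mul_apply, Deven_mono _ h]
  by_cases hi : 0 < α i <;> by_cases hj : 0 < α j <;>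
    simp only [hi, hj, if_true, if_false, map_zero, Deven_mono _ (h' _), hij, hij.symm,
      Nat.sub_zero]
  congr 1
  ext r
  omega

theorem der_comp_der (s t : Var k l) :
    (der s * der t : Module.End F (O F p m l)) = sgn F (vpar s * vpar t) • (der t * der s) := by
  rcases s with i | i <;> rcases t with j | j
  · simpa [der, vpar, sgn] using Deven_comp_Deven i j
  · simpa [der, vpar, sgn] using Deven_comp_dodd i j
  · simpa [der, vpar, sgn] using (Deven_comp_dodd j i).symm
  · simpa [der, vpar, sgn] using dodd_comp_dodd i j

theorem parAut_mul_parAut : (parAut * parAut : Module.End F (O F p m l)) = 1 := by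
  refine hom_ext fun α u h => ?_
  simp [parAut_mono, smul_smul, sgn_mul_self]

theorem parAut_mul_der (s : Var k l) :
    (parAut * der s : Module.End F (O F p m l)) = sgn F (vpar s) • (der s * parAut) := by
  refine hom_ext fun α u h => ?_
  rcases s with i | j
  · simp only [der, vpar, Sum.elim_inl, sgn_zero, one_smul, Module.End.mul_apply, parAut_mono,
      map_smul, Deven_mono i h]
    split_ifs <;> simp [parAut_mono]
  · simp only [der, vpar, Sum.elim_inr, sgn_one, Module.End.mul_apply, parAut_mono,
      map_smul, dodd_mono, LinearMap.smul_apply]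
    split_ifs with hj
    · rw [← Finset.card_erase_add_one hj, Nat.cast_succ, sgn_add, sgn_one]
      simp only [map_smul, parAut_mono, smul_smul]
      congr 1
      ring
    · simp

end Algebra

/-! ### The product of O(k,l,m) and the Leibniz rules -/

section Algebra

variable {F : Type*} [Field F] {p : ℕ} {k : ℕ} {m : Fin k → ℕ} {l : ℕ}

theorem coord_mono (a : Idx p m l) (γ : Fin k → ℕ) (t : Finset (Fin l)) :
    (bas F p m l).coord a (mono F p m γ t) =
      if (∀ i, γ i = a.1 i) ∧ t = a.2 then 1 else 0 := by
  by_cases h : ∀ i, γ i < p ^ m i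
  · rw [mono_of_lt h, Module.Basis.coord_apply, Module.Basis.repr_self, Finsupp.single_apply]
    congr 1
    rw [Prod.ext_iff, funext_iff]
    simp [Fin.ext_iff]
  · rw [if_neg]
    · push Not at h
      obtain ⟨i, hi⟩ := h
      simp [mono_of_le hi]
    · rintro ⟨h', -⟩
      exact h fun i => (h' i) ▸ (a.1 i).2

/-- The coefficient of `1`. -/
def eps : O F p m l →ₗ[F] F :=
  lin fun a => if (∀ i, (a.1 i : ℕ) = 0) ∧ a.2 = ∅ then 1 else 0

theorem eps_mono {α : Fin k → ℕ} (h : ∀ i, α i < p ^ m i) (u : Finset (Fin l)) :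
    eps (mono F p m α u) = if (∀ i, α i = 0) ∧ u = ∅ then 1 else 0 := by
  rw [mono_of_lt h, eps, lin_bas]

/-- The unit element. -/
def one (F : Type*) [Field F] (p : ℕ) {k : ℕ} (m : Fin k → ℕ) (l : ℕ) : O F p m l :=
  mono F p m (fun _ => 0) ∅

/-- `D_i` changes only the exponent at `i`; isolating that binomial factor reduces the Leibniz rule
for `D_i` to Pascal's rule. -/
theorem monoCoeff_split (α β : Fin k → ℕ) (u t : Finset (Fin l)) (i : Fin k) :
    monoCoeff F α β u t = ((α i + β i).choose (α i) : F) *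
      (if Disjoint u t then (∏ r ∈ Finset.univ.erase i, ((α r + β r).choose (α r) : F)) *
        wedgeSign F u t else 0) := by
  unfold monoCoeff
  split_ifs
  · rw [← mul_assoc, Finset.mul_prod_erase _ (fun r => ((α r + β r).choose (α r) : F))
      (Finset.mem_univ i)]
  · simp

theorem prod_choose_congr {α β α' β' : Fin k → ℕ} {i : Fin k} (h : ∀ r, r ≠ i → α r = α' r)
    (h' : ∀ r, r ≠ i → β r = β' r) :
    (∏ r ∈ Finset.univ.erase i, ((α r + β r).choose (α r) : F)) =
      ∏ r ∈ Finset.univ.erase i, ((α' r + β' r).choose (α' r) : F) := by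
  refine Finset.prod_congr rfl fun r hr => ?_
  rw [h r (Finset.ne_of_mem_erase hr), h' r (Finset.ne_of_mem_erase hr)]

/-- The case distinctions mirror those in `Deven_mono`. For `a = b = 0` the left side would be 1 and
the right side 0. -/
theorem choose_pascal {a b : ℕ} (h : 0 < a + b) :
    (a + b).choose a = (if 0 < a then (a - 1 + b).choose (a - 1) else 0) +
      (if 0 < b then (a + (b - 1)).choose a else 0) := by
  rcases a with _ | a
  · have : 0 < b := by omega
    simp [this]
  · rcases b with _ | b
    · simp
    · simp only [Nat.succ_pos, if_true, Nat.add_sub_cancel]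
      rw [show a + 1 + (b + 1) = (a + (b + 1)) + 1 by ring, Nat.choose_succ_succ,
        show a + 1 + b = a + (b + 1) by ring]

theorem filter_erase_lt (j : Fin l) (u : Finset (Fin l)) :
    (u.erase j).filter (fun r => r < j) = u.filter (fun r => r < j) := by
  ext x
  simp only [Finset.mem_filter, Finset.mem_erase]
  constructor
  · tauto
  · rintro ⟨h1, h2⟩
    exact ⟨⟨h2.ne, h1⟩, h2⟩

theorem wedgeSign_of_mem_left {j : Fin l} {u : Finset (Fin l)} (hj : j ∈ u)
    (t : Finset (Fin l)) :
    wedgeSign F u t =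
      (-1) ^ (t.filter (fun r => r < j)).card * wedgeSign F (u.erase j) t := by
  conv_lhs => rw [← Finset.insert_erase hj]
  exact wedgeSign_insert_left (Finset.notMem_erase j u) t

theorem wedgeSign_of_mem_right {j : Fin l} {t : Finset (Fin l)} (hj : j ∈ t)
    (u : Finset (Fin l)) :
    wedgeSign F u t =
      (-1) ^ (u.filter (fun r => j < r)).card * wedgeSign F u (t.erase j) := by
  conv_lhs => rw [← Finset.insert_erase hj]
  exact wedgeSign_insert_right (Finset.notMem_erase j t) u

theorem card_filter_union_lt {u t : Finset (Fin l)} (h : Disjoint u t) (j : Fin l) :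
    ((u ∪ t).filter (fun r => r < j)).card =
      (u.filter (fun r => r < j)).card + (t.filter (fun r => r < j)).card := by
  rw [Finset.filter_union, Finset.card_union_of_disjoint (Finset.disjoint_filter_filter h)]

theorem neg_one_pow_mul_self (n : ℕ) : (-1 : F) ^ n * (-1) ^ n = 1 := by
  rw [← mul_pow]; simp

theorem dodd_mulO (j : Fin l) (f g : O F p m l) :
    dodd j (mulO f g) = mulO (dodd j f) g + mulO (parAut f) (dodd j g) := by
  suffices h : (mulO : O F p m l →ₗ[F] _).compr₂ (dodd j) =
      mulO ∘ₗ dodd j + (LinearMap.compl₂ mulO (dodd j)) ∘ₗ parAut by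
    exact LinearMap.congr_fun (LinearMap.congr_fun h f) g
  refine hom_ext fun α u hα => hom_ext fun β t hβ => ?_
  simp only [LinearMap.compr₂_apply, LinearMap.add_apply, LinearMap.comp_apply,
    LinearMap.compl₂_apply, mulO_mono, map_smul, parAut_mono, LinearMap.smul_apply, dodd_mono]
  by_cases hu : j ∈ u <;> by_cases ht : j ∈ t
  -- With `ξ_j` in both factors the product is zero, so the two terms on the right must cancel:
  -- removing `ξ_j` from the left or from the right factor gives the same monomial with opposite
  -- signs.
  · have hd : ¬ Disjoint u t := fun h => Finset.disjoint_left.1 h hu ht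
    have hu1 : u.erase j ∪ t = u ∪ t := by
      ext x
      by_cases hx : x = j
      · subst hx; simp [ht]
      · simp [hx]
    have hu2 : u ∪ t.erase j = u ∪ t := by
      ext x
      by_cases hx : x = j
      · subst hx; simp [hu]
      · simp [hx]
    have hd' : Disjoint (u.erase j) t ↔ Disjoint u (t.erase j) :=
      Finset.disjoint_erase_comm
    simp only [hu, ht, if_true, map_smul, LinearMap.smul_apply, mulO_mono, smul_smul, hu1, hu2,
      ← add_smul]
    simp only [monoCoeff, hd, if_false, zero_smul, hd']
    split_ifs with h
    · rw [wedgeSign_of_mem_right ht, wedgeSign_of_mem_left hu, sgn_natCast,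
        ← Finset.card_erase_add_one hu, filter_erase_lt,
        ← card_filter_lt_add_gt (Finset.notMem_erase j u), filter_erase_lt, pow_succ, pow_add]
      symm
      convert zero_smul F _
      linear_combination (-(-1) ^ (u.filter (fun r => r < j)).card *
        (-1) ^ ((u.erase j).filter (fun r => j < r)).card *
        (∏ x, ((α x + β x).choose (α x) : F)) * wedgeSign F (u.erase j) (t.erase j)) *
        neg_one_pow_mul_self (F := F) (t.filter (fun r => r < j)).card
    · simp
  · have hu1 : (u ∪ t).erase j = u.erase j ∪ t := by
      rw [Finset.erase_union_distrib, Finset.erase_eq_of_notMem ht]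
    have hd' : Disjoint (u.erase j) t ↔ Disjoint u t := by
      rw [Finset.disjoint_erase_comm, Finset.erase_eq_of_notMem ht]
    simp only [hu, ht, if_true, if_false, map_smul, LinearMap.smul_apply, mulO_mono, smul_smul,
      map_zero, smul_zero, add_zero, Finset.mem_union, true_or, hu1]
    congr 1
    simp only [monoCoeff, hd']
    split_ifs with h
    · rw [card_filter_union_lt h, wedgeSign_of_mem_left hu, pow_add]
      linear_combination ((-1) ^ (u.filter (fun r => r < j)).card *
        (∏ x, ((α x + β x).choose (α x) : F)) * wedgeSign F (u.erase j) t) *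
        neg_one_pow_mul_self (F := F) (t.filter (fun r => r < j)).card
    · simp
  · have hu1 : (u ∪ t).erase j = u ∪ t.erase j := by
      rw [Finset.erase_union_distrib, Finset.erase_eq_of_notMem hu]
    have hd' : Disjoint u (t.erase j) ↔ Disjoint u t := by
      rw [← Finset.disjoint_erase_comm, Finset.erase_eq_of_notMem hu]
    simp only [hu, ht, if_true, if_false, map_smul, mulO_mono, smul_smul, map_zero, LinearMap.zero_apply, zero_add, Finset.mem_union, or_true, hu1]
    congr 1
    simp only [monoCoeff, hd']
    split_ifs with h
    · rw [card_filter_union_lt h, wedgeSign_of_mem_right ht, pow_add, sgn_natCast,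
        ← card_filter_lt_add_gt hu, pow_add]
      ring
    · simp
  · simp [hu, ht]

theorem parTwist_zero : (parTwist 0 : Module.End F (O F p m l)) = 1 := by simp [parTwist]

theorem parTwist_one : (parTwist 1 : Module.End F (O F p m l)) = parAut := by simp [parTwist]

theorem mulO_one_left (f : O F p m l) : mulO (one F p m l) f = f := by
  suffices h : mulO (one F p m l) = LinearMap.id from LinearMap.congr_fun h f
  refine hom_ext fun α u hα => ?_
  rw [one, mulO_mono]
  simp [monoCoeff, wedgeSign]

theorem mulO_one_right (f : O F p m l) : mulO f (one F p m l) = f := by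
  suffices h : mulO.flip (one F p m l) = LinearMap.id from LinearMap.congr_fun h f
  refine hom_ext fun α u hα => ?_
  rw [LinearMap.flip_apply, one, mulO_mono]
  simp [monoCoeff, wedgeSign]

theorem parAut_mulO (f g : O F p m l) : parAut (mulO f g) = mulO (parAut f) (parAut g) := by
  suffices h : (mulO : O F p m l →ₗ[F] _).compr₂ parAut =
      (mulO.compl₂ parAut) ∘ₗ parAut by
    exact LinearMap.congr_fun (LinearMap.congr_fun h f) g
  refine hom_ext fun α u hα => hom_ext fun β t hβ => ?_
  simp only [LinearMap.compr₂_apply, LinearMap.comp_apply, LinearMap.smul_apply,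
    LinearMap.compl₂_apply, mulO_mono, map_smul, parAut_mono, smul_smul]
  congr 1
  by_cases h : Disjoint u t
  · rw [Finset.card_union_of_disjoint h, Nat.cast_add, sgn_add]
    ring
  · simp [monoCoeff, h]

theorem eps_parAut (f : O F p m l) : eps (parAut f) = eps f := by
  suffices h : (eps : O F p m l →ₗ[F] F) ∘ₗ parAut = eps from LinearMap.congr_fun h f
  refine hom_ext fun α u hα => ?_
  rw [LinearMap.comp_apply, parAut_mono, map_smul, eps_mono hα]
  split_ifs with h
  · simp [h.2, sgn_zero]
  · simp

/-! ## Detection of zero by derivatives -/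

/-- Every basis coefficient other than that of 1 is, up to sign, a coefficient of some derivative;
in divided powers no integer factor has to be inverted. This is the tool behind all later inductions
on the degree. -/
theorem eq_zero_of_der {f : O F p m l} (h0 : eps f = 0) (h : ∀ s, der s f = 0) : f = 0 := by
  refine (bas F p m l).ext_elem fun a => ?_
  rw [map_zero, Finsupp.zero_apply, ← Module.Basis.coord_apply]
  by_cases h1 : ∀ i, (a.1 i : ℕ) = 0
  · by_cases h2 : a.2 = ∅
    · suffices hc : (bas F p m l).coord a = eps by rw [hc, h0]
      refine hom_ext fun α u hα => ?_
      rw [coord_mono, eps_mono hα]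
      simp [h1, h2]
    · obtain ⟨j, hj⟩ := Finset.nonempty_iff_ne_empty.2 h2
      suffices hc : (bas F p m l).coord a = (-1 : F) ^ (a.2.filter (fun r => r < j)).card •
          ((bas F p m l).coord (a.1, a.2.erase j) ∘ₗ dodd j) by
        have := h (Sum.inr j)
        simp only [der, Sum.elim_inr] at this
        simp [hc, this]
      refine hom_ext fun α u hα => ?_
      simp only [LinearMap.smul_apply, LinearMap.comp_apply, dodd_mono]
      by_cases hju : j ∈ u
      · simp only [hju, if_true, map_smul, coord_mono, smul_eq_mul]
        have he : u.erase j = a.2.erase j ↔ u = a.2 :=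
          ⟨fun h => by rw [← Finset.insert_erase hju, h, Finset.insert_erase hj], fun h => by rw [h]⟩
        simp only [he]
        by_cases hua : u = a.2
        · subst hua
          simp [neg_one_pow_mul_self]
        · simp [hua]
      · have : u ≠ a.2 := fun h => hju (h ▸ hj)
        rw [coord_mono]
        simp [hju, this]
  · push Not at h1
    obtain ⟨i, hi⟩ := h1
    have hlt : ∀ r, (a.1 r : ℕ) - (if r = i then 1 else 0) < p ^ m r :=
      fun r => lt_of_le_of_lt (Nat.sub_le _ _) (a.1 r).2
    suffices hc : (bas F p m l).coord a =
        ((bas F p m l).coord (fun r => ⟨(a.1 r : ℕ) - (if r = i then 1 else 0), hlt r⟩, a.2) ∘ₗ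
          Deven i) by
      have := h (Sum.inl i)
      simp only [der, Sum.elim_inl] at this
      simp [hc, this]
    refine hom_ext fun α u hα => ?_
    rw [LinearMap.comp_apply, Deven_mono i hα]
    split_ifs with hαi
    · rw [coord_mono, coord_mono]
      congr 2
      simp only [eq_iff_iff]
      refine forall_congr' fun r => ?_
      split_ifs with hr
      · subst hr; omega
      · rfl
    · rw [map_zero, coord_mono, if_neg]
      rintro ⟨h', -⟩
      have := h' i
      omega

variable [Fact p.Prime]

theorem pow_pos_prime (i : Fin k) : 0 < p ^ m i := pow_pos (Fact.out : p.Prime).pos _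

theorem eps_one : eps (one F p m l) = 1 := by
  rw [one, eps_mono fun i => pow_pos_prime (p := p) i]
  simp

theorem eps_mulO (f g : O F p m l) : eps (mulO f g) = eps f * eps g := by
  suffices h : (mulO : O F p m l →ₗ[F] _).compr₂ eps =
      ((LinearMap.mul F F).compl₂ eps) ∘ₗ eps by
    simpa using LinearMap.congr_fun (LinearMap.congr_fun h f) g
  refine hom_ext fun α u hα => hom_ext fun β t hβ => ?_
  simp only [LinearMap.compr₂_apply, LinearMap.comp_apply,
    LinearMap.compl₂_apply, mulO_mono, map_smul, eps_mono hα, eps_mono hβ]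
  by_cases h : ((∀ i, α i = 0) ∧ u = ∅) ∧ ((∀ i, β i = 0) ∧ t = ∅)
  · obtain ⟨⟨h1, rfl⟩, h2, rfl⟩ := h
    rw [eps_mono (fun i => by simpa [h1, h2] using pow_pos_prime (p := p) i)]
    simp [h1, h2, monoCoeff, wedgeSign]
  · rw [LinearMap.mul_apply', ite_zero_mul_ite_zero, if_neg h]
    by_cases hs : ∀ r, α r + β r < p ^ m r
    · rw [eps_mono hs, if_neg, smul_zero]
      rintro ⟨h1, h2⟩
      simp only [Nat.add_eq_zero_iff, Finset.union_eq_empty] at h1 h2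
      exact h ⟨⟨fun i => (h1 i).1, h2.1⟩, fun i => (h1 i).2, h2.2⟩
    · push Not at hs
      obtain ⟨r, hr⟩ := hs
      rw [mono_of_le (α := fun r => α r + β r) hr, map_zero, smul_zero]

theorem der_one (s : Var k l) : der s (one F p m l) = 0 := by
  rcases s with i | j
  · simp [der, one, Deven_mono i fun i => pow_pos_prime (p := p) i]
  · simp [der, one, dodd_mono]

variable [CharP F p]

theorem Deven_mulO (i : Fin k) (f g : O F p m l) :
    Deven i (mulO f g) = mulO (Deven i f) g + mulO f (Deven i g) := by
  suffices h : (mulO : O F p m l →ₗ[F] _).compr₂ (Deven i) =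
      mulO ∘ₗ Deven i + LinearMap.compl₂ mulO (Deven i) by
    exact LinearMap.congr_fun (LinearMap.congr_fun h f) g
  refine hom_ext fun α u hα => hom_ext fun β t hβ => ?_
  simp only [LinearMap.compr₂_apply, LinearMap.add_apply, LinearMap.comp_apply,
    LinearMap.compl₂_apply, mulO_mono, map_smul]
  rw [Deven_mono i hα, Deven_mono i hβ]
  set R : F := if Disjoint u t then (∏ r ∈ Finset.univ.erase i, ((α r + β r).choose (α r) : F)) *
        wedgeSign F u t else 0 with hR
  set γ : Fin k → ℕ := fun r => α r + β r - (if r = i then 1 else 0) with hγ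
  have e1 : mulO (if 0 < α i then mono F p m (fun r => α r - (if r = i then 1 else 0)) u else 0)
      (mono F p m β t) =
      (((if 0 < α i then (α i - 1 + β i).choose (α i - 1) else 0 : ℕ) : F) * R) •
        mono F p m γ (u ∪ t) := by
    split_ifs with h
    · rw [mulO_mono, monoCoeff_split _ _ _ _ i,
        prod_choose_congr (α' := α) (β' := β) (fun r hr => by simp [hr]) (fun r hr => rfl)]
      simp only [if_true]
      congr 2
      funext r
      simp only [hγ]
      split_ifs with hr
      · subst hr; omega
      · omega
    · simp
  have e2 : mulO (mono F p m α u)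
      (if 0 < β i then mono F p m (fun r => β r - (if r = i then 1 else 0)) t else 0) =
      (((if 0 < β i then (α i + (β i - 1)).choose (α i) else 0 : ℕ) : F) * R) •
        mono F p m γ (u ∪ t) := by
    split_ifs with h
    · rw [mulO_mono, monoCoeff_split _ _ _ _ i,
        prod_choose_congr (α' := α) (β' := β) (fun r hr => rfl) (fun r hr => by simp [hr])]
      simp only [if_true]
      congr 2
      funext r
      simp only [hγ]
      split_ifs with hr
      · subst hr; omega
      · omega
    · simp
  rw [e1, e2, ← add_smul, ← add_mul, ← Nat.cast_add, monoCoeff_split _ _ _ _ i, ← hR]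
  rcases Nat.eq_zero_or_pos (α i + β i) with h0 | h0
  · have hα0 : α i = 0 := by omega
    have hβ0 : β i = 0 := by omega
    by_cases hs : ∀ r, α r + β r < p ^ m r
    · rw [Deven_mono i hs]
      simp [hα0, hβ0]
    · push Not at hs
      obtain ⟨r, hr⟩ := hs
      rw [mono_of_le (α := fun r => α r + β r) hr]
      simp [hα0, hβ0]
  · rw [← choose_pascal h0]
    by_cases hs : ∀ r, α r + β r < p ^ m r
    · rw [Deven_mono i hs, if_pos h0]
    · push Not at hs
      obtain ⟨r, hr⟩ := hs
      rw [mono_of_le (α := fun r => α r + β r) hr, map_zero, smul_zero]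
      by_cases hri : r = i
      · subst hri
        rcases hr.eq_or_lt with h1 | h1
        -- The critical case, where the characteristic enters. The product is truncated, but its
        -- formal derivative has exponent `p^(m_r) - 1` and is not; it is killed by the binomial
        -- coefficient of `p^(m_r)` over `α r`, which `p` divides because `0 < α r < p^(m_r)`.
        · have : (((α r + β r).choose (α r) : ℕ) : F) = 0 := by
            rw [CharP.cast_eq_zero_iff F p, ← h1]
            have := hα r
            have := hβ r
            exact (Fact.out : p.Prime).dvd_choose_pow (by omega) (by omega)
          simp [this]
        · rw [mono_of_le (i := r) (by simp only [hγ, if_true]; omega), smul_zero]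
      · rw [mono_of_le (i := r) (by simp only [hγ, hri, if_false]; omega), smul_zero]

theorem der_mulO_apply (s : Var k l) (f g : O F p m l) :
    der s (mulO f g) = mulO (der s f) g + mulO (parTwist (vpar s) f) (der s g) := by
  rcases s with i | j
  · simpa [der, vpar, parTwist_zero] using Deven_mulO i f g
  · simpa [der, vpar, parTwist_one] using dodd_mulO j f g

end Algebra

section Algebra

variable {F : Type*} [Field F] {p : ℕ} {k : ℕ} {m : Fin k → ℕ} {l : ℕ}

/-! ## The `Z_2`-grading -/

theorem zmod_two_add_of_ne {c d : ZMod 2} (h : d ≠ c) : c + d = 1 := by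
  revert c d; decide

theorem parTwist_add (a b : ZMod 2) :
    (parTwist (a + b) : Module.End F (O F p m l)) = parTwist a * parTwist b := by
  rcases zmod_two_cases a with rfl | rfl <;> rcases zmod_two_cases b with rfl | rfl <;>
    simp [show (1 : ZMod 2) + 1 = 0 by decide, parTwist_zero, parTwist_one, parAut_mul_parAut]

theorem parTwist_mul_self (a : ZMod 2) :
    (parTwist a * parTwist a : Module.End F (O F p m l)) = 1 := by
  rw [← parTwist_add, CharTwo.add_self_eq_zero, parTwist_zero]

theorem eps_parTwist (a : ZMod 2) (f : O F p m l) : eps (parTwist a f) = eps f := by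
  rcases zmod_two_cases a with rfl | rfl
  · simp [parTwist_zero]
  · rw [parTwist_one, eps_parAut]

theorem parTwist_mulO (a : ZMod 2) (f g : O F p m l) :
    parTwist a (mulO f g) = mulO (parTwist a f) (parTwist a g) := by
  rcases zmod_two_cases a with rfl | rfl
  · simp [parTwist_zero]
  · simp [parTwist_one, parAut_mulO]

theorem parTwist_mul_der (a : ZMod 2) (s : Var k l) :
    (parTwist a * der s : Module.End F (O F p m l)) =
      sgn F (a * vpar s) • (der s * parTwist a) := by
  rcases zmod_two_cases a with rfl | rfl
  · simp [parTwist_zero, sgn_zero]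
  · simp [parTwist_one, parAut_mul_der]

theorem parTwist_der (a : ZMod 2) (s : Var k l) (f : O F p m l) :
    parTwist a (der s f) = sgn F (a * vpar s) • der s (parTwist a f) :=
  LinearMap.congr_fun (parTwist_mul_der a s) f

theorem bas_mem_Opar (a : Idx p m l) : bas F p m l a ∈ Opar F p m l (a.2.card : ZMod 2) :=
  Submodule.subset_span ⟨a, rfl, rfl⟩

theorem parAut_of_mem_Opar {c : ZMod 2} {f : O F p m l} (hf : f ∈ Opar F p m l c) :
    parAut f = sgn F c • f := by
  induction hf using Submodule.span_induction with
  | mem f hf =>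
    obtain ⟨a, rfl, rfl⟩ := hf
    rw [parAut, lin_bas]
  | zero => simp
  | add f g _ _ hf hg => rw [map_add, hf, hg, smul_add]
  | smul r f _ hf => rw [map_smul, hf, smul_comm]

theorem parTwist_of_mem_Opar (a : ZMod 2) {c : ZMod 2} {f : O F p m l}
    (hf : f ∈ Opar F p m l c) : parTwist a f = sgn F (a * c) • f := by
  rcases zmod_two_cases a with rfl | rfl
  · simp [parTwist_zero, sgn_zero]
  · simp [parTwist_one, parAut_of_mem_Opar hf]

/-- As 2 is invertible, the homogeneous parts are the eigenspaces of `parAut`, so questions of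
parity become identities between operators. -/
theorem mem_Opar_iff [NeZero (2 : F)] {c : ZMod 2} {f : O F p m l} :
    f ∈ Opar F p m l c ↔ parAut f = sgn F c • f := by
  refine ⟨parAut_of_mem_Opar, fun h => ?_⟩
  -- This operator is twice the projection onto the part of degree `c`.
  have key : ∀ g : O F p m l, g + sgn F c • parAut g ∈ Opar F p m l c := by
    intro g
    induction (bas F p m l).mem_span g using Submodule.span_induction with
    | zero => simp
    | add f g _ _ hf hg =>
      rw [map_add, smul_add, add_add_add_comm]
      exact add_mem hf hg
    | smul r f _ hf =>
      rw [map_smul, smul_comm, ← smul_add]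
      exact Submodule.smul_mem _ _ hf
    | mem f hf =>
      obtain ⟨a, rfl⟩ := hf
      rw [parAut_of_mem_Opar (bas_mem_Opar a), smul_smul, ← sgn_add]
      by_cases ha : (a.2.card : ZMod 2) = c
      · rw [ha, CharTwo.add_self_eq_zero, sgn_zero, one_smul, ← ha]
        exact add_mem (bas_mem_Opar a) (bas_mem_Opar a)
      · simp [zmod_two_add_of_ne ha, sgn_one]
  have := key f
  rw [h, smul_smul, sgn_mul_self, one_smul, ← two_smul F] at this
  exact (Submodule.smul_mem_iff _ (NeZero.ne (2 : F))).1 this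

theorem apply_mem_Opar {a b : ZMod 2} {x : Module.End F (O F p m l)} {f : O F p m l}
    (hx : x ∈ Epar F p m l a) (hf : f ∈ Opar F p m l b) : x f ∈ Opar F p m l (b + a) := by
  rw [Epar, Submodule.mem_iInf] at hx
  exact hx b hf

theorem parAut_mul_of_mem_Epar {a : ZMod 2} {x : Module.End F (O F p m l)}
    (hx : x ∈ Epar F p m l a) : parAut * x = sgn F a • (x * parAut) := by
  refine (bas F p m l).ext fun i => ?_
  rw [Module.End.mul_apply, parAut_of_mem_Opar (apply_mem_Opar hx (bas_mem_Opar i)),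
    LinearMap.smul_apply, Module.End.mul_apply, parAut_of_mem_Opar (bas_mem_Opar i),
    map_smul, smul_smul, ← sgn_add, add_comm]

theorem parTwist_mul_of_mem_Epar (c : ZMod 2) {a : ZMod 2} {x : Module.End F (O F p m l)}
    (hx : x ∈ Epar F p m l a) : parTwist c * x = sgn F (c * a) • (x * parTwist c) := by
  rcases zmod_two_cases c with rfl | rfl
  · simp [parTwist_zero, sgn_zero]
  · simp [parTwist_one, parAut_mul_of_mem_Epar hx]

theorem mem_Epar_iff [NeZero (2 : F)] {a : ZMod 2} {x : Module.End F (O F p m l)} :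
    x ∈ Epar F p m l a ↔ parAut * x = sgn F a • (x * parAut) := by
  refine ⟨parAut_mul_of_mem_Epar, fun h => ?_⟩
  rw [Epar, Submodule.mem_iInf]
  intro b f hf
  rw [Submodule.mem_comap, mem_Opar_iff]
  have := LinearMap.congr_fun h f
  rw [Module.End.mul_apply, LinearMap.smul_apply, Module.End.mul_apply,
    parAut_of_mem_Opar hf, map_smul, smul_smul] at this
  rw [this, add_comm, sgn_add]

theorem eps_of_mem_Opar {c : ZMod 2} {f : O F p m l} (hf : f ∈ Opar F p m l c) :
    sgn F c * eps f = eps f := by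
  rw [← smul_eq_mul, ← map_smul, ← parAut_of_mem_Opar hf, eps_parAut]

theorem eps_of_mem_Opar_one [NeZero (2 : F)] {f : O F p m l} (hf : f ∈ Opar F p m l 1) :
    eps f = 0 := by
  have := eps_of_mem_Opar hf
  rw [sgn_one] at this
  have h : (2 : F) * eps f = 0 := by linear_combination -this
  exact (mul_eq_zero.1 h).resolve_left (NeZero.ne _)

theorem eps_eq_zero_of_mem_Opar [NeZero (2 : F)] {c : ZMod 2} {f : O F p m l}
    (hf : f ∈ Opar F p m l c) (hc : c ≠ 0) : eps f = 0 := by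
  rw [(zmod_two_cases c).resolve_left hc] at hf
  exact eps_of_mem_Opar_one hf

section Par

variable [NeZero (2 : F)]

theorem der_mem_Epar (s : Var k l) : (der s : Module.End F (O F p m l)) ∈ Epar F p m l (vpar s) :=
  mem_Epar_iff.2 (parAut_mul_der s)

theorem mul_mem_Epar {a b : ZMod 2} {x y : Module.End F (O F p m l)}
    (hx : x ∈ Epar F p m l a) (hy : y ∈ Epar F p m l b) : x * y ∈ Epar F p m l (a + b) := by
  rw [mem_Epar_iff, ← mul_assoc, parAut_mul_of_mem_Epar hx, smul_mul_assoc, mul_assoc,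
    parAut_mul_of_mem_Epar hy, mul_smul_comm, smul_smul, sgn_add, mul_assoc]

theorem sbr_mem_Epar {a b : ZMod 2} {x y : Module.End F (O F p m l)}
    (hx : x ∈ Epar F p m l a) (hy : y ∈ Epar F p m l b) :
    sbr F a b x y ∈ Epar F p m l (a + b) :=
  sub_mem (mul_mem_Epar hx hy) (Submodule.smul_mem _ _ (add_comm b a ▸ mul_mem_Epar hy hx))

theorem mulO_mem_Epar {c : ZMod 2} {f : O F p m l} (hf : f ∈ Opar F p m l c) :
    mulO f ∈ Epar F p m l c := by
  rw [mem_Epar_iff]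
  ext1 g
  simp [parAut_mulO, parAut_of_mem_Opar hf]

theorem fder_mem_Epar {c : ZMod 2} {f : O F p m l} (hf : f ∈ Opar F p m l c) (s : Var k l) :
    fder f s ∈ Epar F p m l (c + vpar s) :=
  mul_mem_Epar (mulO_mem_Epar hf) (der_mem_Epar s)

theorem der_mem_Opar (s : Var k l) {c : ZMod 2} {f : O F p m l} (hf : f ∈ Opar F p m l c) :
    der s f ∈ Opar F p m l (c + vpar s) :=
  apply_mem_Opar (der_mem_Epar s) hf

end Par

/-! ## The `Z`-grading -/

/-- The `Z`-degree of a basis element. -/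
def zdeg (a : Idx p m l) : ℕ := (∑ i, (a.1 i : ℕ)) + a.2.card

theorem bas_mem_Odeg (a : Idx p m l) : bas F p m l a ∈ Odeg F p m l (zdeg a) :=
  Submodule.subset_span ⟨a, by simp [zdeg], rfl⟩

theorem Odeg_eq_span (n : ℤ) : Odeg F p m l n =
    Submodule.span F {f | ∃ a : Idx p m l, (zdeg a : ℤ) = n ∧ f = bas F p m l a} := by
  simp [Odeg, zdeg]

theorem mono_mem_Odeg {α : Fin k → ℕ} {u : Finset (Fin l)} {n : ℤ}
    (h : ((∑ i, α i + u.card : ℕ) : ℤ) = n) : mono F p m α u ∈ Odeg F p m l n := by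
  by_cases hα : ∀ i, α i < p ^ m i
  · rw [mono_of_lt hα, ← h]
    exact bas_mem_Odeg (F := F) ((fun i => ⟨α i, hα i⟩, u) : Idx p m l)
  · push Not at hα
    obtain ⟨i, hi⟩ := hα
    rw [mono_of_le hi]
    exact zero_mem _

theorem Odeg_induction {n : ℤ} {P : O F p m l → Prop}
    (bas : ∀ a : Idx p m l, (zdeg a : ℤ) = n → P (bas F p m l a)) (zero : P 0)
    (add : ∀ f g, P f → P g → P (f + g)) (smul : ∀ (c : F) f, P f → P (c • f)) {f : O F p m l}
    (hf : f ∈ Odeg F p m l n) : P f := by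
  rw [Odeg_eq_span] at hf
  induction hf using Submodule.span_induction with
  | mem f hf =>
    obtain ⟨a, ha, rfl⟩ := hf
    exact bas a ha
  | zero => exact zero
  | add f g _ _ hf hg => exact add f g hf hg
  | smul r f _ hf => exact smul r f hf

theorem eq_zero_of_mem_Odeg_neg {n : ℤ} (hn : n < 0) {f : O F p m l}
    (hf : f ∈ Odeg F p m l n) : f = 0 := by
  refine Odeg_induction (P := fun f => f = 0) (fun a ha => ?_) rfl ?_ ?_ hf
  · omega
  · rintro f g rfl rfl; simp
  · rintro c f rfl; simp

theorem eps_of_mem_Odeg {n : ℤ} (hn : n ≠ 0) {f : O F p m l} (hf : f ∈ Odeg F p m l n) :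
    eps f = 0 := by
  refine Odeg_induction (P := fun f => eps f = 0) (fun a ha => ?_) (map_zero _) ?_ ?_ hf
  · rw [eps, lin_bas, if_neg]
    rintro ⟨h1, h2⟩
    apply hn
    simp [← ha, zdeg, h1, h2]
  · intro f g hf hg; simp [hf, hg]
  · intro c f hf; simp [hf]

theorem der_mem_Odeg (s : Var k l) {n : ℤ} {f : O F p m l} (hf : f ∈ Odeg F p m l n) :
    der s f ∈ Odeg F p m l (n - 1) := by
  refine Odeg_induction (P := fun f => der s f ∈ Odeg F p m l (n - 1)) (fun a ha => ?_) ?_ ?_ ?_ hf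
  · rw [bas_eq_mono]
    rcases s with i | j
    · simp only [der, Sum.elim_inl, Deven_mono i fun i => (a.1 i).2]
      split_ifs with hi
      · apply mono_mem_Odeg
        rw [zdeg] at ha
        rw [← ha, ← Finset.add_sum_erase _ _ (Finset.mem_univ i),
          ← Finset.add_sum_erase _ (fun i => (a.1 i : ℕ)) (Finset.mem_univ i)]
        rw [Finset.sum_congr (s₁ := Finset.univ.erase i) rfl fun r hr => by
          rw [if_neg (Finset.ne_of_mem_erase hr), Nat.sub_zero]]
        simp only [if_true]
        push_cast
        omega
      · exact zero_mem _
    · simp only [der, Sum.elim_inr, dodd_mono]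
      split_ifs with hj
      · refine Submodule.smul_mem _ _ (mono_mem_Odeg ?_)
        rw [zdeg, ← Finset.card_erase_add_one hj] at ha
        omega
      · exact zero_mem _
  · simp
  · intro f g hf hg; rw [map_add]; exact add_mem hf hg
  · intro c f hf; rw [map_smul]; exact Submodule.smul_mem _ _ hf

theorem mulO_mem_Odeg {n n' : ℤ} {f g : O F p m l} (hf : f ∈ Odeg F p m l n)
    (hg : g ∈ Odeg F p m l n') : mulO f g ∈ Odeg F p m l (n + n') := by
  refine Odeg_induction (P := fun f => mulO f g ∈ _) (fun a ha => ?_) (by simp) ?_ ?_ hf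
  · refine Odeg_induction (P := fun g => mulO _ g ∈ _) (fun b hb => ?_) (by simp) ?_ ?_ hg
    · rw [bas_eq_mono, bas_eq_mono, mulO_mono]
      by_cases h : Disjoint a.2 b.2
      · refine Submodule.smul_mem _ _ (mono_mem_Odeg ?_)
        rw [Finset.card_union_of_disjoint h, Finset.sum_add_distrib, ← ha, ← hb, zdeg, zdeg]
        push_cast
        ring
      · simp [monoCoeff, h]
    · intro f g hf hg; rw [map_add]; exact add_mem hf hg
    · intro c f hf; rw [map_smul]; exact Submodule.smul_mem _ _ hf
  · intro f g hf hg; rw [map_add, LinearMap.add_apply]; exact add_mem hf hg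
  · intro c f hf; rw [map_smul, LinearMap.smul_apply]; exact Submodule.smul_mem _ _ hf

theorem apply_mem_Odeg {n d : ℤ} {x : Module.End F (O F p m l)} {f : O F p m l}
    (hx : x ∈ Edeg F p m l d) (hf : f ∈ Odeg F p m l n) : x f ∈ Odeg F p m l (n + d) := by
  rw [Edeg, Submodule.mem_iInf] at hx
  exact hx n hf

theorem mem_Edeg {d : ℤ} {x : Module.End F (O F p m l)}
    (h : ∀ n, ∀ f ∈ Odeg F p m l n, x f ∈ Odeg F p m l (n + d)) : x ∈ Edeg F p m l d := by
  rw [Edeg, Submodule.mem_iInf]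
  exact h

theorem der_mem_Edeg (s : Var k l) : (der s : Module.End F (O F p m l)) ∈ Edeg F p m l (-1) :=
  mem_Edeg fun _ _ hf => der_mem_Odeg s hf

theorem mul_mem_Edeg {a b : ℤ} {x y : Module.End F (O F p m l)}
    (hx : x ∈ Edeg F p m l a) (hy : y ∈ Edeg F p m l b) : x * y ∈ Edeg F p m l (a + b) :=
  mem_Edeg fun n f hf => by
    rw [Module.End.mul_apply, add_comm a b, ← add_assoc]
    exact apply_mem_Odeg hx (apply_mem_Odeg hy hf)

theorem sbr_mem_Edeg (c c' : ZMod 2) {a b : ℤ} {x y : Module.End F (O F p m l)}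
    (hx : x ∈ Edeg F p m l a) (hy : y ∈ Edeg F p m l b) :
    sbr F c c' x y ∈ Edeg F p m l (a + b) :=
  sub_mem (mul_mem_Edeg hx hy) (Submodule.smul_mem _ _ (add_comm b a ▸ mul_mem_Edeg hy hx))

theorem fder_mem_Edeg {d : ℤ} {f : O F p m l} (hf : f ∈ Odeg F p m l d) (s : Var k l) :
    fder f s ∈ Edeg F p m l (d - 1) :=
  mem_Edeg fun n g hg => by
    rw [show n + (d - 1) = d + (n - 1) by ring]
    exact mulO_mem_Odeg hf (der_mem_Odeg s hg)

theorem eq_smul_one {f : O F p m l} (hf : f ∈ Odeg F p m l 0) : f = eps f • one F p m l := by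
  refine Odeg_induction (P := fun f => f = eps f • one F p m l) (fun a ha => ?_) (by simp) ?_ ?_ hf
  · have h1 : ∀ i, (a.1 i : ℕ) = 0 := by
      have : ∑ i, (a.1 i : ℕ) = 0 := by rw [zdeg] at ha; omega
      simpa using this
    have h2 : a.2 = ∅ := by
      rw [← Finset.card_eq_zero]; rw [zdeg] at ha; omega
    rw [eps, lin_bas, if_pos ⟨h1, h2⟩, one_smul, bas_eq_mono, one, h2]
    simp [h1]
  · intro f g hf hg; rw [map_add, add_smul, ← hf, ← hg]
  · intro c f hf; rw [map_smul, smul_assoc, ← hf]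

theorem gen_mem_Odeg (s : Var k l) : gen F p m s ∈ Odeg F p m l 1 := by
  rcases s with i | j
  · exact mono_mem_Odeg (by simp)
  · exact mono_mem_Odeg (by simp)

theorem gen_mem_Opar [NeZero (2 : F)] (s : Var k l) : gen F p m s ∈ Opar F p m l (vpar s) := by
  rcases s with i | j <;> simp [mem_Opar_iff, gen, parAut_mono, vpar]

/-! ### Derivations and their values on the variables -/

section Prime
variable [Fact p.Prime]

theorem der_gen (hm : ∀ i, 1 ≤ m i) (s t : Var k l) :
    der s (gen F p m t) = if s = t then one F p m l else 0 := by
  have hp : 1 < p := (Fact.out : p.Prime).one_lt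
  -- The variables survive the truncation because `m_r ≥ 1` gives `p^(m_r) > 1`.
  have h1 : ∀ i r : Fin k, (if r = i then 1 else 0) < p ^ m r := fun i r => by
    have := Nat.one_lt_pow (by have := hm r; omega) hp (n := m r)
    split_ifs <;> omega
  rcases s with i | j <;> rcases t with i' | j'
  · simp only [der, gen, Sum.elim_inl, Deven_mono i (h1 i'), Sum.inl.injEq]
    by_cases h : i = i'
    · subst h; simp [one]
    · simp [h]
  · simp [der, gen, Deven_mono i fun i => pow_pos_prime (p := p) i]
  · simp [der, gen, dodd_mono]
  · simp only [der, gen, Sum.elim_inr, dodd_mono, Sum.inr.injEq]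
    by_cases h : j = j'
    · subst h; simp [one, Finset.filter_singleton]
    · simp [h]

theorem eq_sum_gen (hm : ∀ i, 1 ≤ m i) {f : O F p m l} (hf : f ∈ Odeg F p m l 1) :
    f = ∑ s, eps (der s f) • gen F p m s := by
  rw [← sub_eq_zero]
  apply eq_zero_of_der
  · rw [map_sub, map_sum, eps_of_mem_Odeg one_ne_zero hf, zero_sub, neg_eq_zero]
    refine Finset.sum_eq_zero fun s _ => ?_
    rw [map_smul, eps_of_mem_Odeg one_ne_zero (gen_mem_Odeg s), smul_zero]
  · intro s
    simp only [map_sub, map_sum, map_smul, der_gen hm, smul_ite, smul_zero,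
      Finset.sum_ite_eq, Finset.mem_univ, if_true]
    rw [← eq_smul_one (by simpa using der_mem_Odeg s hf), sub_self]

theorem fder_gen (hm : ∀ i, 1 ≤ m i) (f : O F p m l) (s t : Var k l) :
    fder f s (gen F p m t) = if s = t then f else 0 := by
  rw [fder, Module.End.mul_apply, der_gen hm]
  split_ifs
  · exact mulO_one_right f
  · simp

/-- The coefficient of `∂_s` is read off at the variable `x_s`. This allows computing with an
element of W through its values, without choosing a presentation. -/
theorem eq_sum_fder_of_mem_W (hm : ∀ i, 1 ≤ m i) {x : Module.End F (O F p m l)}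
    (hx : x ∈ W F p m l) : x = ∑ s, fder (x (gen F p m s)) s := by
  have hz : ∀ s, fder (0 : O F p m l) s = 0 := fun s => by simp [fder]
  induction hx using Submodule.span_induction with
  | mem x hx =>
    obtain ⟨f, s, rfl⟩ := hx
    rw [Finset.sum_eq_single s]
    · rw [fder_gen hm, if_pos rfl]
    · intro t _ ht
      rw [fder_gen hm, if_neg ht.symm, hz]
    · simp
  | zero => simp [hz]
  | add x y _ _ hx hy =>
    conv_lhs => rw [hx, hy]
    simp [fder, add_mul, Finset.sum_add_distrib]
  | smul r x _ hx =>
    conv_lhs => rw [hx]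
    simp [fder, Finset.smul_sum]

theorem W_apply_one {x : Module.End F (O F p m l)} (hx : x ∈ W F p m l) : x (one F p m l) = 0 := by
  induction hx using Submodule.span_induction with
  | mem x hx =>
    obtain ⟨f, s, rfl⟩ := hx
    simp [fder, der_one]
  | zero => simp
  | add x y _ _ hx hy => simp [hx, hy]
  | smul r x _ hx => simp [hx]

end Prime
end Algebra

section Algebra

variable {F : Type*} [Field F] {p : ℕ} {k : ℕ} {m : Fin k → ℕ} {l : ℕ}

/-! ## Twisted commutators -/

variable (F p m l) in
/-- Conjugation by a power of the parity automorphism. -/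
def tw (c : ZMod 2) : Module.End F (O F p m l) →ₗ[F] Module.End F (O F p m l) :=
  LinearMap.mulLeft F (parTwist c) ∘ₗ LinearMap.mulRight F (parTwist c)

theorem tw_apply (c : ZMod 2) (x : Module.End F (O F p m l)) :
    tw F p m l c x = parTwist c * (x * parTwist c) := rfl

theorem tw_of_mem_Epar (c : ZMod 2) {a : ZMod 2} {x : Module.End F (O F p m l)}
    (hx : x ∈ Epar F p m l a) : tw F p m l c x = sgn F (c * a) • x := by
  rw [tw_apply, ← mul_assoc, parTwist_mul_of_mem_Epar c hx, smul_mul_assoc, mul_assoc,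
    parTwist_mul_self, mul_one]

/-- The super commutator with `E` of degree `e`, as a linear map. -/
def adE (e : ZMod 2) (E : Module.End F (O F p m l)) :
    Module.End F (O F p m l) →ₗ[F] Module.End F (O F p m l) :=
  LinearMap.mulLeft F E - LinearMap.mulRight F E ∘ₗ tw F p m l e

theorem adE_apply (e : ZMod 2) (E x : Module.End F (O F p m l)) :
    adE e E x = E * x - tw F p m l e x * E := rfl

/-- Conjugation by the parity automorphism produces the sign depending on the degree of `x`. Thus
`adE` is linear on all endomorphisms and can be applied to sums before they are split into
homogeneous parts. -/
theorem adE_of_mem_Epar (e : ZMod 2) (E : Module.End F (O F p m l)) {a : ZMod 2}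
    {x : Module.End F (O F p m l)} (hx : x ∈ Epar F p m l a) :
    adE e E x = sbr F e a E x := by
  rw [adE_apply, tw_of_mem_Epar e hx, sbr, smul_mul_assoc]

theorem fder_add (f g : O F p m l) (s : Var k l) : fder (f + g) s = fder f s + fder g s := by
  simp [fder, add_mul]

theorem fder_sub (f g : O F p m l) (s : Var k l) : fder (f - g) s = fder f s - fder g s := by
  simp [fder, sub_mul]

theorem fder_smul (c : F) (f : O F p m l) (s : Var k l) : fder (c • f) s = c • fder f s := by
  simp [fder]

theorem fder_zero (s : Var k l) : fder (0 : O F p m l) s = 0 := by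
  simp [fder]

theorem fder_sum {ι : Type*} (t : Finset ι) (f : ι → O F p m l) (s : Var k l) :
    fder (∑ i ∈ t, f i) s = ∑ i ∈ t, fder (f i) s := by
  simp [fder, Finset.sum_mul]

theorem fder_one (s : Var k l) : fder (one F p m l) s = der s := by
  ext1 g
  simp [fder, mulO_one_left]

theorem adE_fder (e : ZMod 2) {E : Module.End F (O F p m l)}
    (hE : ∀ f g, E (mulO f g) = mulO (E f) g + mulO (parTwist e f) (E g))
    (f : O F p m l) (t : Var k l) :
    adE e E (fder f t) = fder (E f) t + mulO (parTwist e f) * adE e E (der t) := by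
  ext1 g
  simp [adE_apply, tw_apply, fder, parTwist_mulO, hE, add_sub_assoc]

theorem adE_der_der [NeZero (2 : F)] (s t : Var k l) :
    adE (vpar s) (der s : Module.End F (O F p m l)) (der t) = 0 := by
  rw [adE_of_mem_Epar _ _ (der_mem_Epar t), sbr, der_comp_der, sub_self]

/-- The matrix of the linear part of a derivation. -/
def kap (q s : Var k l) : Module.End F (O F p m l) →ₗ[F] F :=
  (eps ∘ₗ der s) ∘ₗ LinearMap.applyₗ (gen F p m q)

theorem kap_apply (q s : Var k l) (x : Module.End F (O F p m l)) :
    kap q s x = eps (der s (x (gen F p m q))) := rfl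

/-- A constant term of odd parity is zero. In the sums below this removes all terms in which the
parities, hence the signs, would not match. -/
theorem kap_eq_zero_of_Epar [NeZero (2 : F)] {q s : Var k l} {e : ZMod 2}
    {x : Module.End F (O F p m l)} (hx : x ∈ Epar F p m l e)
    (h : vpar q ≠ vpar s + e) : kap q s x = 0 := by
  refine eps_eq_zero_of_mem_Opar (der_mem_Opar s (apply_mem_Opar hx (gen_mem_Opar q))) ?_
  revert h
  generalize (vpar q : ZMod 2) = a
  generalize (vpar s : ZMod 2) = b
  clear hx
  revert a b e
  decide

theorem kap_eq_zero_of_Edeg {q s : Var k l} {n : ℤ}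
    {x : Module.End F (O F p m l)} (hx : x ∈ Edeg F p m l n)
    (h : n ≠ 0) : kap q s x = 0 :=
  eps_of_mem_Odeg (n := 1 + n - 1) (by simpa using h)
    (der_mem_Odeg s (apply_mem_Odeg hx (gen_mem_Odeg q)))

theorem Opar_induction {c : ZMod 2} {P : O F p m l → Prop}
    (bas : ∀ a : Idx p m l, (a.2.card : ZMod 2) = c → P (bas F p m l a)) (zero : P 0)
    (add : ∀ f g, P f → P g → P (f + g)) (smul : ∀ (c : F) f, P f → P (c • f)) {f : O F p m l}
    (hf : f ∈ Opar F p m l c) : P f := by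
  induction hf using Submodule.span_induction with
  | mem f hf =>
    obtain ⟨a, ha, rfl⟩ := hf
    exact bas a ha
  | zero => exact zero
  | add f g _ _ hf hg => exact add f g hf hg
  | smul r f _ hf => exact smul r f hf

theorem coord_of_mem_Odeg {n : ℤ} {f : O F p m l} (hf : f ∈ Odeg F p m l n) (b : Idx p m l)
    (hb : (zdeg b : ℤ) ≠ n) : (bas F p m l).repr f b = 0 := by
  refine Odeg_induction (P := fun f => (bas F p m l).repr f b = 0)
    (fun a ha => ?_) (by simp) ?_ ?_ hf
  · rw [Module.Basis.repr_self, Finsupp.single_apply, if_neg]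
    rintro rfl
    exact hb ha
  · intro f g hf hg; simp [hf, hg]
  · intro c f hf; simp [hf]

theorem coord_of_mem_Opar {c : ZMod 2} {f : O F p m l} (hf : f ∈ Opar F p m l c) (b : Idx p m l)
    (hb : (b.2.card : ZMod 2) ≠ c) : (bas F p m l).repr f b = 0 := by
  refine Opar_induction (P := fun f => (bas F p m l).repr f b = 0)
    (fun a ha => ?_) (by simp) ?_ ?_ hf
  · rw [Module.Basis.repr_self, Finsupp.single_apply, if_neg]
    rintro rfl
    exact hb ha
  · intro f g hf hg; simp [hf, hg]
  · intro c f hf; simp [hf]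

section Prime

variable [Fact p.Prime] [CharP F p] [NeZero (2 : F)]

theorem adE_der_fder (s t : Var k l) (f : O F p m l) :
    adE (vpar s) (der s) (fder f t) = fder (der s f) t := by
  rw [adE_fder _ (der_mulO_apply s), adE_der_der, mul_zero, add_zero]

theorem adE_der_of_mem_W (hm : ∀ i, 1 ≤ m i) (t : Var k l) {x : Module.End F (O F p m l)}
    (hx : x ∈ W F p m l) :
    adE (vpar t) (der t) x = ∑ q, fder (der t (x (gen F p m q))) q := by
  conv_lhs => rw [eq_sum_fder_of_mem_W hm hx]
  simp only [map_sum, adE_der_fder]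

theorem fder_der_apply_gen (q t : Var k l) {x : Module.End F (O F p m l)}
    (hd : x ∈ Edeg F p m l 0) :
    fder (der t (x (gen F p m q))) q = kap q t x • der q := by
  have := der_mem_Odeg t (apply_mem_Odeg hd (gen_mem_Odeg q))
  rw [eq_smul_one (f := der t (x (gen F p m q))) (by simpa using this), fder_smul, fder_one, kap_apply]

theorem der_mul_of_mem_W (hm : ∀ i, 1 ≤ m i) (t : Var k l) {e : ZMod 2}
    {x : Module.End F (O F p m l)}
    (hx : x ∈ W F p m l) (he : x ∈ Epar F p m l e) (hd : x ∈ Edeg F p m l 0) :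
    der t * x = sgn F (vpar t * e) • (x * der t) + ∑ q, kap q t x • der q := by
  have h := adE_der_of_mem_W hm t hx
  rw [adE_of_mem_Epar _ _ he, sbr, sub_eq_iff_eq_add'] at h
  rw [h]
  simp only [fder_der_apply_gen _ _ hd]

theorem eps_apply_of_mem_W (hm : ∀ i, 1 ≤ m i) {x : Module.End F (O F p m l)}
    (hx : x ∈ W F p m l) (f : O F p m l) :
    eps (x f) = ∑ q, eps (x (gen F p m q)) * eps (der q f) := by
  conv_lhs => rw [eq_sum_fder_of_mem_W hm hx]
  simp [fder, eps_mulO]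

theorem eps_gen_of_mem_Edeg {x : Module.End F (O F p m l)} {n : ℤ} (hn : n ≠ -1)
    (hd : x ∈ Edeg F p m l n) (q : Var k l) : eps (x (gen F p m q)) = 0 :=
  eps_of_mem_Odeg (n := 1 + n) (by omega) (apply_mem_Odeg hd (gen_mem_Odeg q))

theorem parTwist_mem_Odeg (c : ZMod 2) {n : ℤ} {f : O F p m l} (hf : f ∈ Odeg F p m l n) :
    parTwist c f ∈ Odeg F p m l n := by
  refine Odeg_induction (P := fun f => parTwist c f ∈ Odeg F p m l n)
    (fun a ha => ?_) (by simp) ?_ ?_ hf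
  · rw [parTwist_of_mem_Opar c (bas_mem_Opar a), ← ha]
    exact Submodule.smul_mem _ _ (bas_mem_Odeg a)
  · intro f g hf hg; rw [map_add]; exact add_mem hf hg
  · intro c f hf; rw [map_smul]; exact Submodule.smul_mem _ _ hf

/-- Writing `x` as a sum of `f_s ∂_s` would call for associativity and supercommutativity of the
product. Both are avoided by induction on the degree of `f g`: the defect has no constant term, and
its derivatives are combinations of defects in lower degree, since `x` commutes with `∂_t` up to
constant combinations of the `∂_q`. -/
theorem apply_mulO_of_mem_W (hm : ∀ i, 1 ≤ m i) {e : ZMod 2} {x : Module.End F (O F p m l)}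
    (hx : x ∈ W F p m l) (he : x ∈ Epar F p m l e) (hd : x ∈ Edeg F p m l 0)
    (f g : O F p m l) : x (mulO f g) = mulO (x f) g + mulO (parTwist e f) (x g) := by
  have heps : ∀ f, eps (x f) = 0 := fun f => by
    rw [eps_apply_of_mem_W hm hx]
    exact Finset.sum_eq_zero fun q _ => by rw [eps_gen_of_mem_Edeg (by omega) hd, zero_mul]
  have hder : ∀ t f, der t (x f) =
      sgn F (vpar t * e) • x (der t f) + ∑ q, kap q t x • der q f := fun t f => by
    simpa using LinearMap.congr_fun (der_mul_of_mem_W hm t hx he hd) f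
  have htx : ∀ t f, parTwist t (x f) = sgn F (t * e) • x (parTwist t f) := fun t f =>
    LinearMap.congr_fun (parTwist_mul_of_mem_Epar t he) f
  have key : ∀ n : ℕ, ∀ i j : ℤ, i + j < n → ∀ f ∈ Odeg F p m l i, ∀ g ∈ Odeg F p m l j,
      x (mulO f g) - (mulO (x f) g + mulO (parTwist e f) (x g)) = 0 := by
    intro n
    induction n with
    | zero =>
      intro i j hij f hf g hg
      rcases lt_or_ge i 0 with hi | hi
      · simp [eq_zero_of_mem_Odeg_neg hi hf]
      · simp [eq_zero_of_mem_Odeg_neg (show j < 0 by push_cast at hij; omega) hg]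
    | succ n ih =>
      intro i j hij f hf g hg
      apply eq_zero_of_der
      · simp [heps, eps_mulO]
      · intro t
        have h1 := ih (i - 1) j (by push_cast at hij; omega) _ (der_mem_Odeg t hf) g hg
        have h2 := ih i (j - 1) (by push_cast at hij; omega) _ (parTwist_mem_Odeg (vpar t) hf) _
          (der_mem_Odeg t hg)
        -- Nonzero matrix entries force `|q| = |t| + e`, so the twist by `|q|` splits into those by
        -- `|t|` and `e`.
        have h3 : ∑ q, kap q t x • mulO (parTwist (vpar q) f) (der q g) =
            ∑ q, kap q t x • mulO (parTwist (vpar t) (parTwist e f)) (der q g) := by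
          refine Finset.sum_congr rfl fun q _ => ?_
          by_cases hq : vpar q = vpar t + e
          · rw [hq, parTwist_add, Module.End.mul_apply]
          · rw [kap_eq_zero_of_Epar he hq, zero_smul, zero_smul]
        have h4 : parTwist (vpar t) (parTwist e f) = parTwist e (parTwist (vpar t) f) := by
          rw [← Module.End.mul_apply, ← Module.End.mul_apply, ← parTwist_add, ← parTwist_add,
            add_comm]
        have h5 : der t (parTwist e f) = sgn F (vpar t * e) • parTwist e (der t f) := by
          rw [parTwist_der, smul_smul, mul_comm e, sgn_mul_self, one_smul]
        have h6 := congrArg (fun z => sgn F (vpar t * e) • z) (congrArg₂ (· + ·) h1 h2)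
        simp only [add_zero, smul_zero] at h6
        rw [← h6]
        simp only [map_sub, map_add, der_mulO_apply, hder, htx, map_smul, map_sum,
          LinearMap.add_apply, LinearMap.smul_apply, LinearMap.sum_apply, smul_add, smul_sub,
          Finset.sum_add_distrib, h3, h5]
        rw [h4]
        abel
  have : mulO.compr₂ x = mulO ∘ₗ x + (mulO.compl₂ x) ∘ₗ parTwist e := by
    refine (bas F p m l).ext fun a => (bas F p m l).ext fun b => ?_
    have := key (zdeg a + zdeg b + 1) _ _ (by push_cast; omega) _ (bas_mem_Odeg a) _
      (bas_mem_Odeg b)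
    simpa [sub_eq_zero] using this
  exact LinearMap.congr_fun (LinearMap.congr_fun this f) g

theorem adE_fder_of_mem_W (hm : ∀ i, 1 ≤ m i) {e : ZMod 2} {x : Module.End F (O F p m l)}
    (hx : x ∈ W F p m l) (he : x ∈ Epar F p m l e) (hd : x ∈ Edeg F p m l 0)
    (f : O F p m l) (t : Var k l) :
    adE e x (fder f t) = fder (x f) t -
      sgn F (vpar t * e) • ∑ q, kap q t x • fder (parTwist e f) q := by
  rw [adE_fder e (apply_mulO_of_mem_W hm hx he hd), sub_eq_add_neg]
  congr 1
  rw [adE_of_mem_Epar _ _ (der_mem_Epar t), sbr, der_mul_of_mem_W hm t hx he hd, smul_add,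
    smul_smul, mul_comm e, sgn_mul_self, one_smul, sub_add_cancel_left, mul_neg, mul_smul_comm,
    Finset.mul_sum]
  simp only [mul_smul_comm, fder]

theorem apply_der_of_mem_W (hm : ∀ i, 1 ≤ m i) {e : ZMod 2} {x : Module.End F (O F p m l)}
    (hx : x ∈ W F p m l) (he : x ∈ Epar F p m l e) (hd : x ∈ Edeg F p m l 0)
    (f : O F p m l) (t : Var k l) :
    x (der t f) = sgn F (vpar t * e) • der t (x f) -
      sgn F (vpar t * e) • ∑ q, kap q t x • der q f := by
  have := LinearMap.congr_fun (der_mul_of_mem_W hm t hx he hd) f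
  simp only [Module.End.mul_apply, LinearMap.add_apply, LinearMap.smul_apply,
    LinearMap.sum_apply] at this
  rw [this, smul_add, smul_smul, sgn_mul_self, one_smul, add_sub_cancel_right]

/-! ## The three series -/

/-- The properties of `W`, `S`, `H` on which the construction of the mixed product and its
comparison with the induced module rest. -/
structure IsGood (L : Submodule F (Module.End F (O F p m l))) : Prop where
  le_W : L ≤ W F p m l
  der_mem : ∀ s, der s ∈ L
  le_span : L ≤ Submodule.span F
    {D | D ∈ L ∧ (∃ a, D ∈ Epar F p m l a) ∧ ∃ n, D ∈ Edeg F p m l n}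
  der_bracket : ∀ (s : Var k l), ∀ x ∈ L, adE (vpar s) (der s) x ∈ L
  bracket_zero : ∀ (a b : ZMod 2) (x y : Module.End F (O F p m l)), x ∈ L → y ∈ L →
    x ∈ Edeg F p m l 0 → y ∈ Edeg F p m l 0 → x ∈ Epar F p m l a → y ∈ Epar F p m l b →
    sbr F a b x y ∈ L

theorem fder_mem_W (f : O F p m l) (s : Var k l) : fder f s ∈ W F p m l :=
  Submodule.subset_span ⟨f, s, rfl⟩

theorem isGood_W (hm : ∀ i, 1 ≤ m i) : IsGood (W F p m l) where
  le_W := le_rfl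
  der_mem s := by rw [← fder_one]; exact fder_mem_W _ s
  le_span := by
    refine Submodule.span_le.2 ?_
    rintro _ ⟨f, s, rfl⟩
    rw [← (bas F p m l).sum_repr f, fder_sum]
    refine sum_mem fun a _ => ?_
    rw [fder_smul]
    exact Submodule.smul_mem _ _ (Submodule.subset_span ⟨fder_mem_W _ _,
      ⟨_, fder_mem_Epar (bas_mem_Opar a) s⟩, _, fder_mem_Edeg (bas_mem_Odeg a) s⟩)
  der_bracket s x hx := by
    rw [adE_der_of_mem_W hm s hx]
    exact sum_mem fun q _ => fder_mem_W _ _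
  bracket_zero a b x y hx hy hx0 hy0 ha hb := by
    rw [← adE_of_mem_Epar _ _ hb, eq_sum_fder_of_mem_W hm hy, map_sum]
    refine sum_mem fun q _ => ?_
    rw [adE_fder_of_mem_W hm hx ha hx0]
    exact sub_mem (fder_mem_W _ _) (Submodule.smul_mem _ _ (sum_mem fun r _ =>
      Submodule.smul_mem _ _ (fder_mem_W _ _)))

end Prime
end Algebra

/-! ### The special series S -/

section Algebra

variable {F : Type*} [Field F] {p : ℕ} {k : ℕ} {m : Fin k → ℕ} {l : ℕ}
variable [Fact p.Prime] [CharP F p] [NeZero (2 : F)]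

theorem Dsr_smul (s r : Var k l) (c : ZMod 2) (a : F) (f : O F p m l) :
    Dsr s r c (a • f) = a • Dsr s r c f := by
  simp only [Dsr, map_smul, fder_smul, smul_sub, smul_comm a]

theorem Dsr_mem_S {s r : Var k l} {c : ZMod 2} {f : O F p m l} (hf : f ∈ Opar F p m l c) :
    Dsr s r c f ∈ S F p m l :=
  Submodule.subset_span ⟨s, r, c, f, hf, rfl⟩

theorem S_le_W : S F p m l ≤ W F p m l := by
  refine Submodule.span_le.2 ?_
  rintro _ ⟨s, r, c, f, _, rfl⟩
  exact sub_mem (Submodule.smul_mem _ _ (fder_mem_W _ _))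
    (Submodule.smul_mem _ _ (fder_mem_W _ _))

theorem Dsr_mem_Epar (s r : Var k l) {c : ZMod 2} {f : O F p m l} (hf : f ∈ Opar F p m l c) :
    Dsr s r c f ∈ Epar F p m l (c + vpar s + vpar r) := by
  refine sub_mem (Submodule.smul_mem _ _ (fder_mem_Epar (der_mem_Opar s hf) r))
    (Submodule.smul_mem _ _ ?_)
  rw [add_right_comm]
  exact fder_mem_Epar (der_mem_Opar r hf) s

theorem Dsr_mem_Edeg (s r : Var k l) (c : ZMod 2) {n : ℤ} {f : O F p m l}
    (hf : f ∈ Odeg F p m l n) : Dsr s r c f ∈ Edeg F p m l (n - 1 - 1) :=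
  sub_mem (Submodule.smul_mem _ _ (fder_mem_Edeg (der_mem_Odeg s hf) r))
    (Submodule.smul_mem _ _ (fder_mem_Edeg (der_mem_Odeg r hf) s))

theorem der_mem_S (hk : 1 ≤ k) (hl : 1 ≤ l) (hm : ∀ i, 1 ≤ m i) (r : Var k l) :
    der r ∈ S F p m l := by
  -- As there are both even and odd variables, a second index `s` exists, and `D_{sr}(x_s)` is `∂_r`
  -- up to sign.
  obtain ⟨s, hs⟩ : ∃ s : Var k l, s ≠ r := by
    rcases r with i | j
    · exact ⟨Sum.inr ⟨0, hl⟩, by simp⟩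
    · exact ⟨Sum.inl ⟨0, hk⟩, by simp⟩
  have h := Dsr_mem_S (F := F) (p := p) (m := m) (s := s) (r := r) (gen_mem_Opar s)
  rw [Dsr, der_gen hm, der_gen hm, if_pos rfl, if_neg hs.symm, fder_zero, smul_zero, sub_zero,
    fder_one] at h
  exact (Submodule.smul_mem_iff _ (sgn_ne_zero _)).1 h

theorem sgn_congr {a b : ZMod 2} (h : a = b) : sgn F a = sgn F b := by rw [h]

/-- An element of degree zero acts on `f` and linearly on the two indices: up to signs, the bracket
is `D_{sr}(x(f))` corrected by combinations of the `D_{qr}(f)` and the `D_{sq}(f)`. Hence S is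
stable under all of the degree zero part of W. -/
theorem adE_Dsr_mem_S (hm : ∀ i, 1 ≤ m i) {e : ZMod 2} {x : Module.End F (O F p m l)}
    (hx : x ∈ W F p m l) (he : x ∈ Epar F p m l e) (hd : x ∈ Edeg F p m l 0)
    (s r : Var k l) {c : ZMod 2} {f : O F p m l} (hf : f ∈ Opar F p m l c) :
    adE e x (Dsr s r c f) ∈ S F p m l := by
  -- `hX` and `hY` collect the terms in which `x` has moved the first and the second index; `hA` is
  -- the term in which it acts on `f`.
  have hX : ∀ q, kap q s x • (sgn F (vpar s * vpar r + vpar s * e) • fder (der q f) r -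
      sgn F ((vpar s + vpar r) * c + vpar s * e + e * (c + vpar r)) • fder (der r f) q)
        ∈ S F p m l := by
    intro q
    by_cases hq : vpar q = vpar s + e
    · refine Submodule.smul_mem _ _ ?_
      convert Submodule.smul_mem _ (sgn F (vpar s * vpar r + vpar s * e + vpar q * vpar r))
        (Dsr_mem_S (s := q) (r := r) hf) using 1
      rw [Dsr, smul_sub, smul_smul, smul_smul, ← sgn_add, ← sgn_add]
      congr 2 <;> congr 1 <;> rw [hq] <;> generalize (vpar s : ZMod 2) = a <;>
        generalize (vpar r : ZMod 2) = b <;> clear hq he hf <;> revert a b c e <;> decide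
    · rw [kap_eq_zero_of_Epar he hq, zero_smul]
      exact zero_mem _
  have hY : ∀ q, kap q r x • (sgn F (vpar s * vpar r + vpar r * e + e * (c + vpar s)) •
      fder (der s f) q - sgn F ((vpar s + vpar r) * c + vpar r * e) • fder (der q f) s)
        ∈ S F p m l := by
    intro q
    by_cases hq : vpar q = vpar r + e
    · refine Submodule.smul_mem _ _ ?_
      convert Submodule.smul_mem _ (sgn F (vpar s * vpar r + vpar r * e + e * (c + vpar s) +
        vpar s * vpar q)) (Dsr_mem_S (s := s) (r := q) hf) using 1
      rw [Dsr, smul_sub, smul_smul, smul_smul, ← sgn_add, ← sgn_add]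
      congr 2 <;> congr 1 <;> rw [hq] <;> generalize (vpar s : ZMod 2) = a <;>
        generalize (vpar r : ZMod 2) = b <;> clear hX hq he hf <;> revert a b c e <;> decide
    · rw [kap_eq_zero_of_Epar he hq, zero_smul]
      exact zero_mem _
  have hA : sgn F (vpar s * vpar r + vpar s * e) • fder (der s (x f)) r -
      sgn F ((vpar s + vpar r) * c + vpar r * e) • fder (der r (x f)) s ∈ S F p m l := by
    convert Submodule.smul_mem _ (sgn F (vpar s * e))
      (Dsr_mem_S (s := s) (r := r) (apply_mem_Opar he hf)) using 1
    rw [Dsr, smul_sub, smul_smul, smul_smul, ← sgn_add, ← sgn_add]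
    congr 2 <;> congr 1 <;> generalize (vpar s : ZMod 2) = a <;>
        generalize (vpar r : ZMod 2) = b <;> clear hX hY he hf <;> revert a b c e <;> decide
  convert sub_mem hA (add_mem (sum_mem fun q (_ : q ∈ Finset.univ) => hX q)
    (sum_mem fun q (_ : q ∈ Finset.univ) => hY q)) using 1
  have ht : ∀ t : Var k l, parTwist e (der t f) = sgn F (e * (c + vpar t)) • der t f :=
    fun t => parTwist_of_mem_Opar e (der_mem_Opar t hf)
  rw [Dsr, map_sub, map_smul, map_smul, adE_fder_of_mem_W hm hx he hd,
    adE_fder_of_mem_W hm hx he hd, apply_der_of_mem_W hm hx he hd,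
    apply_der_of_mem_W hm hx he hd, ht, ht]
  simp only [fder_sub, fder_smul, fder_sum, smul_sub, Finset.sum_sub_distrib, Finset.smul_sum,
    sgn_add, mul_smul, smul_comm (kap _ _ _)]
  abel

theorem adE_mem_S (hm : ∀ i, 1 ≤ m i) {e : ZMod 2} {x : Module.End F (O F p m l)}
    (hx : x ∈ W F p m l) (he : x ∈ Epar F p m l e) (hd : x ∈ Edeg F p m l 0)
    {y : Module.End F (O F p m l)} (hy : y ∈ S F p m l) : adE e x y ∈ S F p m l := by
  induction hy using Submodule.span_induction with
  | mem y hy =>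
    obtain ⟨s, r, c, f, hf, rfl⟩ := hy
    exact adE_Dsr_mem_S hm hx he hd s r hf
  | zero => simp
  | add y z _ _ hy hz => rw [map_add]; exact add_mem hy hz
  | smul c y _ hy => rw [map_smul]; exact Submodule.smul_mem _ _ hy

theorem isGood_S (hk : 1 ≤ k) (hl : 1 ≤ l) (hm : ∀ i, 1 ≤ m i) : IsGood (S F p m l) where
  le_W := S_le_W
  der_mem := der_mem_S hk hl hm
  le_span := by
    refine Submodule.span_le.2 ?_
    rintro _ ⟨s, r, c, f, hf, rfl⟩
    refine Opar_induction (P := fun f => Dsr s r c f ∈ Submodule.span F _) ?_ ?_ ?_ ?_ hf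
    · intro a ha
      have := bas_mem_Opar (F := F) a
      rw [ha] at this
      exact Submodule.subset_span ⟨Dsr_mem_S this, ⟨_, Dsr_mem_Epar s r this⟩, _,
        Dsr_mem_Edeg s r c (bas_mem_Odeg a)⟩
    · simp [Dsr, fder_zero]
    · intro f g hf hg
      convert add_mem hf hg using 1
      simp only [Dsr, map_add, fder_add, smul_add]
      abel
    · intro a f hf
      rw [Dsr_smul]
      exact Submodule.smul_mem _ _ hf
  der_bracket s x hx := by
    induction hx using Submodule.span_induction with
    | mem y hy =>
      obtain ⟨t, r, c, f, hf, rfl⟩ := hy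
      -- Up to sign, the bracket of `∂_s` with `D_{tr}(f)` is `D_{tr}(∂_s f)`.
      convert Submodule.smul_mem _ (sgn F (vpar s * vpar t))
        (Dsr_mem_S (s := t) (r := r) (der_mem_Opar s hf)) using 1
      have h1 : ∀ t, der s (der t f) = sgn F (vpar s * vpar t) • der t (der s f) :=
        fun t => LinearMap.congr_fun (der_comp_der s t) f
      rw [Dsr, Dsr, map_sub, map_smul, map_smul, adE_der_fder, adE_der_fder, h1, h1, smul_sub,
        fder_smul, fder_smul, smul_smul, smul_smul, smul_smul, smul_smul, ← sgn_add, ← sgn_add,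
        ← sgn_add, ← sgn_add]
      congr 2 <;> congr 1 <;> generalize (vpar s : ZMod 2) = a <;>
        generalize (vpar r : ZMod 2) = b <;> generalize (vpar t : ZMod 2) = d <;>
        clear hf <;> revert a b c d <;> decide
    | zero => simp
    | add y z _ _ hy hz => rw [map_add]; exact add_mem hy hz
    | smul c y _ hy => rw [map_smul]; exact Submodule.smul_mem _ _ hy
  bracket_zero a b x y hx hy hx0 hy0 ha hb := by
    rw [← adE_of_mem_Epar _ _ hb]
    exact adE_mem_S hm (S_le_W hx) ha hx0 hy

end Algebra

/-! ### The Hamiltonian series H -/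

section Algebra

variable {F : Type*} [Field F] {p : ℕ} {k : ℕ} {m : Fin k → ℕ} {l : ℕ}

theorem conj_conj (hk : Even k) (s : Var k l) : conj (conj s) = s := by
  rcases s with i | j
  · have := i.2
    obtain ⟨h, rfl⟩ := hk
    simp only [conj, Sum.map_inl, Sum.inl.injEq]
    ext
    split_ifs with h1 h2 h2 <;> simp at h2 ⊢ <;> omega
  · rfl

theorem vpar_conj (s : Var k l) : vpar (conj s) = vpar s := by
  rcases s with i | j <;> rfl

theorem hsign_conj (hk : Even k) (s : Var k l) :
    hsign F (conj s) = -(sgn F (vpar s) * hsign F s) := by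
  rcases s with i | j
  · have := i.2
    obtain ⟨h, rfl⟩ := hk
    simp only [conj, Sum.map_inl, hsign, Sum.elim_inl, vpar, sgn_zero, one_mul]
    split_ifs with h1 h2 h2 <;> simp at h2 ⊢
    all_goals omega
  · simp [conj, hsign, vpar, sgn_one]

/-- The involution `conj` as a permutation. -/
def conjEquiv (hk : Even k) : Equiv.Perm (Var k l) :=
  ⟨conj, conj, conj_conj hk, conj_conj hk⟩

theorem DH_smul (c : ZMod 2) (a : F) (f : O F p m l) : DH c (a • f) = a • DH c f := by
  simp only [DH, map_smul, fder_smul, Finset.smul_sum, smul_comm a]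

theorem DH_sum {ι : Type*} (t : Finset ι) (c : ZMod 2) (f : ι → O F p m l) :
    DH c (∑ i ∈ t, f i) = ∑ i ∈ t, DH c (f i) := by
  simp only [DH, map_sum, fder_sum, Finset.smul_sum]
  rw [Finset.sum_comm]

variable [Fact p.Prime] [CharP F p] [NeZero (2 : F)]

theorem DH_mem_Epar {c : ZMod 2} {f : O F p m l} (hf : f ∈ Opar F p m l c) :
    DH c f ∈ Epar F p m l c := by
  refine sum_mem fun s _ => Submodule.smul_mem _ _ ?_
  have := fder_mem_Epar (der_mem_Opar s hf) (conj s)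
  rwa [vpar_conj, add_assoc, CharTwo.add_self_eq_zero, add_zero] at this

theorem DH_mem_Edeg (c : ZMod 2) {n : ℤ} {f : O F p m l} (hf : f ∈ Odeg F p m l n) :
    DH c f ∈ Edeg F p m l (n - 1 - 1) :=
  sum_mem fun s _ => Submodule.smul_mem _ _ (fder_mem_Edeg (der_mem_Odeg s hf) (conj s))

variable (p m l) in
/-- The degree of the basis element of top degree. -/
def topDeg : ℕ := ∑ i, (p ^ m i - 1) + l

theorem zdeg_lt_topDeg {a : Idx p m l}
    (ha : ¬ ((∀ i, (a.1 i : ℕ) = p ^ m i - 1) ∧ a.2 = Finset.univ)) : zdeg a < topDeg p m l := by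
  have h1 : ∀ i, (a.1 i : ℕ) ≤ p ^ m i - 1 := fun i => Nat.le_sub_one_of_lt (a.1 i).2
  have h2 : a.2.card ≤ l := by simpa using Finset.card_le_univ a.2
  rw [not_and_or] at ha
  rcases ha with ha | ha
  · push Not at ha
    obtain ⟨i, hi⟩ := ha
    have := Finset.sum_lt_sum (fun i _ => h1 i) ⟨i, Finset.mem_univ i, lt_of_le_of_ne (h1 i) hi⟩
    exact add_lt_add_of_lt_of_le this h2
  · have h3 : a.2.card < l := by
      have := Finset.card_lt_univ_of_notMem (s := a.2)
        (x := (not_forall.1 fun h => ha (Finset.eq_univ_iff_forall.2 h)).choose)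
        (not_forall.1 fun h => ha (Finset.eq_univ_iff_forall.2 h)).choose_spec
      simpa using this
    exact add_lt_add_of_le_of_lt (Finset.sum_le_sum fun i _ => h1 i) h3

theorem DH_bas_mem_H {a : Idx p m l} (ha : zdeg a ≠ topDeg p m l) :
    DH (a.2.card : ZMod 2) (bas F p m l a) ∈ H F p m l := by
  refine Submodule.subset_span ⟨a, ?_, rfl⟩
  rintro ⟨h1, h2⟩
  apply ha
  simp [zdeg, topDeg, h1, h2]

/-- Only one basis element has top degree, so its exclusion from H becomes a condition on degrees.
Brackets with `∂_s` and with elements of degree zero do not raise degrees and therefore preserve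
this condition. -/
theorem DH_mem_H {c : ZMod 2} {n : ℤ} (hn : n ≠ topDeg p m l) {f : O F p m l}
    (hc : f ∈ Opar F p m l c) (hf : f ∈ Odeg F p m l n) : DH c f ∈ H F p m l := by
  rw [← (bas F p m l).sum_repr f, DH_sum]
  refine sum_mem fun a _ => ?_
  rw [DH_smul]
  by_cases h1 : (zdeg a : ℤ) = n
  · by_cases h2 : (a.2.card : ZMod 2) = c
    · rw [← h2]
      exact Submodule.smul_mem _ _ (DH_bas_mem_H (by omega))
    · rw [coord_of_mem_Opar hc a h2, zero_smul]
      exact zero_mem _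
  · rw [coord_of_mem_Odeg hf a h1, zero_smul]
    exact zero_mem _

theorem H_le_W : H F p m l ≤ W F p m l := by
  refine Submodule.span_le.2 ?_
  rintro _ ⟨a, _, rfl⟩
  exact sum_mem fun s _ => Submodule.smul_mem _ _ (fder_mem_W _ _)

theorem hsign_ne_zero (s : Var k l) : hsign F s ≠ 0 := by
  rcases s with i | j
  · simp only [hsign, Sum.elim_inl]
    split_ifs <;> simp
  · simp [hsign]

theorem prime_ne_two (F : Type*) [Field F] [CharP F p] [NeZero (2 : F)] : p ≠ 2 := by
  rintro rfl
  exact NeZero.ne (2 : F) (by simpa using CharP.cast_eq_zero F 2)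

theorem two_lt_pow (hp : p ≠ 2) (hm : ∀ i, 1 ≤ m i) (i : Fin k) : 2 < p ^ m i := by
  have h2 := (Fact.out : p.Prime).two_le
  have := Nat.pow_le_pow_right (show 0 < p by omega) (hm i)
  rw [pow_one] at this
  omega

/-- Ensures that no variable is the excluded top element, so that the `∂_r` occur in H as multiples
of `D_H(x_{r'})`. -/
theorem one_lt_topDeg (hp : p ≠ 2) (hk : 1 ≤ k) (hm : ∀ i, 1 ≤ m i) : 1 < topDeg p m l := by
  have := Finset.single_le_sum (f := fun i => p ^ m i - 1) (fun _ _ => Nat.zero_le _)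
    (Finset.mem_univ (⟨0, hk⟩ : Fin k))
  have h2 := two_lt_pow hp hm ⟨0, hk⟩
  rw [topDeg]
  omega

theorem der_mem_H (hk : 1 ≤ k) (hk2 : Even k) (hm : ∀ i, 1 ≤ m i) (r : Var k l) :
    der r ∈ H F p m l := by
  have h := DH_mem_H (F := F) (p := p) (m := m) (n := 1) (f := gen F p m (conj r))
    (by have := one_lt_topDeg (m := m) (l := l) (prime_ne_two (p := p) F) hk hm; omega)
    (gen_mem_Opar _) (gen_mem_Odeg _)
  rw [DH, Finset.sum_eq_single (conj r)] at h
  · rw [der_gen hm, if_pos rfl, conj_conj hk2, fder_one] at h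
    exact (Submodule.smul_mem_iff _ (mul_ne_zero (hsign_ne_zero _) (sgn_ne_zero _))).1 h
  · intro s _ hs
    rw [der_gen hm, if_neg hs, fder_zero, smul_zero]
  · simp

/-- The linear condition on the linear part satisfied by Hamiltonian derivations. -/
theorem kap_of_mem_H (hk2 : Even k) (hm : ∀ i, 1 ≤ m i) {x : Module.End F (O F p m l)}
    (hx : x ∈ H F p m l) (q s : Var k l) :
    hsign F s * sgn F (vpar q * vpar s + vpar s) * kap q s x +
      hsign F q * kap (conj s) (conj q) x = 0 := by
  induction hx using Submodule.span_induction with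
  | mem x hx =>
    obtain ⟨a, _, rfl⟩ := hx
    have hf := bas_mem_Opar (F := F) a
    generalize bas F p m l a = f at hf
    generalize (a.2.card : ZMod 2) = c at hf
    have h1 : ∀ q, DH c f (gen F p m q) =
        (hsign F (conj q) * sgn F (vpar q * c)) • der (conj q) f := by
      intro q
      rw [DH, LinearMap.sum_apply, Finset.sum_eq_single (conj q)]
      · rw [LinearMap.smul_apply, fder_gen hm, if_pos (conj_conj hk2 q), vpar_conj]
      · intro t _ ht
        rw [LinearMap.smul_apply, fder_gen hm, if_neg, smul_zero]
        rintro rfl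
        exact ht (conj_conj hk2 t).symm
      · simp
    rw [kap_apply, kap_apply, h1, h1, map_smul, map_smul, map_smul, map_smul, conj_conj hk2,
      vpar_conj, hsign_conj hk2 q,
      show der (conj q) (der s f) = _ from LinearMap.congr_fun (der_comp_der (conj q) s) f,
      vpar_conj, LinearMap.smul_apply, map_smul, Module.End.mul_apply]
    by_cases hc : c = vpar q + vpar s
    · have e1 : (vpar q * vpar s + vpar s) + vpar q + vpar q * c =
          vpar s * c + vpar q * vpar s := by
        rw [hc]
        generalize (vpar q : ZMod 2) = a
        generalize (vpar s : ZMod 2) = b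
        clear hc hf h1
        revert a b
        decide
      have e2 := sgn_congr (F := F) e1
      simp only [sgn_add] at e2 ⊢
      simp only [smul_eq_mul]
      linear_combination (-hsign F s * hsign F q * eps (der s (der (conj q) f))) * e2
    · have : eps (der s (der (conj q) f)) = 0 := by
        refine eps_eq_zero_of_mem_Opar (der_mem_Opar s (der_mem_Opar (conj q) hf)) ?_
        rw [vpar_conj]
        revert hc
        generalize (vpar q : ZMod 2) = a
        generalize (vpar s : ZMod 2) = b
        clear hf h1
        revert a b c
        decide
      simp [this]
  | zero => simp
  | add x y _ _ hx hy =>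
    rw [map_add, map_add]
    linear_combination hx + hy
  | smul c x _ hx =>
    rw [map_smul, map_smul, smul_eq_mul, smul_eq_mul]
    linear_combination c * hx

/-- The bracket of `x` with `D_H(f)` is `D_H(x(f))` plus two correction sums, coming from commuting
`x` with the `∂_s` inside and with the `∂_{s'}` outside. They cancel because the linear part of `x`
preserves the form defining H; this is why `x` must lie in H and not only in W. -/
theorem adE_DH (hk2 : Even k) (hm : ∀ i, 1 ≤ m i) {e : ZMod 2} {x : Module.End F (O F p m l)}
    (hx : x ∈ H F p m l) (he : x ∈ Epar F p m l e) (hd : x ∈ Edeg F p m l 0)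
    {c : ZMod 2} {f : O F p m l} (hf : f ∈ Opar F p m l c) :
    adE e x (DH c f) = DH (c + e) (x f) := by
  have hxW := H_le_W hx
  have ht : ∀ t : Var k l, parTwist e (der t f) = sgn F (e * (c + vpar t)) • der t f :=
    fun t => parTwist_of_mem_Opar e (der_mem_Opar t hf)
  -- After exchanging the two sums of the second term and reindexing by `conj`, the corrections
  -- cancel pair by pair through `kap_of_mem_H`.
  have h0 : ∑ s, ∑ q, ((hsign F s * sgn F (vpar s * c + vpar s * e) * kap q s x) •
      fder (der q f) (conj s)) + ∑ s, ∑ q, ((hsign F s * sgn F (vpar s * c + vpar s * e +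
        e * (c + vpar s)) * kap q (conj s) x) • fder (der s f) q) = 0 := by
    rw [Finset.sum_comm (f := fun s q => (hsign F s * sgn F (vpar s * c + vpar s * e +
        e * (c + vpar s)) * kap q (conj s) x) • fder (der s f) q)]
    rw [← Equiv.sum_comp (conjEquiv hk2) (fun q => ∑ s, (hsign F s * sgn F (vpar s * c +
      vpar s * e + e * (c + vpar s)) * kap q (conj s) x) • fder (der s f) q),
      ← Finset.sum_add_distrib]
    refine Finset.sum_eq_zero fun s _ => ?_
    rw [← Finset.sum_add_distrib]
    refine Finset.sum_eq_zero fun q _ => ?_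
    rw [show conjEquiv hk2 s = conj s from rfl, ← add_smul]
    convert zero_smul F _
    by_cases hq : vpar q = vpar s + e
    · have h := kap_of_mem_H hk2 hm hx q s
      have e1 : vpar s * c + vpar s * e = (vpar q * vpar s + vpar s) +
          (vpar q * c + vpar q * e + e * (c + vpar q)) := by
        rw [hq]
        generalize (vpar s : ZMod 2) = b
        clear hq hf he ht
        revert b c e
        decide
      rw [e1, sgn_add (vpar q * vpar s + vpar s)]
      linear_combination sgn F (vpar q * c + vpar q * e + e * (c + vpar q)) * h
    · have hq' : vpar (conj s : Var k l) ≠ vpar (conj q : Var k l) + e := by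
        rw [vpar_conj, vpar_conj]
        rintro h
        rw [h, add_assoc, CharTwo.add_self_eq_zero, add_zero] at hq
        exact hq rfl
      rw [kap_eq_zero_of_Epar he hq, kap_eq_zero_of_Epar he hq']
      ring
  rw [DH, DH, map_sum, ← sub_eq_zero, ← Finset.sum_sub_distrib, ← neg_eq_zero, ← h0,
    ← Finset.sum_add_distrib, ← Finset.sum_neg_distrib]
  refine Finset.sum_congr rfl fun s _ => ?_
  rw [map_smul, adE_fder_of_mem_W hm hxW he hd, apply_der_of_mem_W hm hxW he hd, ht, vpar_conj]
  simp only [fder_sub, fder_smul, fder_sum, smul_sub, Finset.smul_sum, mul_add,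
    sgn_add, mul_smul, smul_comm (kap _ _ _)]
  abel

theorem isGood_H (hk : 1 ≤ k) (hk2 : Even k) (hm : ∀ i, 1 ≤ m i) : IsGood (H F p m l) where
  le_W := H_le_W
  der_mem := der_mem_H hk hk2 hm
  le_span := by
    refine Submodule.span_le.2 ?_
    rintro _ ⟨a, ha, rfl⟩
    exact Submodule.subset_span ⟨DH_bas_mem_H (zdeg_lt_topDeg ha).ne,
      ⟨_, DH_mem_Epar (bas_mem_Opar a)⟩, _, DH_mem_Edeg _ (bas_mem_Odeg a)⟩
  der_bracket s x hx := by
    induction hx using Submodule.span_induction with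
    | mem y hy =>
      obtain ⟨a, ha, rfl⟩ := hy
      have h1 : ∀ t, der s (der t (bas F p m l a)) =
          sgn F (vpar s * vpar t) • der t (der s (bas F p m l a)) :=
        fun t => LinearMap.congr_fun (der_comp_der s t) _
      have h2 := DH_mem_H (n := zdeg a - 1) (by have := zdeg_lt_topDeg ha; omega)
        (der_mem_Opar s (bas_mem_Opar a)) (der_mem_Odeg s (bas_mem_Odeg (F := F) a))
      convert h2 using 1
      simp only [DH, map_sum, map_smul, adE_der_fder, h1, fder_smul, smul_smul, mul_add, sgn_add,
        mul_assoc, mul_comm (vpar s)]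
    | zero => simp
    | add y z _ _ hy hz => rw [map_add]; exact add_mem hy hz
    | smul c y _ hy => rw [map_smul]; exact Submodule.smul_mem _ _ hy
  bracket_zero a b x y hx hy hx0 hy0 ha hb := by
    rw [← adE_of_mem_Epar _ _ hb]
    clear hy0 hb
    induction hy using Submodule.span_induction with
    | mem y hy =>
      obtain ⟨d, hd, rfl⟩ := hy
      rw [adE_DH hk2 hm hx ha hx0 (bas_mem_Opar d)]
      exact DH_mem_H (by have := zdeg_lt_topDeg hd; omega)
        (apply_mem_Opar ha (bas_mem_Opar d)) (apply_mem_Odeg hx0 (bas_mem_Odeg d))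
    | zero => simp
    | add y z _ _ hy hz => rw [map_add]; exact add_mem hy hz
    | smul c y _ hy => rw [map_smul]; exact Submodule.smul_mem _ _ hy

end Algebra

/-! ### Super bracket identities and homogeneous decomposition -/

section Algebra

variable {F : Type*} [Field F] {p : ℕ} {k : ℕ} {m : Fin k → ℕ} {l : ℕ}

theorem sbr_sum_left {A ι : Type*} [Ring A] [Algebra F A] (t : Finset ι) (a b : ZMod 2)
    (c : ι → F) (x : ι → A) (y : A) :
    sbr F a b (∑ i ∈ t, c i • x i) y = ∑ i ∈ t, c i • sbr F a b (x i) y := by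
  simp only [sbr, Finset.sum_mul, Finset.mul_sum, Finset.smul_sum, smul_sub,
    Finset.sum_sub_distrib, smul_mul_assoc, mul_smul_comm, smul_comm (sgn F _)]

theorem sbr_add_left {A : Type*} [Ring A] [Algebra F A] (a b : ZMod 2) (x x' y : A) :
    sbr F a b (x + x') y = sbr F a b x y + sbr F a b x' y := by
  simp only [sbr, add_mul, mul_add, smul_add]
  abel

theorem sbr_add_right {A : Type*} [Ring A] [Algebra F A] (a b : ZMod 2) (x y y' : A) :
    sbr F a b x (y + y') = sbr F a b x y + sbr F a b x y' := by
  simp only [sbr, add_mul, mul_add, smul_add]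
  abel

theorem sbr_smul_left {A : Type*} [Ring A] [Algebra F A] (a b : ZMod 2) (c : F) (x y : A) :
    sbr F a b (c • x) y = c • sbr F a b x y := by
  simp only [sbr, smul_mul_assoc, mul_smul_comm, smul_sub, smul_comm (sgn F _)]

theorem sbr_smul_right {A : Type*} [Ring A] [Algebra F A] (a b : ZMod 2) (c : F) (x y : A) :
    sbr F a b x (c • y) = c • sbr F a b x y := by
  simp only [sbr, smul_mul_assoc, mul_smul_comm, smul_sub, smul_comm (sgn F _)]

theorem sbr_swap {A : Type*} [Ring A] [Algebra F A] (a b : ZMod 2) (x y : A) :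
    sbr F a b x y = -(sgn F (a * b) • sbr F b a y x) := by
  rw [sbr, sbr, mul_comm b a, smul_sub, smul_smul, sgn_mul_self, one_smul, neg_sub]

/-- The super Jacobi identity, for the commutator with `d`. -/
theorem sbr_jacobi {A : Type*} [Ring A] [Algebra F A] (s a b : ZMod 2) (d x y : A) :
    sbr F s (a + b) d (sbr F a b x y) =
      sbr F (s + a) b (sbr F s a d x) y + sgn F (s * a) • sbr F a (s + b) x (sbr F s b d y) := by
  have e1 : sgn F ((s + a) * b) = sgn F (s * b) * sgn F (a * b) := by rw [add_mul, sgn_add]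
  have e2 : sgn F (a * (s + b)) = sgn F (s * a) * sgn F (a * b) := by
    rw [mul_add, sgn_add, mul_comm a s]
  have e3 : sgn F (s * (a + b)) = sgn F (s * a) * sgn F (s * b) := by rw [mul_add, sgn_add]
  simp only [sbr, e1, e2, e3, sub_mul, mul_sub, smul_sub, smul_mul_assoc, mul_smul_comm,
    smul_smul, mul_assoc]
  rcases sgn_eq_one_or (F := F) (s * a) with h1 | h1 <;>
  rcases sgn_eq_one_or (F := F) (s * b) with h2 | h2 <;>
  rcases sgn_eq_one_or (F := F) (a * b) with h3 | h3 <;>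
  simp only [h1, h2, h3, one_smul, neg_smul, mul_one, mul_neg, neg_neg] <;> abel

/-- `L` is the sum of its homogeneous parts. -/
theorem IsGood.mem_span [NeZero (2 : F)] {L : Submodule F (Module.End F (O F p m l))}
    (hL : L ≤ Submodule.span F
      {D | D ∈ L ∧ (∃ a, D ∈ Epar F p m l a) ∧ ∃ n, D ∈ Edeg F p m l n})
    {a : ZMod 2} {x : Module.End F (O F p m l)} (hx : x ∈ L) (ha : x ∈ Epar F p m l a) :
    x ∈ Submodule.span F {D | D ∈ L ∧ D ∈ Epar F p m l a ∧ ∃ n, D ∈ Edeg F p m l n} := by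
  -- Twice the projection onto parity `a`. Applied to a decomposition of `x` into bihomogeneous
  -- elements, it discards those of the other parity.
  let P : Module.End F (O F p m l) →ₗ[F] Module.End F (O F p m l) :=
    LinearMap.id + sgn F a • tw F p m l 1
  have hP : P x = (2 : F) • x := by
    simp only [P, LinearMap.add_apply, LinearMap.smul_apply, LinearMap.id_apply,
      tw_of_mem_Epar 1 ha, one_mul, smul_smul, sgn_mul_self, two_smul, one_smul]
  rw [← Submodule.smul_mem_iff _ (NeZero.ne (2 : F)), ← hP]
  have h := Submodule.mem_map_of_mem (f := P) (hL hx)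
  rw [Submodule.map_span] at h
  refine Submodule.span_le.2 ?_ h
  rintro _ ⟨D, ⟨hD, ⟨b, hb⟩, hn⟩, rfl⟩
  simp only [P, LinearMap.add_apply, LinearMap.smul_apply, LinearMap.id_apply,
      tw_of_mem_Epar 1 hb, one_mul, smul_smul, ← sgn_add]
  by_cases h : b = a
  · subst h
    have : D ∈ Submodule.span F {D | D ∈ L ∧ D ∈ Epar F p m l b ∧ ∃ n, D ∈ Edeg F p m l n} :=
      Submodule.subset_span ⟨hD, hb, hn⟩
    exact add_mem this (Submodule.smul_mem _ _ this)
  · rw [zmod_two_add_of_ne h, sgn_one, neg_one_smul, add_neg_cancel]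
    exact zero_mem _

variable {V : Type*} [AddCommGroup V] [Module F V]

/-! ## Detection of zero in tensor products -/

/-- By `eq_zero_of_der` the map from `f` to its constant term and its derivatives is injective,
hence has a left inverse. The resulting formula for the identity survives tensoring with V, which a
mere injectivity statement does not do so directly. -/
theorem exists_reconstruction : ∃ (G0 : F →ₗ[F] O F p m l)
    (G : Var k l → (O F p m l →ₗ[F] O F p m l)),
    (LinearMap.id : O F p m l →ₗ[F] O F p m l) = G0 ∘ₗ eps + ∑ s, G s ∘ₗ der s := by
  let Φ : O F p m l →ₗ[F] F × (Var k l → O F p m l) :=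
    LinearMap.prod eps (LinearMap.pi der)
  have hΦ : LinearMap.ker Φ = ⊥ := by
    rw [LinearMap.ker_eq_bot']
    intro f hf
    rw [Prod.ext_iff, funext_iff] at hf
    exact eq_zero_of_der hf.1 hf.2
  obtain ⟨G, hG⟩ := Φ.exists_leftInverse_of_injective hΦ
  refine ⟨G ∘ₗ LinearMap.inl F _ _, fun s => G ∘ₗ LinearMap.inr F _ _ ∘ₗ
    LinearMap.single F (fun _ : Var k l => O F p m l) s, ?_⟩
  rw [← hG]
  ext1 f
  simp only [LinearMap.comp_apply, LinearMap.add_apply, LinearMap.sum_apply, ← map_sum,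
    ← map_add]
  congr 1
  refine Prod.ext (by simp [Φ]) ?_
  funext t
  simp [Φ, Prod.snd_sum, Finset.sum_apply, Pi.single_apply, -Fintype.sum_sum_type]

theorem tensor_eq_zero {w : O F p m l ⊗[F] V}
    (h0 : TensorProduct.map (eps : O F p m l →ₗ[F] F) (LinearMap.id : V →ₗ[F] V) w = 0)
    (h : ∀ s, TensorProduct.map (der s) (LinearMap.id : V →ₗ[F] V) w = 0) : w = 0 := by
  obtain ⟨G0, G, hG⟩ := exists_reconstruction (F := F) (p := p) (m := m) (l := l)
  have h1 : w = TensorProduct.map (LinearMap.id : O F p m l →ₗ[F] O F p m l)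
      (LinearMap.id : V →ₗ[F] V) w := by simp
  have h2 : TensorProduct.map (G0 ∘ₗ eps) (LinearMap.id : V →ₗ[F] V) w = 0 := by
    rw [show (LinearMap.id : V →ₗ[F] V) = LinearMap.id ∘ₗ LinearMap.id from rfl,
      TensorProduct.map_comp, LinearMap.comp_apply, h0, map_zero]
  have h3 : ∀ s, TensorProduct.map (G s ∘ₗ der s) (LinearMap.id : V →ₗ[F] V) w = 0 := by
    intro s
    rw [show (LinearMap.id : V →ₗ[F] V) = LinearMap.id ∘ₗ LinearMap.id from rfl,
      TensorProduct.map_comp, LinearMap.comp_apply, h s, map_zero]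
  have h4 : TensorProduct.map (∑ s, G s ∘ₗ der s) (LinearMap.id : V →ₗ[F] V) w =
      ∑ s, TensorProduct.map (G s ∘ₗ der s) (LinearMap.id : V →ₗ[F] V) w := by
    rw [← LinearMap.sum_apply]
    refine LinearMap.congr_fun (TensorProduct.ext' fun f v => ?_) w
    simp only [TensorProduct.map_tmul, LinearMap.sum_apply, TensorProduct.sum_tmul]
  rw [h1, hG, TensorProduct.map_add_left, LinearMap.add_apply, h2, h4]
  simp [h3]

theorem tensor_op_ext {M : Type*} [AddCommGroup M] [Module F M]
    {A B : O F p m l ⊗[F] V →ₗ[F] M}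
    (h : ∀ a v, A (bas F p m l a ⊗ₜ v) = B (bas F p m l a ⊗ₜ v)) : A = B := by
  refine TensorProduct.ext ((bas F p m l).ext fun a => ?_)
  ext1 v
  exact h a v

/-! ## The mixed product -/

/-- The mixed product action, for arbitrary endomorphisms of `O(k, l, m)`. -/
def mixedLin (η : Module.End F (O F p m l) →ₗ[F] Module.End F V) :
    Module.End F (O F p m l) →ₗ[F] Module.End F (O F p m l ⊗[F] V) where
  toFun D := TensorProduct.map D LinearMap.id +
    ∑ s : Var k l, ∑ r : Var k l,
      TensorProduct.map
        (mulO (parTwist (vpar r) (der r (D (gen F p m s)))) * parTwist (vpar r + vpar s))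
        (η (fder (gen F p m r) s))
  map_add' D E := by
    simp only [LinearMap.add_apply, map_add, add_mul, TensorProduct.map_add_left,
      Finset.sum_add_distrib]
    abel
  map_smul' c D := by
    simp only [LinearMap.smul_apply, map_smul, smul_mul_assoc, TensorProduct.map_smul_left,
      Finset.smul_sum, smul_add, RingHom.id_apply]

theorem mixedLin_apply (η : Module.End F (O F p m l) →ₗ[F] Module.End F V)
    (D : Module.End F (O F p m l)) :
    mixedLin η D = TensorProduct.map D LinearMap.id +
    ∑ s : Var k l, ∑ r : Var k l,
      TensorProduct.map
        (mulO (parTwist (vpar r) (der r (D (gen F p m s)))) * parTwist (vpar r + vpar s))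
        (η (fder (gen F p m r) s)) := rfl

/-- The linear part of a derivation. -/
def linPart : Module.End F (O F p m l) →ₗ[F] Module.End F (O F p m l) :=
  ∑ q : Var k l, ∑ r : Var k l, (kap q r).smulRight (fder (gen F p m r) q)

theorem linPart_apply (x : Module.End F (O F p m l)) :
    linPart x = ∑ q, ∑ r, kap q r x • fder (gen F p m r) q := by
  simp [linPart, LinearMap.sum_apply]

theorem linPart_of_mem_Edeg {x : Module.End F (O F p m l)} {n : ℤ} (hn : n ≠ 0)
    (hx : x ∈ Edeg F p m l n) : linPart x = 0 := by
  rw [linPart_apply]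
  exact Finset.sum_eq_zero fun q _ => Finset.sum_eq_zero fun r _ => by
    rw [kap_eq_zero_of_Edeg hx hn, zero_smul]

theorem eps_comp_eq_zero {x : Module.End F (O F p m l)} {n : ℤ} (hn : 0 ≤ n)
    (hx : x ∈ Edeg F p m l n) (h1 : x (one F p m l) = 0) :
    (eps : O F p m l →ₗ[F] F) ∘ₗ x = 0 := by
  refine (bas F p m l).ext fun a => ?_
  rw [LinearMap.comp_apply, LinearMap.zero_apply]
  by_cases h : (zdeg a : ℤ) + n = 0
  · have ha := bas_mem_Odeg (F := F) a
    rw [show (zdeg a : ℤ) = 0 by omega] at ha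
    rw [eq_smul_one ha, map_smul, h1, smul_zero, map_zero]
  · exact eps_of_mem_Odeg h (apply_mem_Odeg hx (bas_mem_Odeg a))

section Prime

variable [Fact p.Prime] [CharP F p] [NeZero (2 : F)]

theorem linPart_of_mem_W (hm : ∀ i, 1 ≤ m i) {x : Module.End F (O F p m l)}
    (hx : x ∈ W F p m l) (hd : x ∈ Edeg F p m l 0) : linPart x = x := by
  conv_rhs => rw [eq_sum_fder_of_mem_W hm hx]
  rw [linPart_apply]
  refine Finset.sum_congr rfl fun q _ => ?_
  conv_rhs => rw [eq_sum_gen hm (f := x (gen F p m q))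
    (by simpa using apply_mem_Odeg hd (gen_mem_Odeg q)), fder_sum]
  simp only [fder_smul, kap_apply]

/-- `eps` is multiplicative and insensitive to parity twists, so each coefficient `∂_r(f_s)`
contributes only its constant term, and these form the linear part of `x`. -/
theorem eps_comp_mixedLin (η : Module.End F (O F p m l) →ₗ[F] Module.End F V)
    (x : Module.End F (O F p m l)) (h : (eps : O F p m l →ₗ[F] F) ∘ₗ x = 0) :
    TensorProduct.map (eps : O F p m l →ₗ[F] F) (LinearMap.id : V →ₗ[F] V) ∘ₗ mixedLin η x =
      TensorProduct.map eps (η (linPart x)) := by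
  refine TensorProduct.ext' fun f v => ?_
  have h' : eps (x f) = 0 := LinearMap.congr_fun h f
  simp only [mixedLin_apply, linPart_apply, LinearMap.sum_apply, h', eps_mulO, eps_parTwist,
    kap_apply, TensorProduct.tmul_sum, TensorProduct.tmul_smul, LinearMap.comp_apply, map_sum,
    LinearMap.add_apply, map_add, TensorProduct.map_tmul, TensorProduct.zero_tmul, zero_add,
    Module.End.mul_apply, map_smul, LinearMap.smul_apply, TensorProduct.smul_tmul', smul_eq_mul,
    LinearMap.id_apply]

theorem mixedLin_der (hm : ∀ i, 1 ≤ m i) (η : Module.End F (O F p m l) →ₗ[F] Module.End F V)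
    (s : Var k l) : mixedLin η (der s) = TensorProduct.map (der s) LinearMap.id := by
  have : ∀ r q, der r (der s (gen F p m q)) = 0 := by
    intro r q
    rw [der_gen hm]
    split_ifs
    · exact der_one r
    · simp
  simp [mixedLin_apply, this]

/-- The coefficients of the bracket of `∂_s` with `x` are the `∂_s`-derivatives of those of `x`, so
this is the Leibniz rule for `∂_s`. Nothing is assumed about `η`, since `∂_s` does not touch the
factor V. -/
theorem map_der_mul_mixedLin (hm : ∀ i, 1 ≤ m i)
    (η : Module.End F (O F p m l) →ₗ[F] Module.End F V) (s : Var k l) {a : ZMod 2}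
    {x : Module.End F (O F p m l)} (hx : x ∈ Epar F p m l a) (h1 : x (one F p m l) = 0) :
    mixedLin η (sbr F (vpar s) a (der s) x) =
      sbr F (vpar s) a (TensorProduct.map (der s) LinearMap.id) (mixedLin η x) := by
  have hs : ∀ q, sbr F (vpar s) a (der s) x (gen F p m q) = der s (x (gen F p m q)) := by
    intro q
    rw [sbr, LinearMap.sub_apply, LinearMap.smul_apply, Module.End.mul_apply,
      Module.End.mul_apply, der_gen hm]
    split_ifs <;> simp [h1]
  have key : ∀ q r, mulO (parTwist (vpar r) (der r (der s (x (gen F p m q))))) *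
        parTwist (vpar r + vpar q) =
      sbr F (vpar s) a (der s) (mulO (parTwist (vpar r) (der r (x (gen F p m q)))) *
        parTwist (vpar r + vpar q)) := by
    intro q r
    have hg : der r (x (gen F p m q)) ∈ Opar F p m l (vpar q + a + vpar r) :=
      der_mem_Opar r (apply_mem_Opar hx (gen_mem_Opar q))
    have h2 : der s (parTwist (vpar r) (der r (x (gen F p m q)))) =
        parTwist (vpar r) (der r (der s (x (gen F p m q)))) := by
      have h3 := LinearMap.congr_fun (der_comp_der s r) (x (gen F p m q))
      simp only [Module.End.mul_apply, LinearMap.smul_apply] at h3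
      rw [parTwist_of_mem_Opar _ hg, map_smul, h3,
        parTwist_of_mem_Opar _ (der_mem_Opar r (der_mem_Opar s
          (apply_mem_Opar hx (gen_mem_Opar q)))), smul_smul, ← sgn_add]
      congr 1
      refine sgn_congr ?_
      generalize (vpar q : ZMod 2) = a1
      generalize (vpar r : ZMod 2) = a2
      generalize (vpar s : ZMod 2) = a3
      clear hg h3 hs hx
      revert a a1 a2 a3
      decide
    ext1 g
    rw [sbr, LinearMap.sub_apply, LinearMap.smul_apply, Module.End.mul_apply,
      Module.End.mul_apply, Module.End.mul_apply, Module.End.mul_apply, Module.End.mul_apply,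
      der_mulO_apply, h2, parTwist_der (vpar r + vpar q) s, map_smul,
      parTwist_of_mem_Opar (vpar r) hg, map_smul, parTwist_of_mem_Opar _ hg]
    simp only [map_smul, LinearMap.smul_apply, smul_smul, ← sgn_add]
    rw [add_sub_assoc, left_eq_add, sub_eq_zero]
    congr 1
    refine sgn_congr ?_
    generalize (vpar q : ZMod 2) = a1
    generalize (vpar r : ZMod 2) = a2
    generalize (vpar s : ZMod 2) = a3
    clear hg h2 hs hx
    revert a a1 a2 a3
    decide
  rw [mixedLin_apply, mixedLin_apply]
  simp only [hs, key]
  refine TensorProduct.ext' fun f v => ?_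
  simp only [sbr, LinearMap.add_apply, LinearMap.sum_apply, TensorProduct.map_tmul,
    LinearMap.sub_apply, LinearMap.smul_apply, Module.End.mul_apply, map_add, map_sum,
    LinearMap.id_apply, TensorProduct.sub_tmul, TensorProduct.smul_tmul', smul_add,
    Finset.smul_sum, Finset.sum_sub_distrib]
  abel

end Prime
end Algebra

/-! ### The mixed product is an L-module -/

section Algebra

variable {F : Type*} [Field F] {p : ℕ} {k : ℕ} {m : Fin k → ℕ} {l : ℕ}
variable {V : Type*} [AddCommGroup V] [Module F V]
variable [Fact p.Prime] [CharP F p] [NeZero (2 : F)]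
variable {L : Submodule F (Module.End F (O F p m l))}

theorem eq_sum_der_of_mem_W (hm : ∀ i, 1 ≤ m i) {x : Module.End F (O F p m l)}
    (hx : x ∈ W F p m l) (hd : x ∈ Edeg F p m l (-1)) :
    x = ∑ q, eps (x (gen F p m q)) • der q := by
  conv_lhs => rw [eq_sum_fder_of_mem_W hm hx]
  refine Finset.sum_congr rfl fun q _ => ?_
  conv_lhs => rw [eq_smul_one (f := x (gen F p m q))
    (by simpa using apply_mem_Odeg hd (gen_mem_Odeg q)), fder_smul, fder_one]

theorem eq_zero_of_mem_W (hm : ∀ i, 1 ≤ m i) {x : Module.End F (O F p m l)}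
    (hx : x ∈ W F p m l) {n : ℤ} (hn : n < -1) (hd : x ∈ Edeg F p m l n) : x = 0 := by
  rw [eq_sum_fder_of_mem_W hm hx]
  refine Finset.sum_eq_zero fun q _ => ?_
  rw [eq_zero_of_mem_Odeg_neg (by omega) (apply_mem_Odeg hd (gen_mem_Odeg q)), fder_zero]

theorem sbr_apply_one (a b : ZMod 2) {x y : Module.End F (O F p m l)}
    (hx : x (one F p m l) = 0) (hy : y (one F p m l) = 0) : sbr F a b x y (one F p m l) = 0 := by
  simp [sbr, hx, hy]

theorem eps_gen_eq_zero_of_Epar {a : ZMod 2} {x : Module.End F (O F p m l)}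
    (ha : x ∈ Epar F p m l a) {q : Var k l} (hq : vpar q ≠ a) : eps (x (gen F p m q)) = 0 := by
  refine eps_eq_zero_of_mem_Opar (apply_mem_Opar ha (gen_mem_Opar q)) ?_
  rw [Ne, CharTwo.add_eq_zero]
  exact hq

theorem mixedLin_sbr_of_neg_one (hm : ∀ i, 1 ≤ m i)
    (η : Module.End F (O F p m l) →ₗ[F] Module.End F V) {a b : ZMod 2}
    {x y : Module.End F (O F p m l)} (hx : x ∈ W F p m l) (hd : x ∈ Edeg F p m l (-1))
    (ha : x ∈ Epar F p m l a) (hb : y ∈ Epar F p m l b) (hy : y (one F p m l) = 0) :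
    mixedLin η (sbr F a b x y) = sbr F a b (mixedLin η x) (mixedLin η y) := by
  rw [eq_sum_der_of_mem_W hm hx hd, sbr_sum_left, map_sum, map_sum]
  simp only [map_smul]
  rw [sbr_sum_left]
  refine Finset.sum_congr rfl fun q _ => ?_
  by_cases hq : vpar q = a
  · rw [← hq, map_der_mul_mixedLin hm η q hb hy, mixedLin_der hm]
  · rw [eps_gen_eq_zero_of_Epar ha hq, zero_smul, zero_smul]

theorem extAct_sbr (ρ : SuperRep (Lz L 0) V) {a b : ZMod 2}
    {x y : Module.End F (O F p m l)} (hx : x ∈ Lz L 0) (hy : y ∈ Lz L 0)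
    (ha : x ∈ Epar F p m l a) (hb : y ∈ Epar F p m l b) (hz : sbr F a b x y ∈ Lz L 0) :
    extAct ρ (sbr F a b x y) = sbr F a b (extAct ρ x) (extAct ρ y) := by
  have := ρ.act_bracket a b ⟨x, hx⟩ ⟨y, hy⟩ ⟨_, hz⟩ ha hb rfl
  rw [← extAct_eq, ← extAct_eq, ← extAct_eq] at this
  exact this

theorem IsGood.sbr_der_mem (hL : IsGood L) (s : Var k l) {a : ZMod 2}
    {x : Module.End F (O F p m l)} (hx : x ∈ L) (ha : x ∈ Epar F p m l a) :
    sbr F (vpar s) a (der s) x ∈ L := by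
  rw [← adE_of_mem_Epar _ _ ha]
  exact hL.der_bracket s x hx

/-- Induction on the sum of the degrees of `x`, `y` and `f`: applying `∂_s` lowers one of the three
by one, and constant terms are controlled by `L_0`. Thus `extAct` is only ever evaluated in a
meaningful way on `L_0`, although single terms of the formula involve its arbitrary values
elsewhere. -/
theorem IsGood.mixedLin_sbr_apply (hL : IsGood L) (hm : ∀ i, 1 ≤ m i)
    (ρ : SuperRep (Lz L 0) V) (n : ℕ) :
    ∀ i j d : ℤ, i + j + d + 2 < n → ∀ (a b : ZMod 2) (x y : Module.End F (O F p m l)),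
      x ∈ L → y ∈ L → x ∈ Epar F p m l a → y ∈ Epar F p m l b → x ∈ Edeg F p m l i →
      y ∈ Edeg F p m l j → ∀ f ∈ Odeg F p m l d, ∀ v : V,
      mixedLin (extAct ρ) (sbr F a b x y) (f ⊗ₜ v) =
        sbr F a b (mixedLin (extAct ρ) x) (mixedLin (extAct ρ) y) (f ⊗ₜ v) := by
  induction n with
  | zero =>
    intro i j d h a b x y hx hy ha hb hi hj f hf v
    push_cast at h
    -- L vanishes below degree `-1` and O(k,l,m) below degree 0, so when `i + j + d + 2` is negative
    -- one of `x`, `y`, `f` is zero.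
    rcases lt_or_ge d 0 with hd | hd
    · simp [eq_zero_of_mem_Odeg_neg hd hf]
    · rcases lt_or_ge i (-1) with hi' | hi'
      · simp [eq_zero_of_mem_W hm (hL.le_W hx) hi' hi, sbr]
      · simp [eq_zero_of_mem_W hm (hL.le_W hy) (show j < -1 by omega) hj, sbr]
  | succ n ih =>
    intro i j d h a b x y hx hy ha hb hi hj f hf v
    push_cast at h
    have hx1 := W_apply_one (hL.le_W hx)
    have hy1 := W_apply_one (hL.le_W hy)
    rcases lt_trichotomy i (-1) with hi' | rfl | hi'
    · simp [eq_zero_of_mem_W hm (hL.le_W hx) hi' hi, sbr]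
    · rw [mixedLin_sbr_of_neg_one hm _ (hL.le_W hx) hi ha hb hy1]
    rcases lt_trichotomy j (-1) with hj' | rfl | hj'
    · simp [eq_zero_of_mem_W hm (hL.le_W hy) hj' hj, sbr]
    · rw [sbr_swap, map_neg, map_smul, mixedLin_sbr_of_neg_one hm _ (hL.le_W hy) hj hb ha hx1,
        ← sbr_swap]
    rw [← sub_eq_zero, ← LinearMap.sub_apply]
    -- Elements of degree `-1` are combinations of the `∂_s` and are already dealt with; from here
    -- on `i` and `j` are nonnegative.
    apply tensor_eq_zero
    · have h1 := eps_comp_mixedLin (extAct ρ) x (eps_comp_eq_zero (by omega) hi hx1)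
      have h2 := eps_comp_mixedLin (extAct ρ) y (eps_comp_eq_zero (by omega) hj hy1)
      have h3 := eps_comp_mixedLin (extAct ρ) (sbr F a b x y)
        (eps_comp_eq_zero (by omega) (sbr_mem_Edeg a b hi hj) (sbr_apply_one a b hx1 hy1))
      have h4 : ∀ A : Module.End F V, TensorProduct.map (eps : O F p m l →ₗ[F] F) A =
          TensorProduct.map LinearMap.id A ∘ₗ TensorProduct.map eps LinearMap.id := fun A => by
        rw [← TensorProduct.map_comp]; rfl
      -- Linear parts exist only in degree zero. If `i` or `j` is positive then so is `i + j`, and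
      -- both sides vanish; otherwise this is the bracket relation of the representation `ρ`.
      have h5 : extAct ρ (linPart (sbr F a b x y)) =
          sbr F a b (extAct ρ (linPart x)) (extAct ρ (linPart y)) := by
        by_cases hi0 : i = 0
        · by_cases hj0 : j = 0
          · subst hi0 hj0
            have hz := hL.bracket_zero a b x y hx hy hi hj ha hb
            have hz0 : sbr F a b x y ∈ Edeg F p m l 0 := by simpa using sbr_mem_Edeg a b hi hj
            rw [linPart_of_mem_W hm (hL.le_W hx) hi, linPart_of_mem_W hm (hL.le_W hy) hj,
              linPart_of_mem_W hm (hL.le_W hz) hz0]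
            exact extAct_sbr ρ ⟨hx, hi⟩ ⟨hy, hj⟩ ha hb ⟨hz, hz0⟩
          · rw [linPart_of_mem_Edeg (by omega) (sbr_mem_Edeg a b hi hj),
              linPart_of_mem_Edeg hj0 hj]
            simp [sbr]
        · rw [linPart_of_mem_Edeg (by omega) (sbr_mem_Edeg a b hi hj),
            linPart_of_mem_Edeg hi0 hi]
          simp [sbr]
      have h6 : TensorProduct.map (eps : O F p m l →ₗ[F] F) (LinearMap.id : V →ₗ[F] V) ∘ₗ
          sbr F a b (mixedLin (extAct ρ) x) (mixedLin (extAct ρ) y) =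
          TensorProduct.map eps (sbr F a b (extAct ρ (linPart x)) (extAct ρ (linPart y))) := by
        have h7 : ∀ x y : Module.End F (O F p m l),
            TensorProduct.map (eps : O F p m l →ₗ[F] F) (LinearMap.id : V →ₗ[F] V) ∘ₗ
              mixedLin (extAct ρ) x = TensorProduct.map eps (extAct ρ (linPart x)) →
            TensorProduct.map (eps : O F p m l →ₗ[F] F) (LinearMap.id : V →ₗ[F] V) ∘ₗ
              mixedLin (extAct ρ) y = TensorProduct.map eps (extAct ρ (linPart y)) →
            TensorProduct.map (eps : O F p m l →ₗ[F] F) (LinearMap.id : V →ₗ[F] V) ∘ₗ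
              (mixedLin (extAct ρ) x * mixedLin (extAct ρ) y) =
              TensorProduct.map eps (extAct ρ (linPart x) * extAct ρ (linPart y)) := by
          intro x y hx hy
          rw [Module.End.mul_eq_comp, ← LinearMap.comp_assoc, hx, h4, LinearMap.comp_assoc, hy,
            ← TensorProduct.map_comp]
          rfl
        rw [sbr, LinearMap.comp_sub, LinearMap.comp_smul, h7 x y h1 h2, h7 y x h2 h1, sbr]
        refine TensorProduct.ext' fun g w => ?_
        simp only [LinearMap.sub_apply, LinearMap.smul_apply, TensorProduct.map_tmul,
          TensorProduct.tmul_sub, TensorProduct.tmul_smul]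
      have h8 := LinearMap.congr_fun (h3.trans ((congrArg (TensorProduct.map eps) h5).trans h6.symm))
        (f ⊗ₜ v)
      rw [LinearMap.sub_apply, map_sub, sub_eq_zero]
      exact h8
    -- By the Jacobi identity, the `∂_s`-derivative of the defect is expressed by the defects for
    -- `∂_s` bracketed with `x`, for `∂_s` bracketed with `y`, and for the derivative of `f`, each
    -- covered by the induction hypothesis.
    · intro s
      have e1 := ih (-1 + i) j d (by omega) (vpar s + a) b _ y (hL.sbr_der_mem s hx ha) hy
        (sbr_mem_Epar (der_mem_Epar s) ha) hb (sbr_mem_Edeg _ _ (der_mem_Edeg s) hi) hj f hf v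
      have e2 := ih i (-1 + j) d (by omega) a (vpar s + b) x _ hx (hL.sbr_der_mem s hy hb)
        ha (sbr_mem_Epar (der_mem_Epar s) hb) hi (sbr_mem_Edeg _ _ (der_mem_Edeg s) hj) f hf v
      have e3 := ih i j (d - 1) (by omega) a b x y hx hy ha hb hi hj _ (der_mem_Odeg s hf) v
      have e4 := map_der_mul_mixedLin hm (extAct ρ) s (sbr_mem_Epar ha hb)
        (sbr_apply_one a b hx1 hy1)
      have e5 := sbr_jacobi (F := F) (vpar s) a b
        (TensorProduct.map (der s) LinearMap.id : Module.End F (O F p m l ⊗[F] V))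
        (mixedLin (extAct ρ) x) (mixedLin (extAct ρ) y)
      rw [← map_der_mul_mixedLin hm (extAct ρ) s ha hx1,
        ← map_der_mul_mixedLin hm (extAct ρ) s hb hy1] at e5
      rw [sbr_jacobi, map_add, map_smul] at e4
      have e6 := LinearMap.congr_fun e4 (f ⊗ₜ v)
      have e7 := LinearMap.congr_fun e5 (f ⊗ₜ v)
      rw [LinearMap.add_apply, LinearMap.smul_apply, e1, e2, ← LinearMap.smul_apply,
        ← LinearMap.add_apply, ← e7] at e6
      have e8 : ∀ A : Module.End F (O F p m l ⊗[F] V),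
          sbr F (vpar s) (a + b) (TensorProduct.map (der s) LinearMap.id) A (f ⊗ₜ v) =
            TensorProduct.map (der s) LinearMap.id (A (f ⊗ₜ v)) -
              sgn F (vpar s * (a + b)) • A (der s f ⊗ₜ v) := fun A => rfl
      rw [e8, e8, e3, sub_left_inj] at e6
      rw [LinearMap.sub_apply, map_sub, e6, sub_self]

/-- The mixed product is a module over `L`. -/
theorem IsGood.mixedLin_sbr (hL : IsGood L) (hm : ∀ i, 1 ≤ m i)
    (ρ : SuperRep (Lz L 0) V) {a b : ZMod 2} {x y : Module.End F (O F p m l)}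
    (hx : x ∈ L) (hy : y ∈ L) (ha : x ∈ Epar F p m l a) (hb : y ∈ Epar F p m l b) :
    mixedLin (extAct ρ) (sbr F a b x y) =
      sbr F a b (mixedLin (extAct ρ) x) (mixedLin (extAct ρ) y) := by
  have hx' := IsGood.mem_span hL.le_span hx ha
  have hy' := IsGood.mem_span hL.le_span hy hb
  clear hx ha hy hb
  induction hx' using Submodule.span_induction with
  | mem x hx =>
    obtain ⟨hx, ha, i, hi⟩ := hx
    induction hy' using Submodule.span_induction with
    | mem y hy =>
      obtain ⟨hy, hb, j, hj⟩ := hy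
      refine tensor_op_ext fun c v => ?_
      exact hL.mixedLin_sbr_apply hm ρ (i + j + zdeg c + 3).toNat i j (zdeg c) (by omega)
        a b x y hx hy ha hb hi hj _ (bas_mem_Odeg c) v
    | zero => simp [sbr]
    | add y z _ _ h1 h2 => simp only [sbr_add_right, map_add, h1, h2]
    | smul c y _ h => simp only [sbr_smul_right, map_smul, h]
  | zero => simp [sbr]
  | add y z _ _ h1 h2 => simp only [sbr_add_left, map_add, h1, h2]
  | smul c y _ h => simp only [sbr_smul_left, map_smul, h]

end Algebra

section Algebra

variable {F : Type*} [Field F] {p : ℕ} {k : ℕ} {m : Fin k → ℕ} {l : ℕ}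
variable {V : Type*} [AddCommGroup V] [Module F V]
variable {L : Submodule F (Module.End F (O F p m l))}

/-! ## Parity of the mixed product -/

theorem SuperRep.exists_gradeInv (ρ : SuperRep (Lz L 0) V) :
    ∃ g : Module.End F V, ∀ c, ∀ v ∈ ρ.grade c, g v = sgn F c • v := by
  classical
  let e := LinearEquiv.ofBijective (DirectSum.coeLinearMap ρ.grade) ρ.isInternal
  refine ⟨(DirectSum.toModule F (ZMod 2) V fun c => sgn F c • (ρ.grade c).subtype) ∘ₗ
    e.symm.toLinearMap, fun c v hv => ?_⟩
  have h : e.symm v = DirectSum.lof F (ZMod 2) (fun c => ρ.grade c) c ⟨v, hv⟩ := by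
    rw [LinearEquiv.symm_apply_eq]
    exact (DirectSum.coeLinearMap_lof ρ.grade c ⟨v, hv⟩).symm
  rw [LinearMap.comp_apply, LinearEquiv.coe_coe, h, DirectSum.toModule_lof]
  rfl

theorem SuperRep.grade_induction (ρ : SuperRep (Lz L 0) V) {P : V → Prop}
    (hom : ∀ c, ∀ v ∈ ρ.grade c, P v) (add : ∀ v w, P v → P w → P (v + w)) (v : V) : P v := by
  classical
  have hv : v ∈ ⨆ c, ρ.grade c := by
    rw [ρ.isInternal.submodule_iSup_eq_top]
    trivial
  exact Submodule.iSup_induction _ (motive := P) hv hom (hom 0 0 (zero_mem _)) add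

theorem tmul_mem_mixedPar (ρ : SuperRep (Lz L 0) V) {a b : ZMod 2} {f : O F p m l} {v : V}
    (hf : f ∈ Opar F p m l a) (hv : v ∈ ρ.grade b) : f ⊗ₜ[F] v ∈ mixedPar ρ (a + b) :=
  Submodule.subset_span ⟨a, b, f, v, hf, hv, rfl, rfl⟩

/-- The analogue of `mem_Opar_iff`, again obtained from twice the projection onto an eigenspace. -/
theorem mem_mixedPar_iff [NeZero (2 : F)] (ρ : SuperRep (Lz L 0) V) {g : Module.End F V}
    (hg : ∀ c, ∀ v ∈ ρ.grade c, g v = sgn F c • v) {c : ZMod 2} {w : O F p m l ⊗[F] V} :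
    w ∈ mixedPar ρ c ↔ TensorProduct.map parAut g w = sgn F c • w := by
  constructor
  · intro hw
    induction hw using Submodule.span_induction with
    | mem w hw =>
      obtain ⟨a, b, f, v, hf, hv, rfl, rfl⟩ := hw
      rw [TensorProduct.map_tmul, parAut_of_mem_Opar hf, hg b v hv, TensorProduct.smul_tmul_smul,
        sgn_add]
    | zero => simp
    | add x y _ _ hx hy => rw [map_add, hx, hy, smul_add]
    | smul r x _ hx => rw [map_smul, hx, smul_comm]
  · intro h
    have key : ∀ w : O F p m l ⊗[F] V,
        w + sgn F c • TensorProduct.map parAut g w ∈ mixedPar ρ c := by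
      intro w
      induction w using TensorProduct.induction_on with
      | zero => simp
      | add x y hx hy =>
        rw [map_add, smul_add, add_add_add_comm]
        exact add_mem hx hy
      | tmul f v =>
        induction v using ρ.grade_induction with
        | add v w hv hw =>
          rw [TensorProduct.tmul_add, map_add, smul_add, add_add_add_comm]
          exact add_mem hv hw
        | hom b v hv =>
          induction (bas F p m l).mem_span f using Submodule.span_induction with
          | zero => simp
          | add f g _ _ hf hg =>
            rw [TensorProduct.add_tmul, map_add, smul_add, add_add_add_comm]
            exact add_mem hf hg
          | smul r f _ hf =>
            rw [← TensorProduct.smul_tmul', map_smul, smul_comm, ← smul_add]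
            exact Submodule.smul_mem _ _ hf
          | mem f hf =>
            obtain ⟨a, rfl⟩ := hf
            rw [TensorProduct.map_tmul, parAut_of_mem_Opar (bas_mem_Opar a), hg b v hv,
              TensorProduct.smul_tmul_smul, smul_smul, ← sgn_add, ← sgn_add]
            have h1 := tmul_mem_mixedPar ρ (bas_mem_Opar (F := F) a) hv
            by_cases h2 : (a.2.card : ZMod 2) + b = c
            · rw [h2] at h1
              exact add_mem h1 (Submodule.smul_mem _ _ h1)
            · rw [zmod_two_add_of_ne h2, sgn_one, neg_one_smul, add_neg_cancel]
              exact zero_mem _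
    have := key w
    rw [h, smul_smul, sgn_mul_self, one_smul, ← two_smul F] at this
    exact (Submodule.smul_mem_iff _ (NeZero.ne (2 : F))).1 this

variable [Fact p.Prime] [CharP F p] [NeZero (2 : F)]

theorem mixedLin_of_neg_one (hm : ∀ i, 1 ≤ m i)
    (η : Module.End F (O F p m l) →ₗ[F] Module.End F V)
    {x : Module.End F (O F p m l)} (hx : x ∈ W F p m l) (hd : x ∈ Edeg F p m l (-1)) :
    mixedLin η x = TensorProduct.map x LinearMap.id := by
  have h := eq_sum_der_of_mem_W hm hx hd
  generalize (fun q => eps (x (gen F p m q))) = c at h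
  rw [h, map_sum]
  simp only [map_smul, mixedLin_der hm]
  refine TensorProduct.ext' fun f v => ?_
  simp only [LinearMap.sum_apply, LinearMap.smul_apply, TensorProduct.map_tmul,
    TensorProduct.sum_tmul, TensorProduct.smul_tmul']

/-- The parity of single terms is not available, since `extAct` is arbitrary outside `L_0`. The
induction of `IsGood.mixedLin_sbr_apply` is used once more, with the parity of the `L_0`-action
entering at constant terms. -/
theorem IsGood.parAut_mixedLin_apply (hL : IsGood L) (hm : ∀ i, 1 ≤ m i)
    (ρ : SuperRep (Lz L 0) V) {g : Module.End F V}
    (hg : ∀ c, ∀ v ∈ ρ.grade c, g v = sgn F c • v) (n : ℕ) :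
    ∀ i d : ℤ, i + d + 1 < n → ∀ (a : ZMod 2) (x : Module.End F (O F p m l)),
      x ∈ L → x ∈ Epar F p m l a → x ∈ Edeg F p m l i → ∀ f ∈ Odeg F p m l d, ∀ v : V,
      TensorProduct.map parAut g (mixedLin (extAct ρ) x (f ⊗ₜ v)) =
        sgn F a • mixedLin (extAct ρ) x (parAut f ⊗ₜ g v) := by
  induction n with
  | zero =>
    intro i d h a x hx ha hi f hf v
    push_cast at h
    rcases lt_or_ge d 0 with hd | hd
    · simp [eq_zero_of_mem_Odeg_neg hd hf]
    · simp [eq_zero_of_mem_W hm (hL.le_W hx) (show i < -1 by omega) hi]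
  | succ n ih =>
    intro i d h a x hx ha hi f hf v
    push_cast at h
    have hx1 := W_apply_one (hL.le_W hx)
    rcases lt_trichotomy i (-1) with hi' | rfl | hi'
    · simp [eq_zero_of_mem_W hm (hL.le_W hx) hi' hi]
    · have h1 : parAut (x f) = sgn F a • x (parAut f) :=
        LinearMap.congr_fun (parAut_mul_of_mem_Epar ha) f
      rw [mixedLin_of_neg_one hm _ (hL.le_W hx) hi, TensorProduct.map_tmul,
        TensorProduct.map_tmul, TensorProduct.map_tmul, h1, TensorProduct.smul_tmul']
      rfl
    have hdeg : parAut f ∈ Odeg F p m l d := by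
      have := parTwist_mem_Odeg 1 hf
      rwa [parTwist_one] at this
    rw [← sub_eq_zero]
    apply tensor_eq_zero
    · have h1 : ∀ w, TensorProduct.map (eps : O F p m l →ₗ[F] F) (LinearMap.id : V →ₗ[F] V)
          (mixedLin (extAct ρ) x w) = TensorProduct.map eps (extAct ρ (linPart x)) w :=
        LinearMap.congr_fun (eps_comp_mixedLin (extAct ρ) x (eps_comp_eq_zero (by omega) hi hx1))
      have h2 : ∀ w, TensorProduct.map (eps : O F p m l →ₗ[F] F) (LinearMap.id : V →ₗ[F] V)
          (TensorProduct.map parAut g w) = TensorProduct.map LinearMap.id g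
            (TensorProduct.map (eps : O F p m l →ₗ[F] F) (LinearMap.id : V →ₗ[F] V) w) := by
        refine LinearMap.congr_fun (f := TensorProduct.map eps LinearMap.id ∘ₗ
          TensorProduct.map parAut g) (g := TensorProduct.map LinearMap.id g ∘ₗ
            TensorProduct.map eps LinearMap.id) (TensorProduct.ext' fun f v => ?_)
        simp [eps_parAut]
      have h3 : g (extAct ρ (linPart x) v) = sgn F a • extAct ρ (linPart x) (g v) := by
        by_cases hi0 : i = 0
        · subst hi0
          rw [linPart_of_mem_W hm (hL.le_W hx) hi,
            show extAct ρ x = _ from extAct_eq ρ ⟨x, hx, hi⟩]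
          induction v using ρ.grade_induction with
          | add v w hv hw => simp only [map_add, hv, hw, smul_add]
          | hom b v hv =>
            rw [hg _ _ (ρ.act_mem a b _ v ha hv), hg b v hv, map_smul, smul_smul, sgn_add]
        · rw [linPart_of_mem_Edeg hi0 hi]
          simp
      rw [map_sub, map_smul, h2, h1, h1, TensorProduct.map_tmul, TensorProduct.map_tmul,
        TensorProduct.map_tmul, h3, eps_parAut, LinearMap.id_apply, TensorProduct.tmul_smul,
        sub_self]
    · intro s
      have e1 := ih (-1 + i) d (by omega) (vpar s + a) _ (hL.sbr_der_mem s hx ha)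
        (sbr_mem_Epar (der_mem_Epar s) ha) (sbr_mem_Edeg _ _ (der_mem_Edeg s) hi) f hf v
      have e2 := ih i (d - 1) (by omega) a x hx ha hi _ (der_mem_Odeg s hf) v
      have e3 : ∀ w, TensorProduct.map (der s) LinearMap.id (mixedLin (extAct ρ) x w) =
          sgn F (vpar s * a) • mixedLin (extAct ρ) x (TensorProduct.map (der s) LinearMap.id w) +
          mixedLin (extAct ρ) (sbr F (vpar s) a (der s) x) w := by
        intro w
        rw [map_der_mul_mixedLin hm (extAct ρ) s ha hx1]
        simp [sbr]
      have e4 : ∀ w : O F p m l ⊗[F] V, TensorProduct.map (der s) LinearMap.id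
          (TensorProduct.map parAut g w) = sgn F (vpar s) •
            TensorProduct.map parAut g (TensorProduct.map (der s) LinearMap.id w) := by
        refine LinearMap.congr_fun (f := TensorProduct.map (der s) LinearMap.id ∘ₗ
          TensorProduct.map parAut g) (g := sgn F (vpar s) • TensorProduct.map parAut g ∘ₗ
            TensorProduct.map (der s) LinearMap.id) (TensorProduct.ext' fun f v => ?_)
        have : parAut (der s f) = sgn F (vpar s) • der s (parAut f) :=
          LinearMap.congr_fun (parAut_mul_der s) f
        simp only [LinearMap.comp_apply, LinearMap.smul_apply, TensorProduct.map_tmul, this,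
          LinearMap.id_apply, ← TensorProduct.smul_tmul', smul_smul, sgn_mul_self, one_smul]
      have e5 : der s (parAut f) = sgn F (vpar s) • parAut (der s f) := by
        have : parAut (der s f) = sgn F (vpar s) • der s (parAut f) :=
          LinearMap.congr_fun (parAut_mul_der s) f
        rw [this, smul_smul, sgn_mul_self, one_smul]
      rw [map_sub, map_smul, e4, e3, e3, map_add, map_smul, TensorProduct.map_tmul,
        TensorProduct.map_tmul, LinearMap.id_apply, LinearMap.id_apply, e1, e2, e5,
        ← TensorProduct.smul_tmul', map_smul]
      simp only [smul_add, smul_smul, sgn_add]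
      rw [add_sub_add_comm, ← sub_smul, ← sub_smul]
      rcases sgn_eq_one_or (F := F) (vpar s) with h1 | h1 <;> simp [h1, mul_comm]

theorem IsGood.mixedLin_mem_mixedPar (hL : IsGood L) (hm : ∀ i, 1 ≤ m i)
    (ρ : SuperRep (Lz L 0) V) {a b : ZMod 2} {x : Module.End F (O F p m l)}
    (hx : x ∈ L) (ha : x ∈ Epar F p m l a) {w : O F p m l ⊗[F] V} (hw : w ∈ mixedPar ρ b) :
    mixedLin (extAct ρ) x w ∈ mixedPar ρ (b + a) := by
  obtain ⟨g, hg⟩ := ρ.exists_gradeInv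
  have hx' := IsGood.mem_span hL.le_span hx ha
  clear hx ha
  induction hx' using Submodule.span_induction with
  | mem x hx =>
    obtain ⟨hx, ha, i, hi⟩ := hx
    rw [mem_mixedPar_iff ρ hg] at hw ⊢
    have : TensorProduct.map parAut g ∘ₗ mixedLin (extAct ρ) x =
        sgn F a • mixedLin (extAct ρ) x ∘ₗ TensorProduct.map parAut g :=
      tensor_op_ext fun c v => hL.parAut_mixedLin_apply hm ρ hg (i + zdeg c + 2).toNat
        i (zdeg c) (by omega) a x hx ha hi _ (bas_mem_Odeg c) v
    have h := LinearMap.congr_fun this w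
    simp only [LinearMap.comp_apply, LinearMap.smul_apply] at h
    rw [h, hw, map_smul, smul_smul, add_comm, sgn_add]
  | zero => simp
  | add y z _ _ h1 h2 => rw [map_add, LinearMap.add_apply]; exact add_mem h1 h2
  | smul c y _ h => rw [map_smul, LinearMap.smul_apply]; exact Submodule.smul_mem _ _ h

end Algebra

section Algebra

variable {F : Type*} [Field F] {p : ℕ} {k : ℕ} {m : Fin k → ℕ} {l : ℕ}
variable {V : Type*} [AddCommGroup V] [Module F V]
variable {L : Submodule F (Module.End F (O F p m l))}
/-! ## The induced module -/

theorem Ind.act_tmul (A : theta L →ₐ[F] Module.End F V) (y y' : U L) (v : V) :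
    Ind.act A y (Ind.tmul A y' v) = Ind.tmul A (y * y') v := rfl

theorem Ind.induction {A : theta L →ₐ[F] Module.End F V} {P : Ind A → Prop}
    (tmul : ∀ y v, P (Ind.tmul A y v)) (add : ∀ v w, P v → P w → P (v + w)) (w : Ind A) : P w := by
  obtain ⟨w, rfl⟩ := Submodule.Quotient.mk_surjective _ w
  induction w using TensorProduct.induction_on with
  | zero => simpa [Ind.tmul] using tmul 0 0
  | tmul y v => exact tmul y v
  | add x y hx hy => exact add _ _ hx hy

variable [Fact p.Prime]

/-! ## The basis element of top degree -/

variable (p m l) in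
/-- The index of the basis element of top degree. -/
def topIdx : Idx p m l :=
  (fun i => ⟨p ^ m i - 1, Nat.sub_lt (pow_pos_prime i) one_pos⟩, Finset.univ)

variable (F p m l) in
/-- The basis element of top degree. -/
def top : O F p m l := bas F p m l (topIdx p m l)

theorem zdeg_le_topDeg (a : Idx p m l) : zdeg a ≤ topDeg p m l := by
  by_cases ha : (∀ i, (a.1 i : ℕ) = p ^ m i - 1) ∧ a.2 = Finset.univ
  · simp [zdeg, topDeg, ha.1, ha.2]
  · exact (zdeg_lt_topDeg ha).le

theorem top_mem_Odeg : top F p m l ∈ Odeg F p m l (topDeg p m l) := by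
  have := bas_mem_Odeg (F := F) (topIdx p m l)
  simpa [zdeg, topDeg, topIdx, top] using this

theorem top_mem_Opar : top F p m l ∈ Opar F p m l (l : ZMod 2) := by
  have := bas_mem_Opar (F := F) (topIdx p m l)
  simpa [topIdx, top] using this

theorem eq_zero_of_mem_Odeg_gt {n : ℤ} (hn : topDeg p m l < n) {f : O F p m l}
    (hf : f ∈ Odeg F p m l n) : f = 0 := by
  refine (bas F p m l).ext_elem fun a => ?_
  rw [coord_of_mem_Odeg hf a (by have := zdeg_le_topDeg a; omega)]
  simp

/-- Every nonconstant monomial pushes the exponents of top out of range or repeats an odd variable.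
-/
theorem mulO_top (f : O F p m l) : mulO f (top F p m l) = eps f • top F p m l := by
  suffices h : mulO.flip (top F p m l) = (eps : O F p m l →ₗ[F] F).smulRight (top F p m l) from
    LinearMap.congr_fun h f
  refine hom_ext fun α u hα => ?_
  rw [LinearMap.flip_apply, LinearMap.smulRight_apply, eps_mono hα]
  by_cases h : (∀ i, α i = 0) ∧ u = ∅
  · rw [if_pos h, one_smul, show mono F p m α u = one F p m l by
      rw [one, h.2]; congr 1; exact funext h.1, mulO_one_left]
  · rw [if_neg h, zero_smul, top, bas_eq_mono, mulO_mono]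
    rw [not_and_or] at h
    rcases h with h | h
    · push Not at h
      obtain ⟨i, hi⟩ := h
      rw [mono_of_le (i := i), smul_zero]
      have := pow_pos_prime (p := p) (m := m) i
      simp only [topIdx]
      omega
    · rw [monoCoeff, if_neg, zero_smul]
      exact fun hd => h ((Finset.disjoint_self_iff_empty u).1
        (hd.mono_right (Finset.subset_univ u)))

variable [CharP F p] [NeZero (2 : F)]

/-- Apply `∂_q` to `x_r · top = 0`: the Leibniz rule expresses `x_r ∂_q(top)` through `∂_q(x_r) ·
top`. -/
theorem fder_gen_top (hm : ∀ i, 1 ≤ m i) (r q : Var k l) :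
    fder (gen F p m r) q (top F p m l) =
      if q = r then -(sgn F (vpar q) • top F p m l) else 0 := by
  have h := der_mulO_apply q (gen F p m r) (top F p m l)
  rw [mulO_top, eps_of_mem_Odeg one_ne_zero (gen_mem_Odeg r), zero_smul, map_zero, der_gen hm,
    parTwist_of_mem_Opar _ (gen_mem_Opar r)] at h
  rw [fder, Module.End.mul_apply]
  split_ifs at h ⊢ with hqr
  · subst hqr
    rw [mulO_one_left, map_smul, LinearMap.smul_apply] at h
    have h2 : top F p m l = -(sgn F (vpar q * vpar q) •
        mulO (gen F p m q) (der q (top F p m l))) := eq_neg_of_add_eq_zero_left h.symm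
    have h3 : (vpar q * vpar q : ZMod 2) = vpar q := by
      generalize (vpar q : ZMod 2) = a
      revert a
      decide
    rw [h3] at h2
    conv_rhs => rw [h2]
    rw [smul_neg, neg_neg, smul_smul, sgn_mul_self, one_smul]
  · rw [map_zero, LinearMap.zero_apply, zero_add, map_smul, LinearMap.smul_apply] at h
    exact (smul_eq_zero.1 h.symm).resolve_left (sgn_ne_zero _)

variable (F p m l) in
/-- The supertrace of the action on `L / K`, as a linear form on all endomorphisms. -/
def sig : Module.End F (O F p m l) →ₗ[F] F := -∑ q : Var k l, sgn F (vpar q) • kap q q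

theorem sig_apply (x : Module.End F (O F p m l)) :
    sig F p m l x = -∑ q : Var k l, sgn F (vpar q) * kap q q x := by
  simp only [sig, LinearMap.neg_apply, LinearMap.sum_apply, LinearMap.smul_apply, smul_eq_mul]

/-- The origin of the twist by σ: top spans a line on which the degree zero part acts by the
supertrace character. -/
theorem apply_top (hm : ∀ i, 1 ≤ m i) {x : Module.End F (O F p m l)} (hx : x ∈ W F p m l)
    (hd : x ∈ Edeg F p m l 0) : x (top F p m l) = sig F p m l x • top F p m l := by
  conv_lhs => rw [← linPart_of_mem_W hm hx hd, linPart_apply]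
  simp only [LinearMap.sum_apply, LinearMap.smul_apply, fder_gen_top hm, smul_ite, smul_zero,
    Finset.sum_ite_eq, Finset.mem_univ, if_true]
  rw [sig_apply, neg_smul, Finset.sum_smul, ← Finset.sum_neg_distrib]
  refine Finset.sum_congr rfl fun q _ => ?_
  rw [smul_neg, smul_smul, mul_comm]

theorem sig_of_pos {x : Module.End F (O F p m l)} {n : ℤ} (hn : 0 < n)
    (hd : x ∈ Edeg F p m l n) : sig F p m l x = 0 := by
  rw [sig_apply, neg_eq_zero]
  exact Finset.sum_eq_zero fun q _ => by rw [kap_eq_zero_of_Edeg hd hn.ne', mul_zero]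

theorem kap_tw (q s : Var k l) (c : ZMod 2) (x : Module.End F (O F p m l)) :
    kap q s (tw F p m l c x) = sgn F (c * (vpar q + vpar s)) * kap q s x := by
  have h : ∀ f : O F p m l, der s (parTwist c f) = sgn F (c * vpar s) • parTwist c (der s f) := by
    intro f
    rw [parTwist_der, smul_smul, sgn_mul_self, one_smul]
  rw [kap_apply, kap_apply, tw_apply, Module.End.mul_apply, Module.End.mul_apply,
    parTwist_of_mem_Opar c (gen_mem_Opar q), h, map_smul, eps_parTwist, map_smul, map_smul,
    map_smul, smul_smul, smul_eq_mul, mul_add, sgn_add, mul_comm (sgn F (c * vpar q))]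

/-- Only constant terms of the coefficients survive multiplication with top. The sign from moving
`x_r ∂_q` past top, which has parity `l`, is undone by the twist `tw`, leaving the untwisted linear
part on V. -/
theorem mixedLin_tmul_top (η : Module.End F (O F p m l) →ₗ[F] Module.End F V)
    (x : Module.End F (O F p m l)) (v : V) :
    mixedLin η (tw F p m l l x) (top F p m l ⊗ₜ v) =
      tw F p m l l x (top F p m l) ⊗ₜ v + top F p m l ⊗ₜ η (linPart x) v := by
  rw [mixedLin_apply, linPart_apply]
  simp only [LinearMap.add_apply, LinearMap.sum_apply, TensorProduct.map_tmul,
    LinearMap.id_apply, map_sum, map_smul, LinearMap.smul_apply, TensorProduct.tmul_sum,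
    TensorProduct.tmul_smul]
  congr 1
  refine Finset.sum_congr rfl fun q _ => Finset.sum_congr rfl fun r _ => ?_
  rw [Module.End.mul_apply, parTwist_of_mem_Opar _ top_mem_Opar, map_smul, mulO_top,
    eps_parTwist, ← kap_apply, kap_tw, smul_smul, ← TensorProduct.smul_tmul', ← mul_assoc,
    mul_comm (l : ZMod 2), add_comm (vpar q), sgn_mul_self, one_mul]

theorem tw_apply_top {x : Module.End F (O F p m l)} {a : F}
    (h : x (top F p m l) = a • top F p m l) :
    tw F p m l l x (top F p m l) = a • top F p m l := by
  rw [tw_apply, Module.End.mul_apply, Module.End.mul_apply,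
    parTwist_of_mem_Opar _ top_mem_Opar, map_smul, h, map_smul, map_smul,
    parTwist_of_mem_Opar _ top_mem_Opar, smul_comm a, smul_smul, sgn_mul_self, one_smul]

/-! ## The action of the enveloping algebra -/

/-- The mixed product, with the signs of a module shifted by the parity of the top element. -/
def shiftedAct (ρ : SuperRep (Lz L 0) V) : L →ₗ[F] Module.End F (O F p m l ⊗[F] V) :=
  mixedLin (extAct ρ) ∘ₗ tw F p m l l ∘ₗ L.subtype

theorem shiftedAct_apply (ρ : SuperRep (Lz L 0) V) (x : L) :
    shiftedAct ρ x = mixedLin (extAct ρ) (tw F p m l l x) := rfl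

theorem shiftedAct_of_mem_Epar (ρ : SuperRep (Lz L 0) V) {a : ZMod 2} {x : L}
    (ha : (x : Module.End F (O F p m l)) ∈ Epar F p m l a) :
    shiftedAct ρ x = sgn F (l * a) • mixedLin (extAct ρ) x := by
  rw [shiftedAct_apply, tw_of_mem_Epar _ ha, map_smul]

theorem IsGood.URel_shiftedAct (hL : IsGood L) (hm : ∀ i, 1 ≤ m i) (ρ : SuperRep (Lz L 0) V)
    ⦃s t : TensorAlgebra F L⦄ (h : URel L s t) :
    TensorAlgebra.lift F (shiftedAct ρ) s = TensorAlgebra.lift F (shiftedAct ρ) t := by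
  obtain ⟨a, b, x, y, z, hx, hy, hz⟩ := h
  have hz' : (z : Module.End F (O F p m l)) ∈ Epar F p m l (a + b) := hz ▸ sbr_mem_Epar hx hy
  rw [sbr, map_sub, map_smul, map_mul, map_mul, TensorAlgebra.lift_ι_apply,
    TensorAlgebra.lift_ι_apply, TensorAlgebra.lift_ι_apply, ← sbr,
    shiftedAct_of_mem_Epar ρ hx, shiftedAct_of_mem_Epar ρ hy, shiftedAct_of_mem_Epar ρ hz',
    sbr_smul_left, sbr_smul_right, smul_smul, hz, hL.mixedLin_sbr hm ρ x.2 y.2 hx hy, mul_add,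
    sgn_add]

/-- The action of `U(L)` on the shifted mixed product. -/
def IsGood.UAct (hL : IsGood L) (hm : ∀ i, 1 ≤ m i) (ρ : SuperRep (Lz L 0) V) :
    U L →ₐ[F] Module.End F (O F p m l ⊗[F] V) :=
  (RingQuot.liftAlgHom F ⟨TensorAlgebra.lift F (shiftedAct ρ), hL.URel_shiftedAct hm ρ⟩ :
    RingQuot (URel L) →ₐ[F] Module.End F (O F p m l ⊗[F] V))

theorem IsGood.UAct_ι (hL : IsGood L) (hm : ∀ i, 1 ≤ m i) (ρ : SuperRep (Lz L 0) V) (x : L) :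
    hL.UAct hm ρ (ι L x) = shiftedAct ρ x := by
  have h := RingQuot.liftAlgHom_mkAlgHom_apply (S := F) (TensorAlgebra.lift F (shiftedAct ρ))
    (hL.URel_shiftedAct hm ρ) (TensorAlgebra.ι F x)
  rw [TensorAlgebra.lift_ι_apply] at h
  exact h

variable (F p m l V) in
/-- The embedding `v ↦ top ⊗ v`. -/
def topTmul : V →ₗ[F] O F p m l ⊗[F] V := TensorProduct.mk F _ V (top F p m l)

theorem topTmul_apply (v : V) : topTmul F p m l V v = top F p m l ⊗ₜ v := rfl

variable (F p m l V) in
/-- The coefficient of the top element. -/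
def topCoord : O F p m l ⊗[F] V →ₗ[F] V :=
  TensorProduct.lid F V ∘ₗ ((bas F p m l).coord (topIdx p m l)).rTensor V

theorem topCoord_topTmul (v : V) : topCoord F p m l V (topTmul F p m l V v) = v := by
  simp [topCoord, topTmul_apply, top]

theorem shiftedAct_topTmul_zero (hL : IsGood L) (hm : ∀ i, 1 ≤ m i) (ρ : SuperRep (Lz L 0) V)
    {x : L} (h0 : (x : Module.End F (O F p m l)) ∈ Lz L 0) (v : V) :
    shiftedAct ρ x (topTmul F p m l V v) =
      topTmul F p m l V (ρ.act ⟨x, h0⟩ v + sig F p m l x • v) := by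
  have hW := hL.le_W x.2
  rw [shiftedAct_apply, topTmul_apply, mixedLin_tmul_top, tw_apply_top (apply_top hm hW h0.2),
    linPart_of_mem_W hm hW h0.2,
    show extAct ρ (x : Module.End F (O F p m l)) = _ from extAct_eq ρ ⟨x, h0⟩, topTmul_apply,
    TensorProduct.tmul_add, TensorProduct.smul_tmul, add_comm]

theorem shiftedAct_topTmul_pos (ρ : SuperRep (Lz L 0) V)
    {x : L} {n : ℤ} (hn : 0 < n) (h0 : (x : Module.End F (O F p m l)) ∈ Lz L n) (v : V) :
    shiftedAct ρ x (topTmul F p m l V v) = 0 := by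
  rw [shiftedAct_apply, topTmul_apply, mixedLin_tmul_top, tw_apply_top (a := 0),
    linPart_of_mem_Edeg hn.ne' h0.2]
  · simp
  · rw [zero_smul]
    exact eq_zero_of_mem_Odeg_gt (by omega) (apply_mem_Odeg h0.2 top_mem_Odeg)

/-- Expresses that top ⊗ V is stable under K, with `topCoord` naming the resulting vector of V. -/
theorem shiftedAct_topTmul_K (hL : IsGood L) (hm : ∀ i, 1 ≤ m i) (ρ : SuperRep (Lz L 0) V)
    {x : L} (hK : (x : Module.End F (O F p m l)) ∈ K L) (v : V) :
    shiftedAct ρ x (topTmul F p m l V v) =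
      topTmul F p m l V (topCoord F p m l V (shiftedAct ρ x (topTmul F p m l V v))) := by
  have key : ∀ y ∈ K L, ∀ hy : y ∈ L, shiftedAct ρ ⟨y, hy⟩ (topTmul F p m l V v) =
      topTmul F p m l V (topCoord F p m l V (shiftedAct ρ ⟨y, hy⟩ (topTmul F p m l V v))) := by
    intro y hy
    refine Submodule.iSup_induction' (fun n : ℕ => Lz L (n : ℤ))
      (motive := fun y _ => ∀ hy : y ∈ L, shiftedAct ρ ⟨y, hy⟩ (topTmul F p m l V v) =
      topTmul F p m l V (topCoord F p m l V (shiftedAct ρ ⟨y, hy⟩ (topTmul F p m l V v))))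
      ?_ ?_ ?_ hy
    · intro n y hn hy
      rcases Nat.eq_zero_or_pos n with rfl | h
      · rw [shiftedAct_topTmul_zero hL hm ρ (x := ⟨y, hy⟩) hn, topCoord_topTmul]
      · rw [shiftedAct_topTmul_pos ρ (x := ⟨y, hy⟩) (by omega) hn, map_zero, map_zero]
    · intro hy
      rw [show (⟨0, hy⟩ : L) = 0 from rfl]
      simp
    · intro y z hy hz h1 h2 hyz
      have hle : K L ≤ L := iSup_le fun n => inf_le_left
      rw [show (⟨y + z, hyz⟩ : L) = ⟨y, hle hy⟩ + ⟨z, hle hz⟩ from rfl, map_add,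
        LinearMap.add_apply, map_add, map_add, ← h1, ← h2]
  exact key x hK x.2

theorem Deven_pow_mono (i : Fin k) (n : ℕ) {α : Fin k → ℕ} (hα : ∀ i, α i < p ^ m i)
    (hn : α i < n) (u : Finset (Fin l)) : (Deven i ^ n) (mono F p m α u) = 0 := by
  induction n generalizing α with
  | zero => omega
  | succ n ih =>
    rw [pow_succ, Module.End.mul_apply, Deven_mono i hα]
    split_ifs with h
    · exact ih (fun r => lt_of_le_of_lt (Nat.sub_le _ _) (hα r))
        (by simp only [if_true]; omega)
    · simp

theorem Deven_pow (i : Fin k) : (Deven i ^ p ^ m i : Module.End F (O F p m l)) = 0 :=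
  hom_ext fun α u hα => by
    rw [Deven_pow_mono i _ hα (hα i), LinearMap.zero_apply]

theorem shiftedAct_der (hm : ∀ i, 1 ≤ m i) (ρ : SuperRep (Lz L 0) V) {e : L} {s : Var k l}
    (he : (e : Module.End F (O F p m l)) = der s) :
    shiftedAct ρ e = sgn F (l * vpar s) • TensorProduct.map (der s) LinearMap.id := by
  rw [shiftedAct_of_mem_Epar ρ (he ▸ der_mem_Epar s), he, mixedLin_der hm]

/-- `D_i` is even and acts on the first factor only, where its power of exponent `p^(m_i)` is zero.
-/
theorem IsGood.UAct_zset (hL : IsGood L) (hm : ∀ i, 1 ≤ m i) (ρ : SuperRep (Lz L 0) V)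
    {z : U L} (hz : z ∈ zset L) : hL.UAct hm ρ z = 0 := by
  obtain ⟨i, e, he, rfl⟩ := hz
  rw [map_pow, hL.UAct_ι, shiftedAct_der hm ρ (s := Sum.inl i) he]
  simp only [vpar, Sum.elim_inl, mul_zero, sgn_zero, one_smul]
  rw [TensorProduct.map_pow]
  simp [der, Deven_pow]

/-- Stability of top ⊗ V under θ(L,K) needs to be checked on generators only. It makes V a
θ(L,K)-module by restriction, so no relations of θ(L,K) have to be known. -/
theorem IsGood.UAct_theta (hL : IsGood L) (hm : ∀ i, 1 ≤ m i) (ρ : SuperRep (Lz L 0) V)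
    {t : U L} (ht : t ∈ theta L) (v : V) :
    hL.UAct hm ρ t (topTmul F p m l V v) = topTmul F p m l V
      (topCoord F p m l V (hL.UAct hm ρ t (topTmul F p m l V v))) := by
  induction ht using Algebra.adjoin_induction generalizing v with
  | mem t ht =>
    rcases ht with ⟨x, hx, rfl⟩ | hz
    · rw [hL.UAct_ι]
      exact shiftedAct_topTmul_K hL hm ρ hx v
    · simp [hL.UAct_zset hm ρ hz]
  | algebraMap r =>
    rw [AlgHom.commutes, Module.algebraMap_end_apply, ← map_smul, topCoord_topTmul]
  | add x y _ _ hx hy =>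
    rw [map_add, LinearMap.add_apply, map_add, map_add, ← hx, ← hy]
  | mul x y _ _ hx hy =>
    rw [map_mul, Module.End.mul_apply, hy, ← hx]

/-- The action of `θ(L, K)` on `V_σ`. -/
def IsGood.thetaAct (hL : IsGood L) (hm : ∀ i, 1 ≤ m i) (ρ : SuperRep (Lz L 0) V) :
    theta L →ₐ[F] Module.End F V :=
  AlgHom.ofLinearMap
    { toFun := fun t => topCoord F p m l V ∘ₗ hL.UAct hm ρ t ∘ₗ topTmul F p m l V
      map_add' := fun s t => by
        ext1 v
        simp
      map_smul' := fun c t => by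
        ext1 v
        simp }
    (by ext1 v; simp [topCoord_topTmul])
    (fun s t => by
      ext1 v
      simp only [LinearMap.coe_mk, AddHom.coe_mk, LinearMap.comp_apply, Module.End.mul_apply,
        MulMemClass.coe_mul, map_mul]
      rw [← hL.UAct_theta hm ρ t.2])

theorem IsGood.topTmul_thetaAct (hL : IsGood L) (hm : ∀ i, 1 ≤ m i) (ρ : SuperRep (Lz L 0) V)
    (t : theta L) (v : V) : topTmul F p m l V (hL.thetaAct hm ρ t v) =
      hL.UAct hm ρ t (topTmul F p m l V v) := (hL.UAct_theta hm ρ t.2 v).symm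

theorem IsGood.thetaAct_eq (hL : IsGood L) (hm : ∀ i, 1 ≤ m i) (ρ : SuperRep (Lz L 0) V)
    (t : theta L) {v w : V} (h : hL.UAct hm ρ t (topTmul F p m l V v) = topTmul F p m l V w) :
    hL.thetaAct hm ρ t v = w := by
  rw [← topCoord_topTmul (F := F) (p := p) (m := m) (l := l) (hL.thetaAct hm ρ t v),
    hL.topTmul_thetaAct, h, topCoord_topTmul]

theorem IsGood.isTwistedAction (hL : IsGood L) (hm : ∀ i, 1 ≤ m i) (ρ : SuperRep (Lz L 0) V) :
    IsTwistedAction ρ (sig F p m l ∘ₗ (K L).subtype) (hL.thetaAct hm ρ) where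
  zero t x h0 hK ht := by
    ext1 v
    refine hL.thetaAct_eq hm ρ t ?_
    rw [ht, hL.UAct_ι, shiftedAct_topTmul_zero hL hm ρ h0]
    rfl
  pos t n hn x hx hK ht := by
    ext1 v
    refine hL.thetaAct_eq hm ρ t ?_
    rw [ht, hL.UAct_ι, shiftedAct_topTmul_pos ρ hn hx]
    simp [sig_of_pos hn hx.2]
  central t ht := by
    ext1 v
    refine hL.thetaAct_eq hm ρ t ?_
    rw [hL.UAct_zset hm ρ ht]
    simp

/-! ## The homomorphism from the induced module to the mixed product -/

/-- The homomorphism `y ⊗ v ↦ y · (top ⊗ v)`. -/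
def IsGood.indMap (hL : IsGood L) (hm : ∀ i, 1 ≤ m i) (ρ : SuperRep (Lz L 0) V) :
    Ind (hL.thetaAct hm ρ) →ₗ[F] O F p m l ⊗[F] V :=
  Submodule.liftQ (balanced (hL.thetaAct hm ρ))
    (TensorProduct.lift (LinearMap.lcomp F _ (topTmul F p m l V) ∘ₗ
      (hL.UAct hm ρ).toLinearMap)) (by
    refine Submodule.span_le.2 ?_
    rintro _ ⟨y, t, v, rfl⟩
    rw [SetLike.mem_coe, LinearMap.mem_ker, map_sub, TensorProduct.lift.tmul,
      TensorProduct.lift.tmul, sub_eq_zero]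
    simp only [LinearMap.comp_apply, LinearMap.lcomp_apply, AlgHom.toLinearMap_apply, map_mul,
      Module.End.mul_apply]
    rw [hL.topTmul_thetaAct])

theorem IsGood.indMap_tmul (hL : IsGood L) (hm : ∀ i, 1 ≤ m i) (ρ : SuperRep (Lz L 0) V)
    (y : U L) (v : V) : hL.indMap hm ρ (Ind.tmul _ y v) =
      hL.UAct hm ρ y (topTmul F p m l V v) := rfl

theorem IsGood.indMap_act (hL : IsGood L) (hm : ∀ i, 1 ≤ m i) (ρ : SuperRep (Lz L 0) V)
    (y : U L) (w : Ind (hL.thetaAct hm ρ)) :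
    hL.indMap hm ρ (Ind.act _ y w) = hL.UAct hm ρ y (hL.indMap hm ρ w) := by
  induction w using Ind.induction with
  | tmul y' v =>
    rw [Ind.act_tmul, hL.indMap_tmul, hL.indMap_tmul, map_mul, Module.End.mul_apply]
  | add v w hv hw => rw [map_add, map_add, map_add, map_add, hv, hw]

theorem IsGood.UAct_mem_mixedPar (hL : IsGood L) (hm : ∀ i, 1 ≤ m i) (ρ : SuperRep (Lz L 0) V)
    {a b : ZMod 2} {y : U L} (hy : y ∈ Upar L a) {w : O F p m l ⊗[F] V}
    (hw : w ∈ mixedPar ρ b) : hL.UAct hm ρ y w ∈ mixedPar ρ (a + b) := by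
  induction hy using Submodule.span_induction with
  | mem y hy =>
    induction hy with
    | one => simpa using hw
    | mul a c x y hx hy ih =>
      rw [map_mul, Module.End.mul_apply, hL.UAct_ι, shiftedAct_of_mem_Epar ρ hx, add_assoc,
        add_comm a]
      exact Submodule.smul_mem _ _ (hL.mixedLin_mem_mixedPar hm ρ x.2 hx ih)
  | zero => simp
  | add x y _ _ hx hy => rw [map_add, LinearMap.add_apply]; exact add_mem hx hy
  | smul r x _ hx => rw [map_smul, LinearMap.smul_apply]; exact Submodule.smul_mem _ _ hx

/-- The degree is `l`, the parity of top; the sign built into `shiftedAct` is exactly the one an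
intertwiner of that degree requires. -/
theorem IsGood.isModuleIso (hL : IsGood L) (hm : ∀ i, 1 ≤ m i) (ρ : SuperRep (Lz L 0) V)
    (h : Function.Bijective (hL.indMap hm ρ)) :
    IsModuleIso ρ (hL.thetaAct hm ρ) (l : ZMod 2) (LinearEquiv.ofBijective _ h) where
  homogeneous b w hw := by
    rw [LinearEquiv.ofBijective_apply]
    induction hw using Submodule.span_induction with
    | mem w hw =>
      obtain ⟨a, b, y, v, hy, hv, rfl, rfl⟩ := hw
      rw [hL.indMap_tmul, add_assoc, add_comm b]
      exact hL.UAct_mem_mixedPar hm ρ hy (tmul_mem_mixedPar ρ top_mem_Opar hv)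
    | zero => simp
    | add x y _ _ hx hy => rw [map_add]; exact add_mem hx hy
    | smul r x _ hx => rw [map_smul]; exact Submodule.smul_mem _ _ hx
  intertwines a x hx w := by
    rw [LinearEquiv.ofBijective_apply, LinearEquiv.ofBijective_apply, hL.indMap_act, hL.UAct_ι,
      shiftedAct_of_mem_Epar ρ hx, LinearMap.smul_apply, smul_smul, mul_comm a, sgn_mul_self,
      one_smul]
    rfl

end Algebra

/-! ## Ordered monomials in supercommuting elements -/

section Monomials

variable {F B ι : Type*} [Field F] [Ring B] [Algebra F B]

theorem exists_mul_pow {x y : B} (h : ∃ c : F, x * y = c • (y * x)) (n : ℕ) :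
    ∃ c : F, x * y ^ n = c • (y ^ n * x) := by
  obtain ⟨c, hc⟩ := h
  refine ⟨c ^ n, ?_⟩
  induction n with
  | zero => simp
  | succ n ih =>
    rw [pow_succ, ← mul_assoc, ih, smul_mul_assoc, mul_assoc, hc, mul_smul_comm, smul_smul,
      pow_succ, mul_assoc]

theorem exists_pow_mul {x y : B} (h : ∃ c : F, x * y = c • (y * x)) (n : ℕ) :
    ∃ c : F, x ^ n * y = c • (y * x ^ n) := by
  obtain ⟨c, hc⟩ := h
  refine ⟨c ^ n, ?_⟩
  induction n with
  | zero => simp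
  | succ n ih =>
    rw [pow_succ, mul_assoc, hc, mul_smul_comm, ← mul_assoc, ih, smul_mul_assoc, smul_smul,
      pow_succ, mul_assoc, mul_comm (c ^ n)]

/-- The monomial with exponents `e`, in the order given by a list. -/
def orderedMonomial (X : ι → B) (s : List ι) (e : ι → ℕ) : B := (s.map fun i => X i ^ e i).prod

/-- The factor `X i` is moved to its place through elements with which it commutes up to scalars.
The scalar stays unspecified, as only spans matter. -/
theorem exists_mul_orderedMonomial [DecidableEq ι] {X : ι → B}
    (hX : ∀ i j, ∃ c : F, X i * X j = c • (X j * X i)) {s : List ι} (hs : s.Nodup)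
    {i : ι} (hi : i ∈ s) (e : ι → ℕ) :
    ∃ c : F, X i * orderedMonomial X s e =
      c • orderedMonomial X s (Function.update e i (e i + 1)) := by
  induction s with
  | nil => simp at hi
  | cons j s ih =>
    rw [List.nodup_cons] at hs
    simp only [orderedMonomial, List.map_cons, List.prod_cons] at ih ⊢
    by_cases hij : i = j
    · subst hij
      refine ⟨1, ?_⟩
      rw [one_smul, ← mul_assoc, ← pow_succ', Function.update_self]
      congr 2
      refine List.map_congr_left fun j hj => ?_
      rw [Function.update_of_ne]
      rintro rfl
      exact hs.1 hj
    · obtain ⟨c, hc⟩ := ih hs.2 (by simpa [hij] using hi)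
      obtain ⟨d, hd⟩ := exists_mul_pow (hX i j) (e j)
      refine ⟨d * c, ?_⟩
      rw [← mul_assoc, hd, smul_mul_assoc, mul_assoc, hc, mul_smul_comm, smul_smul,
        Function.update_of_ne (Ne.symm hij)]

theorem orderedMonomial_eq_zero {X : ι → B} {s : List ι} {i : ι} (hi : i ∈ s) {N : ℕ}
    (hN : X i ^ N = 0) {e : ι → ℕ} (he : N ≤ e i) : orderedMonomial X s e = 0 :=
  List.prod_eq_zero (List.mem_map.2 ⟨i, hi, pow_eq_zero_of_le he hN⟩)

theorem orderedMonomial_zero (X : ι → B) (s : List ι) :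
    orderedMonomial X s (fun _ => 0) = 1 := by
  simp [orderedMonomial]

end Monomials

section Algebra

variable {F : Type*} [Field F] {p : ℕ} {k : ℕ} {m : Fin k → ℕ} {l : ℕ}
variable {V : Type*} [AddCommGroup V] [Module F V]
variable {L : Submodule F (Module.End F (O F p m l))}

/-! ## The enveloping algebra -/

theorem ι_sbr {a b : ZMod 2} {x y z : L} (hx : (x : Module.End F (O F p m l)) ∈ Epar F p m l a)
    (hy : (y : Module.End F (O F p m l)) ∈ Epar F p m l b)
    (hz : (z : Module.End F (O F p m l)) = sbr F a b (x : Module.End F (O F p m l)) y) :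
    ι L z = sbr F a b (ι L x) (ι L y) := by
  have h := RingQuot.mkAlgHom_rel F (URel.bracket a b x y z hx hy hz)
  rw [sbr, map_sub, map_smul, map_mul, map_mul] at h
  exact h.symm

theorem U_induction (S : Subalgebra F (U L)) (h : ∀ x, ι L x ∈ S) (y : U L) : y ∈ S := by
  obtain ⟨y, rfl⟩ := RingQuot.mkAlgHom_surjective F (URel L) y
  induction y using TensorAlgebra.induction with
  | algebraMap r => rw [AlgHom.commutes]; exact S.algebraMap_mem r
  | ι x => exact h x
  | mul x y hx hy => rw [map_mul]; exact S.mul_mem hx hy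
  | add x y hx hy => rw [map_add]; exact S.add_mem hx hy

theorem Ind.act_mul (A : theta L →ₐ[F] Module.End F V) (y z : U L) :
    Ind.act A (y * z) = Ind.act A y * Ind.act A z := by
  refine LinearMap.ext fun w => ?_
  induction w using Ind.induction with
  | tmul y' v => rw [Module.End.mul_apply, act_tmul, act_tmul, act_tmul, mul_assoc]
  | add v w hv hw => rw [map_add, map_add, hv, hw]

theorem Ind.tmul_add_left (A : theta L →ₐ[F] Module.End F V) (y z : U L) (v : V) :
    Ind.tmul A (y + z) v = Ind.tmul A y v + Ind.tmul A z v := by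
  rw [Ind.tmul, TensorProduct.add_tmul]; rfl

theorem Ind.tmul_smul_left (A : theta L →ₐ[F] Module.End F V) (c : F) (y : U L) (v : V) :
    Ind.tmul A (c • y) v = c • Ind.tmul A y v := by
  rw [Ind.tmul, ← TensorProduct.smul_tmul']; rfl

theorem Ind.tmul_theta (A : theta L →ₐ[F] Module.End F V) (t : theta L) (v : V) :
    Ind.tmul A (t : U L) v = Ind.tmul A 1 (A t v) := by
  rw [Ind.tmul, Ind.tmul, Submodule.Quotient.eq]
  exact Submodule.subset_span ⟨1, t, v, by rw [one_mul]⟩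

/-- The action of `U(L)` on the induced module as a homomorphism. -/
def Ind.actHom (A : theta L →ₐ[F] Module.End F V) : U L →ₐ[F] Module.End F (Ind A) :=
  AlgHom.ofLinearMap
    { toFun := Ind.act A
      map_add' := fun y z => by
        refine LinearMap.ext fun w => ?_
        induction w using Ind.induction with
        | tmul y' v =>
          rw [LinearMap.add_apply, act_tmul, act_tmul, act_tmul, add_mul, tmul_add_left]
        | add v w hv hw => rw [map_add, map_add, hv, hw]
      map_smul' := fun c y => by
        refine LinearMap.ext fun w => ?_
        induction w using Ind.induction with
        | tmul y' v =>
          rw [RingHom.id_apply, LinearMap.smul_apply, act_tmul, act_tmul, smul_mul_assoc,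
            tmul_smul_left]
        | add v w hv hw => rw [map_add, map_add, hv, hw] }
    (by
      refine LinearMap.ext fun w => ?_
      induction w using Ind.induction with
      | tmul y' v => exact (act_tmul A 1 y' v).trans (by rw [one_mul]; rfl)
      | add v w hv hw => rw [map_add, map_add, hv, hw])
    (fun y z => Ind.act_mul A y z)

theorem Ind.actHom_tmul (A : theta L →ₐ[F] Module.End F V) (y y' : U L) (v : V) :
    Ind.actHom A y (Ind.tmul A y' v) = Ind.tmul A (y * y') v := rfl

variable [Fact p.Prime] [CharP F p] [NeZero (2 : F)]

theorem eps_apply_of_mem_K (hL : IsGood L) {x : Module.End F (O F p m l)} (hx : x ∈ K L)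
    (f : O F p m l) : eps (x f) = 0 := by
  refine Submodule.iSup_induction (fun n : ℕ => Lz L (n : ℤ))
    (motive := fun x => eps (x f) = 0) hx (fun n x hx => ?_) (by simp)
    (fun x y hx hy => by simp [hx, hy])
  exact LinearMap.congr_fun (eps_comp_eq_zero (by omega) hx.2 (W_apply_one (hL.le_W hx.1))) f

/-- `L` is the sum of the span of the `∂_s` and of `K`. -/
theorem IsGood.sub_mem_K (hL : IsGood L) (hm : ∀ i, 1 ≤ m i) {x : Module.End F (O F p m l)}
    (hx : x ∈ L) : x - ∑ q, eps (x (gen F p m q)) • der q ∈ K L := by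
  have hx' := hL.le_span hx
  clear hx
  induction hx' using Submodule.span_induction with
  | mem x hx =>
    obtain ⟨hx, -, n, hn⟩ := hx
    rcases lt_trichotomy n (-1) with h | rfl | h
    · simp [eq_zero_of_mem_W hm (hL.le_W hx) h hn]
    · rw [← eq_sum_der_of_mem_W hm (hL.le_W hx) hn, sub_self]
      exact zero_mem _
    · simp only [eps_gen_of_mem_Edeg h.ne' hn, zero_smul, Finset.sum_const_zero, sub_zero]
      refine Submodule.mem_iSup_of_mem n.toNat ?_
      rw [Int.toNat_of_nonneg (by omega)]
      exact ⟨hx, hn⟩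
  | zero => simp
  | add x y _ _ hx hy =>
    convert add_mem hx hy using 1
    simp only [LinearMap.add_apply, map_add, add_smul, Finset.sum_add_distrib]
    abel
  | smul c x _ hx =>
    convert Submodule.smul_mem _ c hx using 1
    simp only [LinearMap.smul_apply, map_smul, smul_assoc, smul_sub, Finset.smul_sum]

/-- `∂_s` as an element of `L`. -/
def IsGood.d (hL : IsGood L) (s : Var k l) : L := ⟨der s, hL.der_mem s⟩

theorem IsGood.mem_theta {x : L} (hx : (x : Module.End F (O F p m l)) ∈ K L) :
    ι L x ∈ theta L := Algebra.subset_adjoin (Or.inl ⟨x, hx, rfl⟩)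

/-- The elements obtained from the `1 ⊗ v` by repeated application of the `∂_s`. -/
inductive IsGood.DerWord (hL : IsGood L) (A : theta L →ₐ[F] Module.End F V) : Ind A → Prop
  | base (v : V) : DerWord hL A (Ind.tmul A 1 v)
  | step (s : Var k l) (w : Ind A) (hw : DerWord hL A w) :
      DerWord hL A (Ind.actHom A (ι L (hL.d s)) w)

/-- Induction on the word: `x` is moved past each `∂_s` at the cost of a bracket, which again lies
in L, until it meets 1 ⊗ v. There its K-part is absorbed into V and the rest is a combination of the
`∂_q`. -/
theorem IsGood.act_derWord (hL : IsGood L) (hm : ∀ i, 1 ≤ m i)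
    (A : theta L →ₐ[F] Module.End F V) {w : Ind A} (hw : hL.DerWord A w) :
    ∀ (a : ZMod 2) (x : L), (x : Module.End F (O F p m l)) ∈ Epar F p m l a →
      Ind.actHom A (ι L x) w ∈ Submodule.span F {w | hL.DerWord A w} := by
  induction hw with
  | base v =>
    intro a x _
    have hK := hL.sub_mem_K hm x.2
    let x' : L := x - ∑ q, eps ((x : Module.End F (O F p m l)) (gen F p m q)) • hL.d q
    have hx' : (x' : Module.End F (O F p m l)) ∈ K L := by
      simpa only [x', Submodule.coe_sub, Submodule.coe_sum, Submodule.coe_smul, IsGood.d] using hK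
    have hx : x = x' + ∑ q, eps ((x : Module.End F (O F p m l)) (gen F p m q)) • hL.d q := by
      simp only [x', sub_add_cancel]
    rw [hx, map_add, map_add, LinearMap.add_apply, map_sum, map_sum, LinearMap.sum_apply]
    refine add_mem ?_ (sum_mem fun q _ => ?_)
    · rw [Ind.actHom_tmul, mul_one,
        show ι L x' = ((⟨ι L x', mem_theta hx'⟩ : theta L) : U L) from rfl, Ind.tmul_theta]
      exact Submodule.subset_span (DerWord.base _)
    · rw [map_smul, map_smul, LinearMap.smul_apply]
      exact Submodule.smul_mem _ _ (Submodule.subset_span (DerWord.step q _ (DerWord.base v)))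
  | step s w hw ih =>
    intro a x hx
    let z : L := ⟨_, hL.sbr_der_mem s x.2 hx⟩
    have hz : ι L z = sbr F (vpar s) a (ι L (hL.d s)) (ι L x) :=
      ι_sbr (der_mem_Epar s) hx rfl
    have h : ι L x * ι L (hL.d s) =
        sgn F (vpar s * a) • (ι L (hL.d s) * ι L x) - sgn F (vpar s * a) • ι L z := by
      rw [hz, sbr, smul_sub, smul_smul, sgn_mul_self, one_smul, sub_sub_cancel]
    have hst : ∀ w ∈ Submodule.span F {w | hL.DerWord A w},
        Ind.actHom A (ι L (hL.d s)) w ∈ Submodule.span F {w | hL.DerWord A w} := by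
      intro w hw
      induction hw using Submodule.span_induction with
      | mem w hw => exact Submodule.subset_span (DerWord.step s w hw)
      | zero => simp
      | add v w _ _ hv hw => rw [map_add]; exact add_mem hv hw
      | smul c w _ hw => rw [map_smul]; exact Submodule.smul_mem _ _ hw
    rw [← Module.End.mul_apply, ← map_mul, h, map_sub, map_smul, map_smul, map_mul,
      LinearMap.sub_apply, LinearMap.smul_apply, LinearMap.smul_apply, Module.End.mul_apply]
    exact sub_mem (Submodule.smul_mem _ _ (hst _ (ih a x hx)))
      (Submodule.smul_mem _ _ (ih _ z (sbr_mem_Epar (der_mem_Epar s) hx)))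

/-- The induced module is generated by the `1 ⊗ v` under the action of the `∂_s`. -/
theorem IsGood.ind_eq_top (hL : IsGood L) (hm : ∀ i, 1 ≤ m i)
    (A : theta L →ₐ[F] Module.End F V) (R : Submodule F (Ind A))
    (h1 : ∀ v, Ind.tmul A 1 v ∈ R)
    (h2 : ∀ s, ∀ w ∈ R, Ind.actHom A (ι L (hL.d s)) w ∈ R) : R = ⊤ := by
  set R0 := Submodule.span F {w | hL.DerWord A w} with hR0
  have hle : R0 ≤ R := by
    refine Submodule.span_le.2 fun w hw => ?_
    induction hw with
    | base v => exact h1 v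
    | step s w _ ih => exact h2 s w ih
  have hL0 : ∀ x : L, ∀ w ∈ R0, Ind.actHom A (ι L x) w ∈ R0 := by
    intro x w hw
    let ψ : L →ₗ[F] Ind A := LinearMap.applyₗ w ∘ₗ (Ind.actHom A).toLinearMap ∘ₗ ι L
    have hψ : ∀ y, ψ y = Ind.actHom A (ι L y) w := fun _ => rfl
    -- `act_derWord` concerns homogeneous elements; as these span L, linearity in `x` covers the
    -- general case.
    have hle : L ≤ (R0.comap ψ).map L.subtype := by
      refine hL.le_span.trans (Submodule.span_le.2 ?_)
      rintro y ⟨hy, ⟨a, ha⟩, -⟩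
      refine ⟨⟨y, hy⟩, ?_, rfl⟩
      rw [SetLike.mem_coe, Submodule.mem_comap, hψ]
      clear hψ ψ
      induction hw using Submodule.span_induction with
      | mem w hw => exact hL.act_derWord hm A hw a ⟨y, hy⟩ ha
      | zero => simp
      | add v w _ _ hv hw => rw [map_add]; exact add_mem hv hw
      | smul c w _ hw => rw [map_smul]; exact Submodule.smul_mem _ _ hw
    obtain ⟨x', hx', h⟩ := hle x.2
    rw [← Subtype.ext h]
    exact hx'
  -- The stabilizer of `R0` is a subalgebra containing L, hence all of U(L).
  let S : Subalgebra F (U L) :=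
    { carrier := {y | ∀ w ∈ R0, Ind.actHom A y w ∈ R0}
      mul_mem' := fun {y z} hy hz w hw => by
        rw [map_mul]; exact hy _ (hz _ hw)
      add_mem' := fun {y z} hy hz w hw => by
        rw [map_add]; exact add_mem (hy _ hw) (hz _ hw)
      algebraMap_mem' := fun r w hw => by
        rw [AlgHom.commutes]; exact Submodule.smul_mem _ _ hw }
  rw [eq_top_iff]
  intro w _
  induction w using Ind.induction with
  | tmul y v =>
    have := U_induction S hL0 y _ (Submodule.subset_span (IsGood.DerWord.base v))
    rw [Ind.actHom_tmul, mul_one] at this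
    exact hle this
  | add v w hv hw => exact add_mem (hv trivial) (hw trivial)

end Algebra

section Algebra

variable {F : Type*} [Field F] {p : ℕ} {k : ℕ} {m : Fin k → ℕ} {l : ℕ}
variable {V : Type*} [AddCommGroup V] [Module F V]
variable {L : Submodule F (Module.End F (O F p m l))}

/-! ## A spanning family of the induced module -/

variable (p m) in
/-- The exponent of `∂_s` that acts by zero on the induced module. -/
def nilExp : Var k l → ℕ := Sum.elim (fun i => p ^ m i) fun _ => 2

/-- The exponents of the monomial with a given index. -/
def exponents (a : Idx p m l) : Var k l → ℕ :=
  Sum.elim (fun i => (a.1 i : ℕ)) fun j => if j ∈ a.2 then 1 else 0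

theorem exists_exponents {e : Var k l → ℕ} (h : ∀ s, e s < nilExp p m s) :
    ∃ a : Idx p m l, exponents a = e := by
  refine ⟨(fun i => ⟨e (Sum.inl i), h (Sum.inl i)⟩,
    Finset.univ.filter fun j => e (Sum.inr j) = 1), funext fun s => ?_⟩
  rcases s with i | j
  · rfl
  · have := h (Sum.inr j)
    simp only [nilExp, Sum.elim_inr] at this
    simp only [exponents, Sum.elim_inr, Finset.mem_filter, Finset.mem_univ, true_and]
    split_ifs <;> omega

theorem exponents_lt [Fact p.Prime] (a : Idx p m l) (s : Var k l) :
    exponents a s < nilExp p m s := by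
  rcases s with i | j
  · exact (a.1 i).2
  · simp only [exponents, nilExp, Sum.elim_inr]
    split_ifs <;> omega

variable [Fact p.Prime] [CharP F p] [NeZero (2 : F)]

/-- The action of `∂_s` on the induced module. -/
def IsGood.actD (hL : IsGood L) (A : theta L →ₐ[F] Module.End F V) (s : Var k l) :
    Module.End F (Ind A) := Ind.actHom A (ι L (hL.d s))

theorem IsGood.actD_mul_actD (hL : IsGood L) (A : theta L →ₐ[F] Module.End F V) (s t : Var k l) :
    hL.actD A s * hL.actD A t = sgn F (vpar s * vpar t) • (hL.actD A t * hL.actD A s) := by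
  have h : ι L 0 = sbr F (vpar s) (vpar t) (ι L (hL.d s)) (ι L (hL.d t)) :=
    ι_sbr (der_mem_Epar s) (der_mem_Epar t)
      (show (0 : Module.End F (O F p m l)) = sbr F _ _ (der s) (der t) by
        rw [sbr, der_comp_der, sub_self])
  rw [map_zero, sbr, eq_comm, sub_eq_zero] at h
  rw [actD, actD, ← map_mul, h, map_smul, map_mul]

/-- For an even variable the power is some `z_i`: it kills 1 ⊗ V and commutes up to scalars with
every `∂_t`, so its kernel is everything by `IsGood.ind_eq_top`. For an odd one, anticommuting with
itself makes the square zero, as 2 is invertible. -/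
theorem IsGood.actD_pow (hL : IsGood L) (hm : ∀ i, 1 ≤ m i) {A : theta L →ₐ[F] Module.End F V}
    (hA : ∀ t : theta L, (t : U L) ∈ zset L → A t = 0) (s : Var k l) :
    hL.actD A s ^ nilExp p m s = 0 := by
  rcases s with i | j
  · have hz : ι L (hL.d (Sum.inl i)) ^ p ^ m i ∈ zset L := ⟨i, _, rfl, rfl⟩
    rw [nilExp, Sum.elim_inl, ← LinearMap.ker_eq_top]
    refine hL.ind_eq_top hm A _ (fun v => ?_) fun t w hw => ?_
    · rw [LinearMap.mem_ker, actD, ← map_pow, Ind.actHom_tmul, mul_one]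
      have := Ind.tmul_theta A ⟨_, Algebra.subset_adjoin (Or.inr hz)⟩ v
      rw [hA _ hz] at this
      rw [this, LinearMap.zero_apply, Ind.tmul, TensorProduct.tmul_zero, Submodule.Quotient.mk_zero]
    · obtain ⟨c, hc⟩ := exists_pow_mul (⟨_, hL.actD_mul_actD A (Sum.inl i) t⟩ :
        ∃ c : F, _ = c • _) (p ^ m i)
      rw [LinearMap.mem_ker] at hw ⊢
      rw [← actD, ← Module.End.mul_apply, hc, LinearMap.smul_apply, Module.End.mul_apply, hw,
        map_zero, smul_zero]
  · have h := hL.actD_mul_actD A (Sum.inr j) (Sum.inr j)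
    rw [vpar, Sum.elim_inr, mul_one, sgn_one] at h
    rw [nilExp, Sum.elim_inr, pow_two]
    refine LinearMap.ext fun w => ?_
    have hw := LinearMap.congr_fun h w
    rw [LinearMap.smul_apply, neg_one_smul, eq_neg_iff_add_eq_zero, ← two_smul F,
      smul_eq_zero] at hw
    exact hw.resolve_left two_ne_zero

/-- The map sending `(v_a)` to the sum of the `∂^a ⊗ v_a`. -/
def IsGood.monomialMap (hL : IsGood L) (A : theta L →ₐ[F] Module.End F V) :
    (Idx p m l → V) →ₗ[F] Ind A :=
  ∑ a, orderedMonomial (hL.actD A) (Finset.univ : Finset (Var k l)).toList (exponents a) ∘ₗ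
    ((balanced A).mkQ ∘ₗ TensorProduct.mk F (U L) V 1) ∘ₗ LinearMap.proj a

theorem IsGood.monomialMap_apply (hL : IsGood L) (A : theta L →ₐ[F] Module.End F V)
    (f : Idx p m l → V) : hL.monomialMap A f =
      ∑ a, orderedMonomial (hL.actD A) (Finset.univ : Finset (Var k l)).toList (exponents a)
        (Ind.tmul A 1 (f a)) := by
  rw [monomialMap, LinearMap.sum_apply]
  rfl

theorem IsGood.orderedMonomial_mem_range (hL : IsGood L) (A : theta L →ₐ[F] Module.End F V)
    (a : Idx p m l) (v : V) :
    orderedMonomial (hL.actD A) (Finset.univ : Finset (Var k l)).toList (exponents a)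
      (Ind.tmul A 1 v) ∈ LinearMap.range (hL.monomialMap A) := by
  refine ⟨Pi.single a v, ?_⟩
  rw [hL.monomialMap_apply, Finset.sum_eq_single a]
  · rw [Pi.single_eq_same]
  · intro b _ hb
    rw [Pi.single_eq_of_ne hb, Ind.tmul, TensorProduct.tmul_zero, Submodule.Quotient.mk_zero,
      map_zero]
  · simp

/-- The upper bound for the dimension of the induced module. Multiplication by `∂_s` raises one
exponent of an ordered monomial, which gives another monomial of the family or reaches `nilExp` and
vanishes. -/
theorem IsGood.monomialMap_surjective (hL : IsGood L) (hm : ∀ i, 1 ≤ m i)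
    {A : theta L →ₐ[F] Module.End F V} (hA : ∀ t : theta L, (t : U L) ∈ zset L → A t = 0) :
    Function.Surjective (hL.monomialMap A) := by
  rw [← LinearMap.range_eq_top]
  refine hL.ind_eq_top hm A _ (fun v => ?_) ?_
  · obtain ⟨a, ha⟩ := exists_exponents (p := p) (m := m) (l := l) (e := fun _ => 0) (by
      rintro (i | j)
      · exact pow_pos_prime i
      · exact two_pos)
    have := hL.orderedMonomial_mem_range A a v
    rwa [ha, orderedMonomial_zero, Module.End.one_apply] at this
  · rintro s _ ⟨f, rfl⟩
    rw [hL.monomialMap_apply, map_sum]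
    refine sum_mem fun a _ => ?_
    have hs : s ∈ (Finset.univ : Finset (Var k l)).toList := Finset.mem_toList.2 (Finset.mem_univ s)
    obtain ⟨c, hc⟩ := exists_mul_orderedMonomial (F := F)
      (fun i j => ⟨_, hL.actD_mul_actD A i j⟩) (Finset.nodup_toList _) hs (exponents a)
    rw [← actD, ← Module.End.mul_apply, hc, LinearMap.smul_apply]
    refine Submodule.smul_mem _ c ?_
    by_cases h : exponents a s + 1 < nilExp p m s
    · obtain ⟨b, hb⟩ := exists_exponents (p := p) (m := m)
        (e := Function.update (exponents a) s (exponents a s + 1)) (by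
          intro t
          rcases eq_or_ne t s with rfl | hts
          · rwa [Function.update_self]
          · rw [Function.update_of_ne hts]
            exact exponents_lt a t)
      rw [← hb]
      exact hL.orderedMonomial_mem_range A b _
    · rw [orderedMonomial_eq_zero hs (hL.actD_pow hm hA s)
        (by rw [Function.update_self]; exact not_lt.1 h), LinearMap.zero_apply]
      exact zero_mem _

/-! ## The mixed product is generated by its top component -/

theorem exists_der_bas {a : Idx p m l} (ha : a ≠ topIdx p m l) :
    ∃ (s : Var k l) (b : Idx p m l) (c : F), c ≠ 0 ∧ zdeg b = zdeg a + 1 ∧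
      der s (bas F p m l b) = c • bas F p m l a := by
  by_cases h : ∃ i, (a.1 i : ℕ) + 1 < p ^ m i
  · obtain ⟨i, hi⟩ := h
    have hlt : ∀ r, (a.1 r : ℕ) + (if r = i then 1 else 0) < p ^ m r := by
      intro r
      split_ifs with hr
      · exact hr ▸ hi
      · exact (a.1 r).2
    refine ⟨Sum.inl i, (fun r => ⟨_, hlt r⟩, a.2), 1, one_ne_zero, ?_, ?_⟩
    · simp [zdeg, Finset.sum_add_distrib]
      omega
    · rw [bas_eq_mono, der, Sum.elim_inl, Deven_mono i hlt, if_pos (by simp), one_smul,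
        bas_eq_mono a]
      simp
  · push Not at h
    have h2 : ∃ j, j ∉ a.2 := by
      by_contra! h2
      refine ha (Prod.ext (funext fun i => Fin.ext ?_) (Finset.eq_univ_iff_forall.2 h2))
      have := h i
      have := (a.1 i).2
      simp only [topIdx]
      omega
    obtain ⟨j, hj⟩ := h2
    refine ⟨Sum.inr j, (a.1, insert j a.2), (-1) ^ ((insert j a.2).filter (fun r => r < j)).card,
      pow_ne_zero _ (neg_ne_zero.2 one_ne_zero), ?_, ?_⟩
    · simp only [zdeg, Finset.card_insert_of_notMem hj]
      omega
    · rw [bas_eq_mono, der, Sum.elim_inr, dodd_mono, if_pos (Finset.mem_insert_self _ _),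
        Finset.erase_insert hj, ← bas_eq_mono a]

/-- Descending induction on the degree: every basis element except top is a nonzero multiple of a
derivative of one of degree one higher (`exists_der_bas`). -/
theorem tensor_eq_top (R : Submodule F (O F p m l ⊗[F] V))
    (h1 : ∀ v : V, top F p m l ⊗ₜ[F] v ∈ R)
    (h2 : ∀ s : Var k l, ∀ w ∈ R, TensorProduct.map (der s) LinearMap.id w ∈ R) : R = ⊤ := by
  have key : ∀ n : ℕ, ∀ a : Idx p m l, topDeg p m l - zdeg a = n →
      ∀ v : V, bas F p m l a ⊗ₜ[F] v ∈ R := by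
    intro n
    induction n with
    | zero =>
      intro a h v
      by_cases ha : a = topIdx p m l
      · exact ha ▸ h1 v
      · obtain ⟨s, b, c, -, hb, -⟩ := exists_der_bas (F := F) ha
        have := zdeg_le_topDeg b
        omega
    | succ n ih =>
      intro a h v
      by_cases ha : a = topIdx p m l
      · exact ha ▸ h1 v
      · obtain ⟨s, b, c, hc, hb, h⟩ := exists_der_bas (F := F) ha
        have := h2 s _ (ih b (by omega) v)
        rw [TensorProduct.map_tmul, h, ← TensorProduct.smul_tmul'] at this
        exact (Submodule.smul_mem_iff _ hc).1 this
  rw [eq_top_iff]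
  rintro w -
  induction w using TensorProduct.induction_on with
  | zero => exact zero_mem _
  | tmul f v =>
    rw [← (bas F p m l).sum_repr f, TensorProduct.sum_tmul]
    refine sum_mem fun a _ => ?_
    rw [← TensorProduct.smul_tmul']
    exact Submodule.smul_mem _ _ (key _ a rfl v)
  | add x y hx hy => exact add_mem hx hy

theorem IsGood.indMap_surjective (hL : IsGood L) (hm : ∀ i, 1 ≤ m i) (ρ : SuperRep (Lz L 0) V) :
    Function.Surjective (hL.indMap hm ρ) := by
  rw [← LinearMap.range_eq_top]
  refine tensor_eq_top _ (fun v => ⟨Ind.tmul _ 1 v, ?_⟩) ?_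
  · rw [hL.indMap_tmul, map_one]
    rfl
  · rintro s _ ⟨w, rfl⟩
    have h := hL.indMap_act hm ρ (ι L (hL.d s)) w
    rw [hL.UAct_ι, shiftedAct_der hm ρ (s := s) rfl, LinearMap.smul_apply] at h
    refine (Submodule.smul_mem_iff _ (sgn_ne_zero (F := F) (l * vpar s))).1 ?_
    rw [← h]
    exact ⟨_, rfl⟩

theorem IsGood.indMap_bijective [FiniteDimensional F V] (hL : IsGood L) (hm : ∀ i, 1 ≤ m i)
    (ρ : SuperRep (Lz L 0) V) : Function.Bijective (hL.indMap hm ρ) := by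
  have hG := hL.monomialMap_surjective hm (hL.isTwistedAction hm ρ).central
  have hs := (hL.indMap_surjective hm ρ).comp hG
  -- The composite goes from V-valued functions on the indices onto O ⊗ V, two spaces of equal
  -- finite dimension, so it is injective; since `monomialMap` is onto, `indMap` is injective too.
  have hi : Function.Injective (hL.indMap hm ρ ∘ₗ hL.monomialMap _) := by
    refine (LinearMap.injective_iff_surjective_of_finrank_eq_finrank ?_).2 hs
    rw [Module.finrank_tensorProduct, Module.finrank_eq_card_basis (bas F p m l),
      Module.finrank_pi_fintype]
    simp only [Finset.sum_const, Finset.card_univ, smul_eq_mul]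
  refine ⟨fun x y h => ?_, hL.indMap_surjective hm ρ⟩
  obtain ⟨x, rfl⟩ := hG x
  obtain ⟨y, rfl⟩ := hG y
  rw [hi h]

end Algebra

section Algebra

variable {F : Type*} [Field F] {p : ℕ} {k : ℕ} {m : Fin k → ℕ} {l : ℕ}
variable {L : Submodule F (Module.End F (O F p m l))}
variable [Fact p.Prime] [CharP F p] [NeZero (2 : F)]

/-! ## The supertrace of the action on `L / K` -/

variable (L) in
/-- The constant terms of the coefficients of a derivation in `L`. -/
def constCoeff : L →ₗ[F] Var k l → F :=
  LinearMap.pi fun q => eps ∘ₗ LinearMap.applyₗ (gen F p m q) ∘ₗ L.subtype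

theorem constCoeff_apply (y : L) (q : Var k l) :
    constCoeff L y q = eps ((y : Module.End F (O F p m l)) (gen F p m q)) := rfl

theorem IsGood.constCoeff_d (hL : IsGood L) (hm : ∀ i, 1 ≤ m i) (s : Var k l) :
    constCoeff L (hL.d s) = Pi.single s 1 := by
  funext q
  rw [constCoeff_apply, IsGood.d, der_gen hm, Pi.single_apply]
  split_ifs with h1 h2 h2
  · exact eps_one
  · exact absurd h1.symm h2
  · exact absurd h2.symm h1
  · exact map_zero _

/-- K consists of the derivations in L whose coefficients have no constant term, so L/K has the
classes of the `∂_s` as a basis. -/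
theorem IsGood.ker_constCoeff (hL : IsGood L) (hm : ∀ i, 1 ≤ m i) :
    (K L).submoduleOf L = LinearMap.ker (constCoeff L) := by
  ext y
  rw [LinearMap.mem_ker, Submodule.submoduleOf, Submodule.mem_comap, Submodule.subtype_apply]
  refine ⟨fun hy => funext fun q => eps_apply_of_mem_K hL hy _, fun hy => ?_⟩
  have h := hL.sub_mem_K hm y.2
  have h0 : ∀ q, eps ((y : Module.End F (O F p m l)) (gen F p m q)) = 0 := fun q => congrFun hy q
  simpa only [h0, zero_smul, Finset.sum_const_zero, sub_zero] using h

theorem IsGood.constCoeff_surjective (hL : IsGood L) (hm : ∀ i, 1 ≤ m i) :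
    Function.Surjective (constCoeff L) := by
  refine fun c => ⟨∑ s, c s • hL.d s, ?_⟩
  rw [map_sum]
  simp only [map_smul, hL.constCoeff_d hm]
  exact (pi_eq_sum_univ' c).symm

/-- The isomorphism of `L / K` onto the space with the basis of the `∂_s`. -/
def IsGood.quotEquiv (hL : IsGood L) (hm : ∀ i, 1 ≤ m i) : LmodK L ≃ₗ[F] (Var k l → F) :=
  (Submodule.quotEquivOfEq _ _ (hL.ker_constCoeff hm)).trans
    ((constCoeff L).quotKerEquivOfSurjective (hL.constCoeff_surjective hm))

theorem IsGood.quotEquiv_cls (hL : IsGood L) (hm : ∀ i, 1 ≤ m i) (y : L) :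
    hL.quotEquiv hm (cls L y) = constCoeff L y := rfl

theorem IsGood.isSigma (hL : IsGood L) (hm : ∀ i, 1 ≤ m i) :
    IsSigma L (sig F p m l ∘ₗ (K L).subtype) := by
  intro a x ha
  -- The matrix of `x` on L/K in the basis of the `∂_s`: in the bracket of `x` with `∂_s`, the term
  -- beginning with `x` has no constant terms on the variables, so only the other one, with its
  -- sign, contributes.
  let M : Matrix (Var k l) (Var k l) F := Matrix.of fun q s =>
    -(sgn F (a * vpar s) * kap q s (x : Module.End F (O F p m l)))
  have hM : ∀ q s, M q s = -(sgn F (a * vpar s) * kap q s (x : Module.End F (O F p m l))) :=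
    fun _ _ => rfl
  let N : Matrix (Var k l) (Var k l) F := Matrix.diagonal fun s => sgn F (vpar s)
  refine ⟨(hL.quotEquiv hm).symm.conj (Matrix.toLin' M),
    (hL.quotEquiv hm).symm.conj (Matrix.toLin' N), ?_, ?_, ?_⟩
  · intro b y z hy hz
    refine (hL.quotEquiv hm).injective ?_
    rw [LinearEquiv.conj_apply_apply, LinearEquiv.apply_symm_apply, LinearEquiv.symm_symm,
      hL.quotEquiv_cls, hL.quotEquiv_cls, Matrix.toLin'_apply]
    funext q
    rw [constCoeff_apply, hz, sbr, LinearMap.sub_apply, LinearMap.smul_apply,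
      Module.End.mul_apply, Module.End.mul_apply, map_sub, eps_apply_of_mem_K hL x.2, map_smul,
      eps_apply_of_mem_W hm (hL.le_W y.2), zero_sub, smul_eq_mul, Finset.mul_sum,
      ← Finset.sum_neg_distrib, Matrix.mulVec, dotProduct]
    refine Finset.sum_congr rfl fun s _ => ?_
    rw [hM, constCoeff_apply, ← kap_apply]
    by_cases h : vpar s = b
    · rw [h]
      ring
    · rw [eps_gen_eq_zero_of_Epar hy h]
      ring
  · intro b y hy
    refine (hL.quotEquiv hm).injective ?_
    rw [LinearEquiv.conj_apply_apply, LinearEquiv.apply_symm_apply, LinearEquiv.symm_symm,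
      map_smul, hL.quotEquiv_cls, Matrix.toLin'_apply]
    funext q
    rw [Matrix.mulVec_diagonal, Pi.smul_apply, smul_eq_mul, constCoeff_apply]
    by_cases h : vpar q = b
    · rw [h]
    · rw [eps_gen_eq_zero_of_Epar hy h, mul_zero, mul_zero]
  · rw [Module.End.mul_eq_comp, ← LinearEquiv.conj_comp, LinearMap.trace_conj', ← Matrix.toLin'_mul,
      Matrix.trace_toLin'_eq, LinearMap.comp_apply, Submodule.subtype_apply,
      sig_apply, ← Finset.sum_neg_distrib, Matrix.trace]
    refine Finset.sum_congr rfl fun s _ => ?_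
    rw [Matrix.diag_apply, Matrix.mul_diagonal, hM]
    -- For odd `x` the diagonal entries vanish by parity, and for even `x` the sign in `M` is 1;
    -- either way it drops out of the trace.
    by_cases h : a = 0
    · rw [h, zero_mul, sgn_zero]
      ring
    · rw [kap_eq_zero_of_Epar ha (by simpa using h)]
      ring

end Algebra

end

end CartanSuper

/-! ### The isomorphism theorem for W, S and H -/

theorem mainTheorem1 {F : Type*} [Field F] (p : ℕ) [Fact p.Prime] [CharP F p] (hp : p ≠ 2)
    {k l : ℕ} (hk : 1 ≤ k) (hl : 1 ≤ l) (m : Fin k → ℕ) (hm : ∀ i, 1 ≤ m i)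
    (L : Submodule F (Module.End F (CartanSuper.O F p m l)))
    (hL : L = CartanSuper.W F p m l ∨ L = CartanSuper.S F p m l ∨
      (Even k ∧ L = CartanSuper.H F p m l))
    {V : Type*} [AddCommGroup V] [Module F V] [FiniteDimensional F V]
    (ρ : CartanSuper.SuperRep (CartanSuper.Lz L 0) V) :
    ∃ (σ : CartanSuper.K L →ₗ[F] F) (A : CartanSuper.theta L →ₐ[F] Module.End F V),
      CartanSuper.IsSigma L σ ∧ CartanSuper.IsTwistedAction ρ σ A ∧
      ∃ (c : ZMod 2) (T : CartanSuper.Ind A ≃ₗ[F] (CartanSuper.O F p m l ⊗[F] V)),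
        CartanSuper.IsModuleIso ρ A c T := by
  have : NeZero (2 : F) := ⟨fun h => by
    have h2 : ((2 : ℕ) : F) = 0 := by exact_mod_cast h
    rw [CharP.cast_eq_zero_iff F p] at h2
    exact hp ((Nat.prime_dvd_prime_iff_eq Fact.out Nat.prime_two).1 h2)⟩
  have hgood : CartanSuper.IsGood L := by
    rcases hL with rfl | rfl | ⟨hk2, rfl⟩
    · exact CartanSuper.isGood_W hm
    · exact CartanSuper.isGood_S hk hl hm
    · exact CartanSuper.isGood_H hk hk2 hm
  exact ⟨_, _, hgood.isSigma hm, hgood.isTwistedAction hm ρ, _, _,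
    hgood.isModuleIso hm ρ (hgood.indMap_bijective hm ρ)⟩
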